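/- Let $p$ be an odd prime, $V$ an $n$-dimensional vector space over $\mathbb{F}_p$ with a non-degenerate symmetric bilinear form $\langle\cdot,\cdot\rangle$, $\xi=e^{2\pi i/p}$, and let $s$ be an integer with $0\le s\le n-2$ and $n+s\ge 4$ if $n+s$ is even, and $0\le s\le n-1$ and $n+s\ge 3$ if $n+s$ is odd. Definitions. For $f:V\to\mathbb{F}_p$ put $\widehat{\chi_f}(\alpha)=\sum_{x\in V}\xi^{f(x)-\langle\alpha,x\rangle}$. The function $f$ is $s$-plateaued if $|\widehat{\chi_f}(\alpha)|\in\{0,p^{(n+s)/2}\}$ for all $\alpha$; then $S=\{\alpha:|\widehat{\chi_f}(\alpha)|=p^{(n+s)/2}\}$. Let $\mu=1$ if $p^{n+s}\equiv1\pmod 4$ and $\mu=\sqrt{-1}$ if $p^{n+s}\equiv 3\pmod 4$. For $\alpha\in S$ one has $\widehat{\chi_f}(\alpha)=\epsilon_\alpha\,\mu\, p^{(n+s)/2}\xi^{f^*(\alpha)}$ with a unique sign $\epsilon_\alpha=\pm1$ and a unique $f^*(\alpha)\in\mathbb{F}_p$; let $B_\pm(f)=\{\alpha\in S:\epsilon_\alpha=\pm1\}$.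 The dual $f^*:S\to\mathbb{F}_p$ is called bent relative to $S$ if $\widehat{\chi_{f^*}}(\alpha)=\sum_{x\in S}\xi^{f^*(x)-\langle\alpha,x\rangle}$ satisfies $|\widehat{\chi_{f^*}}(\alpha)|=(\#S)^{1/2}$ for all $\alpha\in V$. Put $B_\pm(f^*)=\{\alpha\in V:\widehat{\chi_{f^*}}(\alpha)=\pm\mu p^{(n-s)/2}\xi^{f(-\alpha)}\}$. The class $\mathscr{F}$ consists of the $s$-plateaued $f$ such that (1) $f(0)=0$; (2) $f^*$ is bent relative to $S$; (3) $aB_+(f^*)\subseteq B_+(f^*)$ and $aB_-(f^*)\subseteq B_-(f^*)$ for all $a\in\mathbb{F}_p^*$; (4) there are integers $t,t'\in[2,p-1]$ with $\gcd(t-1,p-1)=\gcd(t'-1,p-1)=1$ such that, for all $a\in\mathbb{F}_p^*$, $f(ax)=a^tf(x)$ for $x\in B_+(f^*)$ and $f(ax)=a^{t'}f(x)$ for $x\in B_-(f^*)$. Theorem. Let $f\in\mathscr{F}$ be $s$-plateaued, $k=\#B_+(f)$, and $$\widetilde{\mathcal C}_f=\{(af(x)+\langle b,x\rangle)_{x\in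 V,\,f(x)\ne0}: a\in\mathbb{F}_p,\ b\in V\}.$$ Then $0\in S$ if $n+s$ is even, so that $\epsilon_0$ is defined. Put $m=(p-1)(p^{n-1}-\epsilon_0p^{\frac{n+s}2-1})$ if $n+s$ is even, and $m=(p-1)p^{n-1}$ if $n+s$ is odd. Then $\widetilde{\mathcal C}_f$ is a $p$-ary $[m,n+1]$ linear code whose weight distribution is the following (multiplicities of rows with equal weights are to be added). If $n+s$ is even, with the first multiplicity for $0\in B_+(f)$ and the second for $0\in B_-(f)$: - weight $0$: $1$; $1$. - weight $(p-1)^2(p^{n-2}-\epsilon_0p^{\frac{n+s}2-2})$: $p^{n+1}-p^{n-s+1}$; $p^{n+1}-p^{n-s+1}$. - weight $(p-1)^2p^{n-2}$: $\frac kp+(p-1)p^{\frac{n-s}2-1}-1$; $p^{n-s-1}-(p-1)p^{\frac{n-s}2-1}-\frac kp-1$. - weight $(p-1)^2(p^{n-2}-2\epsilon_0p^{\frac{n+s}2-2})$: $p^{n-s-1}-\frac kp$; $\frac kp$. - weight $(p-1)(p^{n-1}-p^{n-2}-\epsilon_0p^{\frac{n+s}2-1})$: $(p-1)(\frac{2k}p+(p-2)p^{\frac{n-s}2-1}-1)$;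 $(p-1)(2p^{n-s-1}-(p-2)p^{\frac{n-s}2-1}-\frac{2k}p-1)$. - weight $(p-1)((p-1)p^{n-2}-\epsilon_0(p-2)p^{\frac{n+s}2-2})$: $2(p-1)(p^{n-s-1}-\frac kp)$; $2(p-1)\frac kp$. - weight $(p-1)(p^{n-1}-\epsilon_0p^{\frac{n+s}2-1})$: $p-1$; $p-1$. - weight $(p-1)^2p^{n-2}-\epsilon_0(p-2)p^{\frac{n+s}2-1}$: $(p-1)^2(\frac kp-p^{\frac{n-s}2-1})$; $(p-1)^2(p^{n-s-1}+p^{\frac{n-s}2-1}-\frac kp)$. - weight $(p-1)^2p^{n-2}-\epsilon_0(p^2-2p+2)p^{\frac{n+s}2-2}$: $(p-1)^2(p^{n-s-1}-\frac kp)$; $(p-1)^2\frac kp$. If $n+s$ is odd: - weight $0$: $1$. - weight $(p-1)^2p^{n-2}$: $p^{n+1}-p^{n-s+1}+p^{n-s}-p$. - weight $(p-1)(p^{n-1}-p^{n-2}+p^{\frac{n+s-3}2})$: $\frac{p-1}2(p^{n-s-1}+p^{\frac{n-s-1}2})$. - weight $(p-1)(p^{n-1}-p^{n-2}-p^{\frac{n+s-3}2})$: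 $\frac{p-1}2(p^{n-s-1}-p^{\frac{n-s-1}2})$. - weight $(p-1)^2p^{n-2}-p^{\frac{n+s-3}2}$: $\frac{(p-1)^2}2(p^{n-s-1}+p^{\frac{n-s-1}2})$. - weight $(p-1)^2p^{n-2}+p^{\frac{n+s-3}2}$: $\frac{(p-1)^2}2(p^{n-s-1}-p^{\frac{n-s-1}2})$. - weight $(p-1)p^{n-1}$: $p-1$. The dual code $\widetilde{\mathcal C}_f^{\perp}$ (with respect to the standard dot product) is an $[m,\,m-n-1,\,3]$ linear code, i.e. its minimum Hamming distance is exactly $3$. Moreover, if $p\ne3$, or if $p=3$ and $n+s\ge5$, then $\widetilde{\mathcal C}_f\subseteq\widetilde{\mathcal C}_f^{\perp}$. -/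

import Mathlib

namespace PlateauedCode

/-! ### Walsh transform, plateaued functions and their duals -/

section Functions

variable {p : ℕ} [Fact p.Prime] {V : Type*} [AddCommGroup V] [Module (ZMod p) V] [Fintype V]

/-- Relative Walsh transform `α ↦ ∑_{x ∈ S} ξ^(g x - ⟨α, x⟩)`, where `ξ = exp (2πi / p)`;
`ZMod.stdAddChar j` is `ξ ^ j`. Only the values of `g` on `S` matter. -/
noncomputable def walshOn (B : LinearMap.BilinForm (ZMod p) V) (S : Set V) (g : V → ZMod p)
    (α : V) : ℂ :=
  open scoped Classical in
  ∑ x : V, if x ∈ S then ZMod.stdAddChar (g x - B α x) else 0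

/-- The Walsh transform `α ↦ ∑_x ξ^(f x - ⟨α, x⟩)`. -/
noncomputable def walsh (B : LinearMap.BilinForm (ZMod p) V) (f : V → ZMod p) (α : V) : ℂ :=
  ∑ x : V, ZMod.stdAddChar (f x - B α x)

/-- The real number `p ^ ((n + s) / 2)`, where `n` is the dimension of `V`. -/
noncomputable def amp (p : ℕ) (V : Type*) [AddCommGroup V] [Fact p.Prime] [Module (ZMod p) V]
    (s : ℕ) : ℝ :=
  (p : ℝ) ^ (((Module.finrank (ZMod p) V : ℝ) + (s : ℝ)) / 2)

/-- The real number `p ^ ((n - s) / 2)`, where `n` is the dimension of `V`. -/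
noncomputable def dualAmp (p : ℕ) (V : Type*) [AddCommGroup V] [Fact p.Prime] [Module (ZMod p) V]
    (s : ℕ) : ℝ :=
  (p : ℝ) ^ (((Module.finrank (ZMod p) V : ℝ) - (s : ℝ)) / 2)

/-- `μ = 1` if `p ^ (n + s) ≡ 1 (mod 4)`, and `μ = √-1` otherwise
(for odd `p`, this means `p ^ (n + s) ≡ 3 (mod 4)`). -/
noncomputable def mu (p : ℕ) (V : Type*) [AddCommGroup V] [Fact p.Prime] [Module (ZMod p) V]
    (s : ℕ) : ℂ :=
  if p ^ (Module.finrank (ZMod p) V + s) % 4 = 1 then 1 else Complex.I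

/-- `f` is `s`-plateaued. -/
def IsPlateaued (B : LinearMap.BilinForm (ZMod p) V) (s : ℕ) (f : V → ZMod p) : Prop :=
  s ≤ Module.finrank (ZMod p) V ∧ ∀ α, ‖walsh B f α‖ = 0 ∨ ‖walsh B f α‖ = amp p V s

/-- The Walsh support of an `s`-plateaued function. -/
def walshSupport (B : LinearMap.BilinForm (ZMod p) V) (s : ℕ) (f : V → ZMod p) : Set V :=
  {α | ‖walsh B f α‖ = amp p V s}

open scoped Classical in
/-- The dual `f*` of an `s`-plateaued function: `f* α` is the (unique) `j` for which the Walsh value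
at `α` is `± μ p^((n+s)/2) ξ^j`. It is meaningful on the Walsh support only, and it is only
evaluated there. -/
noncomputable def dual (B : LinearMap.BilinForm (ZMod p) V) (s : ℕ) (f : V → ZMod p) (α : V) :
    ZMod p :=
  if h : ∃ j : ZMod p,
      walsh B f α = mu p V s * (amp p V s : ℂ) * ZMod.stdAddChar j ∨
      walsh B f α = -(mu p V s * (amp p V s : ℂ) * ZMod.stdAddChar j)
  then h.choose else 0

/-- The set `B₊(f)`. -/
def Bplus (B : LinearMap.BilinForm (ZMod p) V) (s : ℕ) (f : V → ZMod p) : Set V :=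
  {α | α ∈ walshSupport B s f ∧
    walsh B f α = mu p V s * (amp p V s : ℂ) * ZMod.stdAddChar (dual B s f α)}

/-- The set `B₋(f)`. -/
def Bminus (B : LinearMap.BilinForm (ZMod p) V) (s : ℕ) (f : V → ZMod p) : Set V :=
  {α | α ∈ walshSupport B s f ∧
    walsh B f α = -(mu p V s * (amp p V s : ℂ) * ZMod.stdAddChar (dual B s f α))}

open scoped Classical in
/-- The sign `ε_α`: it is `1` on `B₊(f)` and `-1` on `B₋(f)` (and `0`, a dummy value, elsewhere). -/
noncomputable def eps (B : LinearMap.BilinForm (ZMod p) V) (s : ℕ) (f : V → ZMod p) (α : V) : ℤ :=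
  if α ∈ Bplus B s f then 1 else if α ∈ Bminus B s f then -1 else 0

/-- `g` is bent relative to `S`. -/
def IsBentRel (B : LinearMap.BilinForm (ZMod p) V) (S : Set V) (g : V → ZMod p) : Prop :=
  ∀ α, ‖walshOn B S g α‖ = Real.sqrt (S.ncard : ℝ)

/-- The set `B₊(f*)`. -/
def BplusDual (B : LinearMap.BilinForm (ZMod p) V) (s : ℕ) (f : V → ZMod p) : Set V :=
  {α | walshOn B (walshSupport B s f) (dual B s f) α =
    mu p V s * (dualAmp p V s : ℂ) * ZMod.stdAddChar (f (-α))}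

/-- The set `B₋(f*)`. -/
def BminusDual (B : LinearMap.BilinForm (ZMod p) V) (s : ℕ) (f : V → ZMod p) : Set V :=
  {α | walshOn B (walshSupport B s f) (dual B s f) α =
    -(mu p V s * (dualAmp p V s : ℂ) * ZMod.stdAddChar (f (-α)))}

/-- On `S`, the function `f` is homogeneous of some degree `t` with `2 ≤ t ≤ p - 1` and
`gcd (t - 1, p - 1) = 1`. -/
def IsFormOn (S : Set V) (f : V → ZMod p) : Prop :=
  ∃ t : ℕ, 2 ≤ t ∧ t ≤ p - 1 ∧ Nat.gcd (t - 1) (p - 1) = 1 ∧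
    ∀ a : ZMod p, a ≠ 0 → ∀ x ∈ S, f (a • x) = a ^ t * f x

/-- The `s`-plateaued functions in the class `𝓕`. -/
structure MemF (B : LinearMap.BilinForm (ZMod p) V) (s : ℕ) (f : V → ZMod p) : Prop where
  plateaued : IsPlateaued B s f
  map_zero : f 0 = 0
  dual_bent : IsBentRel B (walshSupport B s f) (dual B s f)
  smul_plus : ∀ x ∈ BplusDual B s f, ∀ a : ZMod p, a ≠ 0 → a • x ∈ BplusDual B s f
  smul_minus : ∀ x ∈ BminusDual B s f, ∀ a : ZMod p, a ≠ 0 → a • x ∈ BminusDual B s f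
  form_plus : IsFormOn (BplusDual B s f) f
  form_minus : IsFormOn (BminusDual B s f) f

end Functions

/-! ### Linear codes -/

section Codes

variable {F : Type*} [Field F] [DecidableEq F] {ι : Type*} [Fintype ι]

/-- `C` is an `[m, k]` linear code. -/
def HasParams (C : Submodule F (ι → F)) (m k : ℤ) : Prop :=
  (Fintype.card ι : ℤ) = m ∧ (Module.finrank F C : ℤ) = k

/-- `C` has minimum Hamming distance `d`. -/
def HasMinDist (C : Submodule F (ι → F)) (d : ℕ) : Prop :=
  IsLeast {m : ℕ | ∃ x ∈ C, ∃ y ∈ C, x ≠ y ∧ hammingDist x y = m} d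

/-- The dual code. -/
def dualCode (C : Submodule F (ι → F)) : Submodule F (ι → F) where
  carrier := {x | ∀ y ∈ C, x ⬝ᵥ y = 0}
  add_mem' := by
    intro a b ha hb y hy
    rw [add_dotProduct, ha y hy, hb y hy, add_zero]
  zero_mem' := by
    intro y _
    exact zero_dotProduct y
  smul_mem' := by
    intro c x hx y hy
    rw [smul_dotProduct, hx y hy, smul_zero]

/-- `C` is self-orthogonal. -/
def IsSelfOrthogonal (C : Submodule F (ι → F)) : Prop := C ≤ dualCode C

/-- The weight distribution of `C` is given by the table `T`, a list of rows
`(weight, multiplicity)`. Rows in which the same weight occurs are added up. -/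
def HasWeightTable (C : Submodule F (ι → F)) (T : List (ℤ × ℚ)) : Prop :=
  ∀ w : ℤ, (({c : ι → F | c ∈ C ∧ (hammingNorm c : ℤ) = w}.ncard : ℕ) : ℚ) =
    ((T.filter (fun r => r.1 = w)).map Prod.snd).sum

end Codes

/-- The punctured code `{ (a f(x) + ⟨b, x⟩)_{x : f x ≠ 0} : a ∈ 𝔽_p, b ∈ V }`. -/
def puncturedCode {p : ℕ} [Fact p.Prime] {V : Type*} [AddCommGroup V] [Module (ZMod p) V]
    (B : LinearMap.BilinForm (ZMod p) V) (f : V → ZMod p) :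
    Submodule (ZMod p) ({x : V // f x ≠ 0} → ZMod p) where
  carrier := {c | ∃ (a : ZMod p) (b : V), c = fun x => a * f x.1 + B b x.1}
  add_mem' := by
    rintro _ _ ⟨a, b, rfl⟩ ⟨a', b', rfl⟩
    refine ⟨a + a', b + b', ?_⟩
    funext x
    simp only [Pi.add_apply, map_add, LinearMap.add_apply]
    ring
  zero_mem' := ⟨0, 0, by funext x; simp⟩
  smul_mem' := by
    rintro c _ ⟨a, b, rfl⟩
    refine ⟨c * a, c • b, ?_⟩
    funext x
    simp only [Pi.smul_apply, map_smul, LinearMap.smul_apply, smul_eq_mul]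
    ring

/-! ### The weight distributions -/

/-- Weights and multiplicities for `n + s` even and `0 ∈ B₊(f)` (so `ε₀ = 1`); `k = #B₊(f)`. -/
def tableEvenPlus (p n s k : ℕ) : List (ℤ × ℚ) :=
  [(0, 1),
   (((p : ℤ) - 1) ^ 2 * ((p : ℤ) ^ (n - 2) - (p : ℤ) ^ ((n + s) / 2 - 2)),
     (p : ℚ) ^ (n + 1) - (p : ℚ) ^ (n - s + 1)),
   (((p : ℤ) - 1) ^ 2 * (p : ℤ) ^ (n - 2),
     (k : ℚ) / p + ((p : ℚ) - 1) * (p : ℚ) ^ ((n - s) / 2 - 1) - 1),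
   (((p : ℤ) - 1) ^ 2 * ((p : ℤ) ^ (n - 2) - 2 * (p : ℤ) ^ ((n + s) / 2 - 2)),
     (p : ℚ) ^ (n - s - 1) - (k : ℚ) / p),
   (((p : ℤ) - 1) * ((p : ℤ) ^ (n - 1) - (p : ℤ) ^ (n - 2) - (p : ℤ) ^ ((n + s) / 2 - 1)),
     ((p : ℚ) - 1) * (2 * (k : ℚ) / p + ((p : ℚ) - 2) * (p : ℚ) ^ ((n - s) / 2 - 1) - 1)),
   (((p : ℤ) - 1) * (((p : ℤ) - 1) * (p : ℤ) ^ (n - 2)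
       - ((p : ℤ) - 2) * (p : ℤ) ^ ((n + s) / 2 - 2)),
     2 * ((p : ℚ) - 1) * ((p : ℚ) ^ (n - s - 1) - (k : ℚ) / p)),
   (((p : ℤ) - 1) * ((p : ℤ) ^ (n - 1) - (p : ℤ) ^ ((n + s) / 2 - 1)),
     (p : ℚ) - 1),
   (((p : ℤ) - 1) ^ 2 * (p : ℤ) ^ (n - 2) - ((p : ℤ) - 2) * (p : ℤ) ^ ((n + s) / 2 - 1),
     ((p : ℚ) - 1) ^ 2 * ((k : ℚ) / p - (p : ℚ) ^ ((n - s) / 2 - 1))),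
   (((p : ℤ) - 1) ^ 2 * (p : ℤ) ^ (n - 2)
       - ((p : ℤ) ^ 2 - 2 * (p : ℤ) + 2) * (p : ℤ) ^ ((n + s) / 2 - 2),
     ((p : ℚ) - 1) ^ 2 * ((p : ℚ) ^ (n - s - 1) - (k : ℚ) / p))]

/-- Weights and multiplicities for `n + s` even and `0 ∈ B₋(f)` (so `ε₀ = -1`); `k = #B₊(f)`. -/
def tableEvenMinus (p n s k : ℕ) : List (ℤ × ℚ) :=
  [(0, 1),
   (((p : ℤ) - 1) ^ 2 * ((p : ℤ) ^ (n - 2) + (p : ℤ) ^ ((n + s) / 2 - 2)),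
     (p : ℚ) ^ (n + 1) - (p : ℚ) ^ (n - s + 1)),
   (((p : ℤ) - 1) ^ 2 * (p : ℤ) ^ (n - 2),
     (p : ℚ) ^ (n - s - 1) - ((p : ℚ) - 1) * (p : ℚ) ^ ((n - s) / 2 - 1) - (k : ℚ) / p - 1),
   (((p : ℤ) - 1) ^ 2 * ((p : ℤ) ^ (n - 2) + 2 * (p : ℤ) ^ ((n + s) / 2 - 2)),
     (k : ℚ) / p),
   (((p : ℤ) - 1) * ((p : ℤ) ^ (n - 1) - (p : ℤ) ^ (n - 2) + (p : ℤ) ^ ((n + s) / 2 - 1)),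
     ((p : ℚ) - 1) * (2 * (p : ℚ) ^ (n - s - 1) - ((p : ℚ) - 2) * (p : ℚ) ^ ((n - s) / 2 - 1)
       - 2 * (k : ℚ) / p - 1)),
   (((p : ℤ) - 1) * (((p : ℤ) - 1) * (p : ℤ) ^ (n - 2)
       + ((p : ℤ) - 2) * (p : ℤ) ^ ((n + s) / 2 - 2)),
     2 * ((p : ℚ) - 1) * ((k : ℚ) / p)),
   (((p : ℤ) - 1) * ((p : ℤ) ^ (n - 1) + (p : ℤ) ^ ((n + s) / 2 - 1)),
     (p : ℚ) - 1),
   (((p : ℤ) - 1) ^ 2 * (p : ℤ) ^ (n - 2) + ((p : ℤ) - 2) * (p : ℤ) ^ ((n + s) / 2 - 1),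
     ((p : ℚ) - 1) ^ 2 * ((p : ℚ) ^ (n - s - 1) + (p : ℚ) ^ ((n - s) / 2 - 1) - (k : ℚ) / p)),
   (((p : ℤ) - 1) ^ 2 * (p : ℤ) ^ (n - 2)
       + ((p : ℤ) ^ 2 - 2 * (p : ℤ) + 2) * (p : ℤ) ^ ((n + s) / 2 - 2),
     ((p : ℚ) - 1) ^ 2 * ((k : ℚ) / p))]

/-- Weights and multiplicities for `n + s` odd. -/
def tableOdd (p n s : ℕ) : List (ℤ × ℚ) :=
  [(0, 1),
   (((p : ℤ) - 1) ^ 2 * (p : ℤ) ^ (n - 2),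
     (p : ℚ) ^ (n + 1) - (p : ℚ) ^ (n - s + 1) + (p : ℚ) ^ (n - s) - p),
   (((p : ℤ) - 1) * ((p : ℤ) ^ (n - 1) - (p : ℤ) ^ (n - 2) + (p : ℤ) ^ ((n + s - 3) / 2)),
     ((p : ℚ) - 1) / 2 * ((p : ℚ) ^ (n - s - 1) + (p : ℚ) ^ ((n - s - 1) / 2))),
   (((p : ℤ) - 1) * ((p : ℤ) ^ (n - 1) - (p : ℤ) ^ (n - 2) - (p : ℤ) ^ ((n + s - 3) / 2)),
     ((p : ℚ) - 1) / 2 * ((p : ℚ) ^ (n - s - 1) - (p : ℚ) ^ ((n - s - 1) / 2))),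
   (((p : ℤ) - 1) ^ 2 * (p : ℤ) ^ (n - 2) - (p : ℤ) ^ ((n + s - 3) / 2),
     ((p : ℚ) - 1) ^ 2 / 2 * ((p : ℚ) ^ (n - s - 1) + (p : ℚ) ^ ((n - s - 1) / 2))),
   (((p : ℤ) - 1) ^ 2 * (p : ℤ) ^ (n - 2) + (p : ℤ) ^ ((n + s - 3) / 2),
     ((p : ℚ) - 1) ^ 2 / 2 * ((p : ℚ) ^ (n - s - 1) - (p : ℚ) ^ ((n - s - 1) / 2))),
   (((p : ℤ) - 1) * (p : ℤ) ^ (n - 1), (p : ℚ) - 1)]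

end PlateauedCode

open PlateauedCode

/-! Every codeword weight is an affine combination of numbers `N_b` of solutions of `f x = ⟨b, x⟩`,
so the theorem reduces to the distribution of `N_b` as `b` runs through `V`.

Arithmetic. A Walsh value of absolute value `p^((n+s)/2)` lies in `ℤ[ξ]`. Since `p` is totally
ramified there, and an algebraic integer all of whose conjugates have absolute value 1 is a root of
unity, it equals `±μ p^((n+s)/2) ξ^j` (`exists_charSum_eq_gam_mul`). The only integral relation
among the `p`-th roots of unity is that they sum to zero, so this identity determines every
coefficient (`IsGaussVector.mul_coeff_eq`). Hence `N_b = p^(n-1) + p e_b`, where the excess `e_b`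
depends only on `ε_b` and `f* b`.

Distribution. Fourier inversion gives the difference of the sums of `ξ^(f* x - ⟨α, x⟩)` over `B₊(f)`
and `B₋(f)`; relative bentness gives their sum up to a root of unity, and comparing coefficients mod
2 shows that it carries the same exponent `f(-α)` (`walshOn_dual_eq`). For `n + s` even, the case `α
= 0` counts the zeros of `f*` on each set. For `n + s` odd, the excess takes three values `0, ±P`,
and its first two moments determine its distribution.

Homogeneity. Because `t - 1` and `t' - 1` are prime to `p - 1`, one has `N_(zb) = N_b` for `z ≠ 0`
(`solCard_smul`), so a weight depends only on `e_0`, `e_b` and on whether `a` and `b` vanish. Also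
`t`, `t'` are even, so `f` is even, which feeds all parity arguments.

Dual code. Its words are the linear relations between the vectors `(f x, x)`. Weight 2 would give `l
≠ 1` with `l^(t-1) = 1`; weight 3 comes from `x, -x, 2x` if `p ≥ 5` and from a counting argument if
`p = 3`. Self-orthogonality follows from fibre sizes divisible by `p`, evenness of `f`, and either
scaling by 2 or, for `p = 3`, divisibility of weights by 3. -/

namespace PlateauedCode

/-! ### Integer combinations of `p`-th roots of unity -/

section RootsOfUnity

variable {p : ℕ} [Fact p.Prime]

/-- The element `∑ c_l ξ^l` of `ℤ[ξ] ⊆ ℂ`. -/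
noncomputable def charSum (c : ZMod p → ℤ) : ℂ := ∑ l, (c l : ℂ) * ZMod.stdAddChar l

theorem stdAddChar_one_isPrimitiveRoot :
    IsPrimitiveRoot (ZMod.stdAddChar (1 : ZMod p) : ℂ) p := by
  have h := Complex.isPrimitiveRoot_exp p (NeZero.ne p)
  have h2 := ZMod.stdAddChar_coe (N := p) 1
  simp only [Int.cast_one, mul_one] at h2
  rwa [h2]

theorem stdAddChar_eq_pow (l : ZMod p) :
    (ZMod.stdAddChar l : ℂ) = ZMod.stdAddChar (1 : ZMod p) ^ l.val := by
  rw [← AddChar.map_nsmul_eq_pow, nsmul_eq_mul, mul_one, ZMod.natCast_zmod_val]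

theorem norm_stdAddChar (l : ZMod p) : ‖(ZMod.stdAddChar l : ℂ)‖ = 1 := by
  rw [ZMod.stdAddChar_apply]; exact Circle.norm_coe _

theorem stdAddChar_ne_zero (l : ZMod p) : (ZMod.stdAddChar l : ℂ) ≠ 0 := by
  intro h
  have := norm_stdAddChar l
  simp [h] at this

theorem conj_stdAddChar (l : ZMod p) :
    (starRingEnd ℂ) (ZMod.stdAddChar l : ℂ) = ZMod.stdAddChar (-l) := by
  rw [ZMod.stdAddChar_apply, ZMod.stdAddChar_apply, AddChar.map_neg_eq_inv, Circle.coe_inv_eq_conj]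

/-- The only integral relation among the `p`-th roots of unity is that they sum to zero. -/
theorem charSum_eq_zero_iff (c : ZMod p → ℤ) : charSum c = 0 ↔ ∀ i j, c i = c j := by
  have hp := (Fact.out : p.Prime)
  rw [charSum]
  obtain ⟨q, rfl⟩ : ∃ q, p = q + 1 := ⟨p - 1, by have := hp.pos; omega⟩
  refine Iff.trans (Eq.congr_left (Finset.sum_congr rfl fun l _ => ?_))
    (IsPrimitiveRoot.sum_eq_zero_iff_forall_eq_int hp
      (stdAddChar_one_isPrimitiveRoot (p := q + 1)) c)
  rw [stdAddChar_eq_pow]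
  rfl

theorem charSum_sub (c d : ZMod p → ℤ) : charSum (c - d) = charSum c - charSum d := by
  simp [charSum, sub_mul, Finset.sum_sub_distrib]

theorem charSum_add (c d : ZMod p → ℤ) : charSum (c + d) = charSum c + charSum d := by
  simp [charSum, add_mul, Finset.sum_add_distrib]

theorem charSum_smul (a : ℤ) (c : ZMod p → ℤ) : charSum (a • c) = a * charSum c := by
  simp [charSum, Finset.mul_sum, mul_assoc]

theorem charSum_shift (c : ZMod p → ℤ) (j : ZMod p) :
    charSum (fun l => c (l - j)) = charSum c * ZMod.stdAddChar j := by
  rw [charSum, charSum, Finset.sum_mul, ← Equiv.sum_comp (Equiv.addRight j)]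
  refine Finset.sum_congr rfl fun l _ => ?_
  simp [AddChar.map_add_eq_mul, mul_assoc]

open NumberField in
/-- In the ring of integers of the `p`-th cyclotomic field, two elements `x`, `y` with
`x * σ x = y * σ y = p ^ N` are associated: `p` is totally ramified. -/
theorem associated_of_mul_map_eq_pow {K : Type*} [Field K] [NumberField K]
    [IsCyclotomicExtension {p} ℚ K] (σ : 𝓞 K ≃ₐ[ℤ] 𝓞 K) {x y : 𝓞 K} {N : ℕ}
    (hx : x * σ x = (p : 𝓞 K) ^ N) (hy : y * σ y = (p : 𝓞 K) ^ N) : Associated x y := by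
  have hζ := IsCyclotomicExtension.zeta_spec p ℚ K
  set π : 𝓞 K := hζ.toInteger - 1 with hπ
  have hπp : Prime π := hζ.zeta_sub_one_prime'
  have hσ : Associated π (σ π) := hζ.toInteger_isPrimitiveRoot.associated_sub_one_map_sub_one σ
  obtain ⟨u, hu⟩ : Associated (π ^ (p - 1)) (p : 𝓞 K) :=
    IsCyclotomicExtension.Rat.associated_zeta_sub_one_pow_prime p hζ
  -- Up to units `p` is a power of the prime `π`, so `z` and `σ z` are associated to powers of `π`.
  -- As `σ π` is associated to `π`, the two exponents agree, and `N` determines them.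
  have key : ∀ z : 𝓞 K, z * σ z = (p : 𝓞 K) ^ N →
      ∃ i, 2 * i = (p - 1) * N ∧ Associated z (π ^ i) := by
    intro z hz
    have h1 : z * σ z = ((u ^ N : (𝓞 K)ˣ) : 𝓞 K) * π ^ ((p - 1) * N) := by
      rw [hz, ← hu, mul_pow, pow_mul, Units.val_pow_eq_pow_val, mul_comm]
    obtain ⟨i, j, b, c, hij, hbc, hb, hc⟩ := mul_eq_mul_prime_pow hπp h1
    have hU : IsUnit (b * c) := hbc ▸ Units.isUnit _
    have hbu := isUnit_of_mul_isUnit_left hU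
    have hcu := isUnit_of_mul_isUnit_right hU
    have A1 : Associated z (π ^ i) := by
      rw [hb]; exact (associated_isUnit_mul_left_iff hbu).2 (Associated.refl _)
    have A2 : Associated (σ z) (π ^ j) := by
      rw [hc]; exact (associated_isUnit_mul_left_iff hcu).2 (Associated.refl _)
    have A3 : Associated (σ z) (π ^ i) := by
      have := A1.map σ
      rw [map_pow] at this
      exact this.trans (hσ.symm.pow_pow)
    have A4 : Associated (π ^ i) (π ^ j) := A3.symm.trans A2
    have h2 : i = j := by
      apply le_antisymm
      · exact (pow_dvd_pow_iff hπp.ne_zero hπp.not_isUnit).1 A4.dvd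
      · exact (pow_dvd_pow_iff hπp.ne_zero hπp.not_isUnit).1 A4.symm.dvd
    exact ⟨i, by omega, A1⟩
  obtain ⟨i, hi, hxi⟩ := key x hx
  obtain ⟨j, hj, hyj⟩ := key y hy
  obtain rfl : i = j := by omega
  exact hxi.trans hyj.symm

-- The automorphism `ζ ↦ ζ⁻¹` becomes complex conjugation under every embedding. The two elements
-- therefore differ by a unit `u` whose absolute value is 1 under every embedding, and by
-- Kronecker's theorem `u` is a root of unity; for odd `p` this means `±ζ^r`.
open NumberField in
theorem charSum_eq_of_norm_sq_eq_aux (K : Type) [Field K] [NumberField K]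
    [IsCyclotomicExtension {p} ℚ K] (hp : p ≠ 2) {c d : ZMod p → ℤ} {N : ℕ}
    (hc : charSum c * (starRingEnd ℂ) (charSum c) = (p : ℂ) ^ N)
    (hd : charSum d * (starRingEnd ℂ) (charSum d) = (p : ℂ) ^ N) :
    ∃ j : ZMod p, charSum c = charSum d * ZMod.stdAddChar j ∨
      charSum c = -(charSum d * ZMod.stdAddChar j) := by
  have hpp := (Fact.out : p.Prime)
  have hζ : IsPrimitiveRoot (IsCyclotomicExtension.zeta p ℚ K) p :=
    IsCyclotomicExtension.zeta_spec p ℚ K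
  have hirr : Irreducible (Polynomial.cyclotomic p ℚ) := Polynomial.cyclotomic.irreducible_rat hpp.pos
  let τ : K ≃ₐ[ℚ] K := IsCyclotomicExtension.fromZetaAut hζ.inv hirr
  have hτ : τ (IsCyclotomicExtension.zeta p ℚ K) = (IsCyclotomicExtension.zeta p ℚ K)⁻¹ :=
    IsCyclotomicExtension.fromZetaAut_spec hζ.inv hirr
  let σ : 𝓞 K ≃ₐ[ℤ] 𝓞 K := AlgEquiv.ofRingEquiv (f := RingOfIntegers.mapRingEquiv τ.toRingEquiv)
    (by intro r; simp)
  have hσ : ∀ x : 𝓞 K, algebraMap (𝓞 K) K (σ x) = τ (algebraMap (𝓞 K) K x) := fun x => rfl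
  let z : (ZMod p → ℤ) → 𝓞 K := fun c => ∑ l, (c l : 𝓞 K) * hζ.toInteger ^ l.val
  have hz : ∀ (φ : K →+* ℂ) c, φ (algebraMap (𝓞 K) K (z c)) =
      ∑ l, (c l : ℂ) * φ (IsCyclotomicExtension.zeta p ℚ K) ^ l.val := by
    intro φ c
    simp only [z, map_sum, map_mul, map_pow, map_intCast]
    rfl
  have hconj : ∀ (φ : K →+* ℂ) (x : 𝓞 K), φ (algebraMap (𝓞 K) K (σ x)) =
      (starRingEnd ℂ) (φ (algebraMap (𝓞 K) K x)) := by
    intro φ x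
    rw [hσ]
    let φ₁ : K →ₐ[ℚ] ℂ := RingHom.toRatAlgHom (φ.comp (τ : K →+* K))
    let φ₂ : K →ₐ[ℚ] ℂ := RingHom.toRatAlgHom ((starRingEnd ℂ).comp φ)
    -- Both are embeddings of `K`, and they agree on the generator because the inverse of a complex
    -- root of unity is its conjugate.
    have : φ₁ = φ₂ := by
      refine PowerBasis.algHom_ext (hζ.powerBasis ℚ) ?_
      rw [hζ.powerBasis_gen ℚ]
      change φ (τ _) = (starRingEnd ℂ) (φ _)
      rw [hτ, map_inv₀]
      exact Complex.inv_eq_conj ((hζ.map_of_injective φ.injective).norm'_eq_one hpp.ne_zero)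
    exact DFunLike.congr_fun this (algebraMap (𝓞 K) K x)
  obtain ⟨φ, hφ⟩ : ∃ φ : K →+* ℂ, φ (IsCyclotomicExtension.zeta p ℚ K) =
      ZMod.stdAddChar (1 : ZMod p) := by
    have hm : (ZMod.stdAddChar (1 : ZMod p) : ℂ) ∈ primitiveRoots p ℂ :=
      (mem_primitiveRoots hpp.pos).2 stdAddChar_one_isPrimitiveRoot
    let e := hζ.embeddingsEquivPrimitiveRoots ℂ hirr
    refine ⟨(e.symm ⟨_, hm⟩ : K →ₐ[ℚ] ℂ).toRingHom, ?_⟩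
    have := hζ.embeddingsEquivPrimitiveRoots_apply_coe ℂ hirr (e.symm ⟨_, hm⟩)
    rw [Equiv.apply_symm_apply] at this
    exact this.symm
  have hzφ : ∀ c, φ (algebraMap (𝓞 K) K (z c)) = charSum c := by
    intro c
    rw [hz, hφ, charSum]
    exact Finset.sum_congr rfl fun l _ => by rw [← stdAddChar_eq_pow]
  have hmul : ∀ c, charSum c * (starRingEnd ℂ) (charSum c) = (p : ℂ) ^ N →
      z c * σ (z c) = (p : 𝓞 K) ^ N := by
    intro c h
    rw [← hzφ, ← hconj, ← map_mul, ← map_mul] at h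
    apply RingOfIntegers.coe_injective
    apply φ.injective
    simpa using h
  have hzc := hmul c hc
  have hzd := hmul d hd
  obtain ⟨u, hu⟩ := (associated_of_mul_map_eq_pow σ hzd hzc)
  have hpN : (p : ℂ) ^ N ≠ 0 := pow_ne_zero _ (by exact_mod_cast hpp.ne_zero)
  have hunorm : ∀ ψ : K →+* ℂ, ‖ψ (algebraMap (𝓞 K) K u)‖ = 1 := by
    intro ψ
    have sq : ∀ c, z c * σ (z c) = (p : 𝓞 K) ^ N → ‖ψ (algebraMap (𝓞 K) K (z c))‖ ^ 2 = (p : ℝ) ^ N := by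
      intro c h
      have h1 : ψ (algebraMap (𝓞 K) K (z c)) * (starRingEnd ℂ) (ψ (algebraMap (𝓞 K) K (z c))) = (p : ℂ) ^ N := by
        rw [← hconj, ← map_mul, ← map_mul, h]
        simp
      rw [Complex.mul_conj, Complex.normSq_eq_norm_sq] at h1
      exact_mod_cast h1
    have e1 := sq c hzc
    have e2 := sq d hzd
    rw [← hu] at e1
    simp only [map_mul, norm_mul, mul_pow, e2] at e1
    have h3 : (p : ℝ) ^ N ≠ 0 := pow_ne_zero _ (by exact_mod_cast hpp.ne_zero)
    have h4 : ‖ψ (algebraMap (𝓞 K) K u)‖ ^ 2 = 1 := by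
      apply mul_left_cancel₀ h3; rw [e1, mul_one]
    exact (pow_eq_one_iff_of_nonneg (norm_nonneg _) two_ne_zero).1 h4
  obtain ⟨m, hm, hum⟩ := Embeddings.pow_eq_one_of_norm_eq_one K ℂ
    (RingOfIntegers.isIntegral_coe (u : 𝓞 K)) hunorm
  obtain ⟨r, -, hr⟩ := hζ.exists_pow_or_neg_mul_pow_of_isOfFinOrder (hpp.odd_of_ne_two hp)
    (isOfFinOrder_iff_pow_eq_one.2 ⟨m, hm, hum⟩)
  have hcd : charSum c = charSum d * φ (algebraMap (𝓞 K) K u) := by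
    rw [← hzφ c, ← hzφ d, ← hu, map_mul, map_mul]
  have hpow : (ZMod.stdAddChar ((r : ℕ) : ZMod p) : ℂ) =
      φ (IsCyclotomicExtension.zeta p ℚ K) ^ r := by
    rw [hφ, ← AddChar.map_nsmul_eq_pow, nsmul_eq_mul, mul_one]
  refine ⟨(r : ZMod p), ?_⟩
  rw [hcd, hpow]
  rcases hr with h | h
  · left; rw [h, map_pow]
  · right; rw [h, map_neg, map_pow, mul_neg]

/-- Two elements of `ℤ[ξ]` whose squared absolute value is `p ^ N` differ by a root of unity. -/
theorem charSum_eq_of_norm_sq_eq (hp : p ≠ 2) {c d : ZMod p → ℤ} {N : ℕ}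
    (hc : charSum c * (starRingEnd ℂ) (charSum c) = (p : ℂ) ^ N)
    (hd : charSum d * (starRingEnd ℂ) (charSum d) = (p : ℂ) ^ N) :
    ∃ j : ZMod p, charSum c = charSum d * ZMod.stdAddChar j ∨
      charSum c = -(charSum d * ZMod.stdAddChar j) := by
  have : NeZero ((p : ℕ) : ℚ) := ⟨by exact_mod_cast NeZero.ne p⟩
  have : IsCyclotomicExtension {p} ℚ (CyclotomicField p ℚ) := by
    convert CyclotomicField.isCyclotomicExtension p ℚ
    · rfl
    · exact Subsingleton.elim (h := Rat.algebra_rat_subsingleton) _ _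
  have : NumberField (CyclotomicField p ℚ) := IsCyclotomicExtension.numberField {p} ℚ _
  exact charSum_eq_of_norm_sq_eq_aux (CyclotomicField p ℚ) hp hc hd

end RootsOfUnity

end PlateauedCode

/-! ### Gauss sums and the numbers `μ p^(N/2)` as integer combinations of roots of unity -/

namespace PlateauedCode

section GaussVector

variable {p : ℕ} [Fact p.Prime]

/-- The number `μ p^(N/2)`. -/
noncomputable def gam (p N : ℕ) : ℂ :=
  (if p ^ N % 4 = 1 then 1 else Complex.I) * (((p : ℝ) ^ ((N : ℝ) / 2) : ℝ) : ℂ)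

theorem gam_mul_conj (N : ℕ) : gam p N * (starRingEnd ℂ) (gam p N) = (p : ℂ) ^ N := by
  have h1 : ((p : ℝ) ^ ((N : ℝ) / 2)) * ((p : ℝ) ^ ((N : ℝ) / 2)) = (p : ℝ) ^ N := by
    rw [← Real.rpow_add (by exact_mod_cast (Fact.out : p.Prime).pos), add_halves,
      Real.rpow_natCast]
  have h2 : ((((p : ℝ) ^ ((N : ℝ) / 2) : ℝ) : ℂ)) * (((p : ℝ) ^ ((N : ℝ) / 2) : ℝ) : ℂ) =
      (p : ℂ) ^ N := by exact_mod_cast h1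
  rw [gam, map_mul, Complex.conj_ofReal, ← h2]
  split_ifs
  · simp
  · rw [Complex.conj_I]
    linear_combination (-(((p : ℝ) ^ ((N : ℝ) / 2) : ℝ) : ℂ) ^ 2) * Complex.I_mul_I

theorem gam_ne_zero (N : ℕ) : gam p N ≠ 0 := by
  intro h
  have h1 := gam_mul_conj (p := p) N
  rw [h, zero_mul] at h1
  exact pow_ne_zero N (by exact_mod_cast (Fact.out : p.Prime).ne_zero) h1.symm

theorem odd_pow_two_mul_mod_four (hp : p ≠ 2) (k : ℕ) : p ^ (2 * k) % 4 = 1 := by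
  have h := (Fact.out : p.Prime).odd_of_ne_two hp
  have h2 : p ^ 2 % 4 = 1 := by
    rcases Nat.odd_mod_four_iff.1 (Nat.odd_iff.1 h) with h | h <;> simp [Nat.pow_mod, h]
  rw [pow_mul, Nat.pow_mod, h2]; simp

theorem gam_two_mul (hp : p ≠ 2) (k : ℕ) : gam p (2 * k) = (p : ℂ) ^ k := by
  rw [gam, if_pos (odd_pow_two_mul_mod_four hp k)]
  have : ((2 * k : ℕ) : ℝ) / 2 = k := by push_cast; ring
  rw [this, Real.rpow_natCast]; simp

theorem gam_two_mul_add_one (hp : p ≠ 2) (k : ℕ) :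
    gam p (2 * k + 1) = (p : ℂ) ^ k * ((if p % 4 = 1 then 1 else Complex.I) * (√(p : ℝ) : ℝ)) := by
  have h4 : p ^ (2 * k + 1) % 4 = p % 4 := by
    rw [pow_succ, Nat.mul_mod, odd_pow_two_mul_mod_four hp, one_mul, Nat.mod_mod]
  have h0 : (0 : ℝ) < p := by exact_mod_cast (Fact.out : p.Prime).pos
  have : ((2 * k + 1 : ℕ) : ℝ) / 2 = k + 1 / 2 := by push_cast; ring
  rw [gam, h4, this, Real.rpow_add h0, Real.rpow_natCast, ← Real.sqrt_eq_rpow]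
  push_cast
  ring

/-- The quadratic Gauss sum, up to its sign. -/
theorem exists_sign_charSum_quadraticChar (hp : p ≠ 2) : ∃ τ : ℤ, (τ = 1 ∨ τ = -1) ∧
    charSum (quadraticChar (ZMod p)) =
      τ * ((if p % 4 = 1 then 1 else Complex.I) * (√(p : ℝ) : ℝ)) := by
  have hc : ringChar (ZMod p) ≠ 2 := by rwa [ZMod.ringChar_zmod_n]
  have h := gaussSum_sq (R := ZMod p) (R' := ℂ)
    (χ := (quadraticChar (ZMod p)).ringHomComp (Int.castRingHom ℂ))
    ((MulChar.ringHomComp_ne_one_iff (RingHom.injective_int _)).2 (quadraticChar_ne_one hc))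
    ((quadraticChar_isQuadratic (ZMod p)).comp _) (ZMod.isPrimitive_stdAddChar p)
  have hG : gaussSum ((quadraticChar (ZMod p)).ringHomComp (Int.castRingHom ℂ))
      ZMod.stdAddChar = charSum (quadraticChar (ZMod p)) := by
    simp [gaussSum, charSum]
  rw [hG] at h
  have h1 : ((√(p : ℝ) : ℝ) : ℂ) * (√(p : ℝ) : ℝ) = p := by
    exact_mod_cast Real.mul_self_sqrt (Nat.cast_nonneg p)
  -- The square of the Gauss sum is `χ(-1) p`, which fixes the sum up to sign. The sign is never
  -- evaluated: it stays as `τ`.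
  have h2 : charSum (quadraticChar (ZMod p)) ^ 2 =
      ((if p % 4 = 1 then 1 else Complex.I) * (√(p : ℝ) : ℝ)) ^ 2 := by
    rw [h, MulChar.ringHomComp_apply, quadraticChar_neg_one hc, ZMod.card]
    rcases Nat.odd_mod_four_iff.1 (Nat.odd_iff.1 ((Fact.out : p.Prime).odd_of_ne_two hp))
      with h4 | h4
    · rw [ZMod.χ₄_nat_one_mod_four h4, if_pos h4]
      simp only [eq_intCast, Int.cast_one]
      linear_combination -h1
    · rw [ZMod.χ₄_nat_three_mod_four h4, if_neg (by omega)]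
      simp only [eq_intCast, Int.cast_neg, Int.cast_one]
      linear_combination h1 - Complex.I_mul_I * ((√(p : ℝ) : ℝ) : ℂ) ^ 2
  rcases sq_eq_sq_iff_eq_or_eq_neg.1 h2 with h3 | h3
  · exact ⟨1, Or.inl rfl, by rw [h3]; simp⟩
  · exact ⟨-1, Or.inr rfl, by rw [h3]; push_cast; ring⟩

/-- An integer vector representing `μ p^(N/2)` as a combination of `p`-th roots of unity. -/
structure IsGaussVector (N : ℕ) (g : ZMod p → ℤ) : Prop where
  charSum_eq : charSum g = gam p N
  of_even : Even N → ∀ l, g l = if l = 0 then (p : ℤ) ^ (N / 2) else 0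
  of_odd : Odd N → ∃ τ : ℤ, (τ = 1 ∨ τ = -1) ∧
    ∀ l, g l = τ * (p : ℤ) ^ ((N - 1) / 2) * quadraticChar (ZMod p) l

theorem exists_isGaussVector (hp : p ≠ 2) (N : ℕ) : ∃ g : ZMod p → ℤ, IsGaussVector N g := by
  rcases Nat.even_or_odd' N with ⟨k, rfl | rfl⟩
  · refine ⟨fun l => if l = 0 then (p : ℤ) ^ k else 0, ?_, fun _ l => ?_, fun h => ?_⟩
    · rw [gam_two_mul hp, charSum, Finset.sum_eq_single 0] <;> simp +contextual
    · simp
    · exact absurd h (by simp)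
  · obtain ⟨τ, hτ, h⟩ := exists_sign_charSum_quadraticChar hp
    -- The factor `τ` cancels the sign of the Gauss sum, since `τ² = 1`.
    refine ⟨(τ * (p : ℤ) ^ k) • ⇑(quadraticChar (ZMod p)), ?_, fun h => ?_, fun _ => ?_⟩
    · rw [charSum_smul, h, gam_two_mul_add_one hp]
      have : (τ : ℂ) * τ = 1 := by rcases hτ with rfl | rfl <;> simp
      push_cast
      linear_combination
        (p : ℂ) ^ k * ((if p % 4 = 1 then 1 else Complex.I) * (√(p : ℝ) : ℝ)) * this
    · exact absurd h (by simp)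
    · exact ⟨τ, hτ, fun l => by simp⟩

theorem odd_natCast_pow (hp : p ≠ 2) (k : ℕ) : Odd ((p : ℤ) ^ k) :=
  Odd.pow (by exact_mod_cast (Fact.out : p.Prime).odd_of_ne_two hp)

/-- Modulo 2 the coefficient at `0` is the odd one out, for both parities of `N`. This is how an
exponent `j` is read off from the coefficients of `± μ p^(N/2) ξ^j`. -/
theorem IsGaussVector.odd_sub (hp : p ≠ 2) {N : ℕ} {g : ZMod p → ℤ} (hg : IsGaussVector N g)
    {l : ZMod p} (hl : l ≠ 0) : Odd (g 0 - g l) := by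
  rcases Nat.even_or_odd N with h | h
  · rw [hg.of_even h, hg.of_even h, if_pos rfl, if_neg hl, sub_zero]
    exact odd_natCast_pow hp _
  · obtain ⟨τ, hτ, h⟩ := hg.of_odd h
    rw [h, h, MulChar.map_zero, mul_zero, zero_sub]
    refine (Odd.mul (Odd.mul ?_ (odd_natCast_pow hp _)) ?_).neg
    · rcases hτ with rfl | rfl <;> decide
    · rcases quadraticChar_dichotomy hl with h | h <;> rw [h] <;> decide

theorem IsGaussVector.even_sub (hp : p ≠ 2) {N : ℕ} {g : ZMod p → ℤ} (hg : IsGaussVector N g)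
    {l l' : ZMod p} (hl : l ≠ 0) (hl' : l' ≠ 0) : Even (g l - g l') := by
  have := (hg.odd_sub hp hl').sub_odd (hg.odd_sub hp hl)
  rwa [show g 0 - g l' - (g 0 - g l) = g l - g l' by ring] at this

theorem IsGaussVector.sum_even {N : ℕ} {g : ZMod p → ℤ} (hg : IsGaussVector N g) (h : Even N) :
    ∑ l, g l = (p : ℤ) ^ (N / 2) := by
  simp [hg.of_even h]

theorem IsGaussVector.sum_odd (hp : p ≠ 2) {N : ℕ} {g : ZMod p → ℤ} (hg : IsGaussVector N g)
    (h : Odd N) : ∑ l, g l = 0 := by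
  obtain ⟨τ, -, h⟩ := hg.of_odd h
  simp_rw [h, ← Finset.mul_sum]
  rw [quadraticChar_sum_zero (by rwa [ZMod.ringChar_zmod_n]), mul_zero]

/-- An element of `ℤ[ξ]` of absolute value `p^(N/2)` is `± μ p^(N/2) ξ^j` for some `j`. -/
theorem exists_charSum_eq_gam_mul (hp : p ≠ 2) (c : ZMod p → ℤ) (N : ℕ)
    (h : ‖charSum c‖ ^ 2 = (p : ℝ) ^ N) : ∃ j : ZMod p, ∃ ε : ℤ, (ε = 1 ∨ ε = -1) ∧
      charSum c = ε * (gam p N * ZMod.stdAddChar j) := by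
  obtain ⟨g, hg⟩ := exists_isGaussVector hp N
  have hc : charSum c * (starRingEnd ℂ) (charSum c) = (p : ℂ) ^ N := by
    rw [Complex.mul_conj, Complex.normSq_eq_norm_sq, h]; simp
  have hd : charSum g * (starRingEnd ℂ) (charSum g) = (p : ℂ) ^ N := by
    rw [hg.charSum_eq, gam_mul_conj]
  obtain ⟨j, hj⟩ := charSum_eq_of_norm_sq_eq hp hc hd
  rw [hg.charSum_eq] at hj
  rcases hj with hj | hj
  · exact ⟨j, 1, Or.inl rfl, by simpa using hj⟩
  · exact ⟨j, -1, Or.inr rfl, by simpa using hj⟩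

end GaussVector

end PlateauedCode

/-! ### Fibre counts, Fourier inversion, and the Walsh support -/

namespace PlateauedCode

section Counting

variable {p : ℕ} [Fact p.Prime] {V : Type*}

open scoped Classical in
/-- The number of elements of `F` at which `h` takes the value `l`. -/
noncomputable def fiberCard (F : Finset V) (h : V → ZMod p) (l : ZMod p) : ℤ :=
  (F.filter fun x => h x = l).card

theorem charSum_fiberCard (F : Finset V) (h : V → ZMod p) :
    charSum (fiberCard F h) = ∑ x ∈ F, (ZMod.stdAddChar (h x) : ℂ) := by
  classical
  rw [charSum, ← Finset.sum_fiberwise F h]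
  refine Finset.sum_congr rfl fun l _ => ?_
  rw [Finset.sum_congr rfl (g := fun _ => (ZMod.stdAddChar l : ℂ))
    (fun x hx => by rw [(Finset.mem_filter.1 hx).2]), Finset.sum_const, nsmul_eq_mul, fiberCard]
  norm_cast

theorem sum_fiberCard (F : Finset V) (h : V → ZMod p) : ∑ l, fiberCard F h l = F.card := by
  classical
  simp only [fiberCard]
  rw [Finset.card_eq_sum_card_fiberwise (f := h) (t := Finset.univ) (fun _ _ => by simp)]
  push_cast
  rfl

theorem neg_ne_self_of_ne_zero [AddCommGroup V] [Module (ZMod p) V] (hp : p ≠ 2) {x : V}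
    (hx : x ≠ 0) : -x ≠ x := by
  intro h
  have h2 : (2 : ZMod p) • x = 0 := by rw [two_smul]; nth_rw 1 [← h]; simp
  rcases smul_eq_zero.1 h2 with h3 | h3
  · exact Ring.two_ne_zero (by rwa [ZMod.ringChar_zmod_n]) h3
  · exact hx h3

theorem even_card_of_neg_mem [AddCommGroup V] [Module (ZMod p) V] (hp : p ≠ 2) (F : Finset V)
    (hF : ∀ x ∈ F, -x ∈ F) (h0 : 0 ∉ F) : Even F.card := by
  rw [← ZMod.natCast_eq_zero_iff_even, Finset.cast_card]
  refine Finset.sum_involution (fun x _ => -x) (fun _ _ => by decide) (fun x hx _ => ?_) hF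
    (fun x _ => neg_neg x)
  exact neg_ne_self_of_ne_zero hp (fun h => h0 (h ▸ hx))

end Counting

section Amplitude

variable {p : ℕ} [Fact p.Prime] {V : Type*} [AddCommGroup V] [Module (ZMod p) V]

theorem mu_mul_amp (s : ℕ) :
    mu p V s * (amp p V s : ℂ) = gam p (Module.finrank (ZMod p) V + s) := by
  rw [mu, amp, gam]; push_cast; rfl

/-- The constant `μ` is defined through `n + s` but serves `n - s` as well: the exponents differ by
`2 s`, and `p^(2s) ≡ 1 (mod 4)`. -/
theorem mu_mul_dualAmp (hp : p ≠ 2) {s : ℕ} (hs : s ≤ Module.finrank (ZMod p) V) :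
    mu p V s * (dualAmp p V s : ℂ) = gam p (Module.finrank (ZMod p) V - s) := by
  have h : p ^ (Module.finrank (ZMod p) V + s) % 4 = p ^ (Module.finrank (ZMod p) V - s) % 4 := by
    rw [show Module.finrank (ZMod p) V + s = (Module.finrank (ZMod p) V - s) + 2 * s by omega,
      pow_add, Nat.mul_mod, odd_pow_two_mul_mod_four hp, mul_one, Nat.mod_mod]
  rw [mu, dualAmp, gam, h]; push_cast [Nat.cast_sub hs]; rfl

theorem amp_sq (s : ℕ) : amp p V s ^ 2 = (p : ℝ) ^ (Module.finrank (ZMod p) V + s) := by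
  rw [amp, ← Real.rpow_natCast, ← Real.rpow_mul (Nat.cast_nonneg p), ← Real.rpow_natCast]
  congr 1; push_cast; ring

end Amplitude

section Walsh

variable {p : ℕ} [Fact p.Prime] {V : Type*} [AddCommGroup V] [Module (ZMod p) V] [Fintype V]
  {B : LinearMap.BilinForm (ZMod p) V}

theorem card_eq_pow_finrank : Fintype.card V = p ^ Module.finrank (ZMod p) V := by
  rw [Module.card_eq_pow_finrank (K := ZMod p), ZMod.card]

theorem sum_stdAddChar_bilin (hB : B.Nondegenerate) {x : V} (h : x ≠ 0) :
    ∑ α, (ZMod.stdAddChar (B α x) : ℂ) = 0 := by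
  let χ : AddChar V ℂ := ZMod.stdAddChar.compAddMonoidHom (B.flip x).toAddMonoidHom
  have hχ : χ ≠ 1 := by
    intro h1
    refine h (hB.2 x fun α => ?_)
    have h2 : (ZMod.stdAddChar (B α x) : ℂ) = 1 := DFunLike.congr_fun h1 α
    rw [← AddChar.map_zero_eq_one (ZMod.stdAddChar (N := p))] at h2
    exact ZMod.injective_stdAddChar h2
  exact AddChar.sum_eq_zero_of_ne_one hχ

theorem walsh_inversion (hB : B.Nondegenerate) (f : V → ZMod p) (x : V) :
    ∑ α, walsh B f α * ZMod.stdAddChar (B α x) =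
      (p : ℂ) ^ Module.finrank (ZMod p) V * ZMod.stdAddChar (f x) := by
  simp only [walsh, Finset.sum_mul]
  rw [Finset.sum_comm, Finset.sum_eq_single x]
  · simp_rw [← AddChar.map_add_eq_mul, sub_add_cancel]
    rw [Finset.sum_const, Finset.card_univ, card_eq_pow_finrank (p := p), nsmul_eq_mul]
    push_cast; rfl
  · intro y _ hy
    have : ∀ α, (ZMod.stdAddChar (f y - B α y) * ZMod.stdAddChar (B α x) : ℂ) =
        ZMod.stdAddChar (f y) * ZMod.stdAddChar (B α (x - y)) := by
      intro α
      rw [← AddChar.map_add_eq_mul, ← AddChar.map_add_eq_mul, map_sub]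
      congr 1; ring
    simp_rw [this, ← Finset.mul_sum]
    rw [sum_stdAddChar_bilin hB (sub_ne_zero.2 (Ne.symm hy)), mul_zero]
  · simp

theorem walsh_parseval (hB : B.Nondegenerate) (f : V → ZMod p) :
    ∑ α, ‖walsh B f α‖ ^ 2 = ((p : ℝ) ^ Module.finrank (ZMod p) V) ^ 2 := by
  have h1 : ∀ α, ((‖walsh B f α‖ ^ 2 : ℝ) : ℂ) =
      ∑ x, walsh B f α * ZMod.stdAddChar (B α x) * ZMod.stdAddChar (-f x) := by
    intro α
    rw [Complex.ofReal_pow, ← Complex.mul_conj']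
    conv_lhs => rw [← mul_comm, mul_comm, walsh, map_sum]
    rw [Finset.mul_sum]
    refine Finset.sum_congr rfl fun x _ => ?_
    rw [conj_stdAddChar, mul_assoc, ← AddChar.map_add_eq_mul, neg_sub, sub_eq_add_neg]
    rfl
  have h2 : ((∑ α, ‖walsh B f α‖ ^ 2 : ℝ) : ℂ) = ((p : ℂ) ^ Module.finrank (ZMod p) V) ^ 2 := by
    rw [Complex.ofReal_sum, Finset.sum_congr rfl fun α _ => h1 α, Finset.sum_comm]
    simp_rw [← Finset.sum_mul, walsh_inversion hB, mul_assoc, ← AddChar.map_add_eq_mul,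
      add_neg_cancel, AddChar.map_zero_eq_one, mul_one]
    rw [Finset.sum_const, Finset.card_univ, card_eq_pow_finrank (p := p), nsmul_eq_mul, sq]
    push_cast; rfl
  exact_mod_cast h2

theorem walsh_eq_charSum (f : V → ZMod p) (α : V) :
    walsh B f α = charSum (fiberCard Finset.univ fun x => f x - B α x) := by
  rw [charSum_fiberCard, walsh]

theorem mem_Bplus_iff {s : ℕ} {f : V → ZMod p} {α : V} : α ∈ Bplus B s f ↔
    α ∈ walshSupport B s f ∧
      walsh B f α = gam p (Module.finrank (ZMod p) V + s) * ZMod.stdAddChar (dual B s f α) := by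
  rw [← mu_mul_amp]; rfl

theorem mem_Bminus_iff {s : ℕ} {f : V → ZMod p} {α : V} : α ∈ Bminus B s f ↔
    α ∈ walshSupport B s f ∧
      walsh B f α = -(gam p (Module.finrank (ZMod p) V + s) * ZMod.stdAddChar (dual B s f α)) := by
  rw [← mu_mul_amp]; rfl

/-- On the Walsh support the default branch of `dual` never occurs: the classification of elements
of `ℤ[ξ]` of absolute value `p^(N/2)` supplies an exponent. -/
theorem mem_Bplus_or_mem_Bminus (hp : p ≠ 2) {s : ℕ} {f : V → ZMod p} {α : V}
    (h : α ∈ walshSupport B s f) : α ∈ Bplus B s f ∨ α ∈ Bminus B s f := by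
  have h1 : ‖walsh B f α‖ = amp p V s := h
  obtain ⟨j, ε, hε, hj⟩ := exists_charSum_eq_gam_mul hp
    (fiberCard Finset.univ fun x => f x - B α x) (Module.finrank (ZMod p) V + s)
    (by rw [← walsh_eq_charSum, h1, amp_sq])
  rw [← walsh_eq_charSum, ← mu_mul_amp] at hj
  have hex : ∃ j : ZMod p,
      walsh B f α = mu p V s * (amp p V s : ℂ) * ZMod.stdAddChar j ∨
      walsh B f α = -(mu p V s * (amp p V s : ℂ) * ZMod.stdAddChar j) := by
    refine ⟨j, ?_⟩
    rcases hε with rfl | rfl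
    · left; simpa using hj
    · right; simpa using hj
  have hd : dual B s f α = hex.choose := dif_pos hex
  have := hex.choose_spec
  rw [← hd] at this
  exact this.imp (fun h2 => ⟨h, h2⟩) (fun h2 => ⟨h, h2⟩)

theorem not_mem_Bplus_and_Bminus {s : ℕ} {f : V → ZMod p} {α : V}
    (h : α ∈ Bplus B s f) (h' : α ∈ Bminus B s f) : False := by
  have h1 := (mem_Bplus_iff.1 h).2.symm.trans (mem_Bminus_iff.1 h').2
  rw [self_eq_neg] at h1
  exact mul_ne_zero (gam_ne_zero _) (stdAddChar_ne_zero _) h1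

theorem walsh_eq_zero_of_not_mem {s : ℕ} {f : V → ZMod p} (hf : IsPlateaued B s f) {α : V}
    (h : α ∉ walshSupport B s f) : walsh B f α = 0 :=
  norm_eq_zero.1 ((hf.2 α).resolve_right h)

/-- Parseval: each point of the support contributes `p^(n+s)` to a total of `p^(2n)`. -/
theorem ncard_walshSupport (hB : B.Nondegenerate) {s : ℕ} {f : V → ZMod p}
    (hf : IsPlateaued B s f) :
    (walshSupport B s f).ncard = p ^ (Module.finrank (ZMod p) V - s) := by
  classical
  have h1 := walsh_parseval hB f
  have h2 : ∀ α, ‖walsh B f α‖ ^ 2 = if α ∈ walshSupport B s f then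
      (p : ℝ) ^ (Module.finrank (ZMod p) V + s) else 0 := by
    intro α
    split_ifs with h
    · rw [← amp_sq, show ‖walsh B f α‖ = amp p V s from h]
    · rw [walsh_eq_zero_of_not_mem hf h]; simp
  simp_rw [h2] at h1
  rw [← Finset.sum_filter, Finset.sum_const, nsmul_eq_mul] at h1
  have h3 : (walshSupport B s f).ncard = (Finset.univ.filter (· ∈ walshSupport B s f)).card := by
    rw [← Set.ncard_coe_finset]; simp
  have h4 : ((Finset.univ.filter (· ∈ walshSupport B s f)).card : ℝ) *
      (p : ℝ) ^ (Module.finrank (ZMod p) V + s) = (p : ℝ) ^ (Module.finrank (ZMod p) V - s) *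
      (p : ℝ) ^ (Module.finrank (ZMod p) V + s) := by
    rw [h1, ← pow_add, ← pow_mul]
    congr 1
    have := hf.1
    omega
  have h5 := mul_right_cancel₀ (pow_ne_zero _
    (by exact_mod_cast (Fact.out : p.Prime).ne_zero)) h4
  rw [h3]; exact_mod_cast h5

end Walsh

end PlateauedCode

/-! ### Comparison of coefficients, and the dual of the dual -/

namespace PlateauedCode

section GaussVector

variable {p : ℕ} [Fact p.Prime]

theorem gam_sq (N : ℕ) : gam p N ^ 2 = ((if p ^ N % 4 = 1 then 1 else -1 : ℤ) : ℂ) * (p : ℂ) ^ N := by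
  have h1 : ((p : ℝ) ^ ((N : ℝ) / 2)) * ((p : ℝ) ^ ((N : ℝ) / 2)) = (p : ℝ) ^ N := by
    rw [← Real.rpow_add (by exact_mod_cast (Fact.out : p.Prime).pos), add_halves,
      Real.rpow_natCast]
  have h2 : ((((p : ℝ) ^ ((N : ℝ) / 2) : ℝ) : ℂ)) * (((p : ℝ) ^ ((N : ℝ) / 2) : ℝ) : ℂ) =
      (p : ℂ) ^ N := by exact_mod_cast h1
  rw [gam, ← h2]
  split_ifs
  · push_cast; ring
  · push_cast
    linear_combination ((((p : ℝ) ^ ((N : ℝ) / 2) : ℝ) : ℂ) ^ 2) * Complex.I_mul_I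

theorem gam_add_two_mul (hp : p ≠ 2) (N k : ℕ) : gam p (N + 2 * k) = (p : ℂ) ^ k * gam p N := by
  have h4 : p ^ (N + 2 * k) % 4 = p ^ N % 4 := by
    rw [pow_add, Nat.mul_mod, odd_pow_two_mul_mod_four hp, mul_one, Nat.mod_mod]
  have h0 : (0 : ℝ) < p := by exact_mod_cast (Fact.out : p.Prime).pos
  have : ((N + 2 * k : ℕ) : ℝ) / 2 = k + N / 2 := by push_cast; ring
  rw [gam, gam, h4, this, Real.rpow_add h0, Real.rpow_natCast]
  push_cast
  ring

/-- The coefficients of an integer combination of roots of unity that equals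
`ε μ p^(N/2) ξ^j`. -/
theorem IsGaussVector.mul_coeff_eq {N : ℕ} {g : ZMod p → ℤ} (hg : IsGaussVector N g)
    {c : ZMod p → ℤ} {ε : ℤ} {j : ZMod p} (h : charSum c = ε * (gam p N * ZMod.stdAddChar j))
    (l : ZMod p) : p * c l = ∑ l, c l + ε * (p * g (l - j) - ∑ l, g l) := by
  rw [← hg.charSum_eq, ← charSum_shift, ← charSum_smul, ← sub_eq_zero, ← charSum_sub,
    charSum_eq_zero_iff] at h
  -- The difference of the two coefficient vectors represents zero, hence is constant; summing over
  -- all residues evaluates the constant.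
  have h1 : ∑ l', (c l' - ε * g (l' - j)) = p * (c l - ε * g (l - j)) := by
    rw [Finset.sum_congr rfl (g := fun _ => c l - ε * g (l - j))
      (fun l' _ => by simpa using h l' l)]
    rw [Finset.sum_const, Finset.card_univ, ZMod.card, nsmul_eq_mul]
  have h2 : ∑ l', g (l' - j) = ∑ l', g l' := Equiv.sum_comp (Equiv.subRight j) g
  rw [Finset.sum_sub_distrib, ← Finset.mul_sum, h2] at h1
  linear_combination -h1

theorem IsGaussVector.coeff_sub_eq {N : ℕ} {g : ZMod p → ℤ} (hg : IsGaussVector N g)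
    {c : ZMod p → ℤ} {ε : ℤ} {j : ZMod p} (h : charSum c = ε * (gam p N * ZMod.stdAddChar j))
    (l l' : ZMod p) : c l - c l' = ε * (g (l - j) - g (l' - j)) := by
  have h1 := hg.mul_coeff_eq h l
  have h2 := hg.mul_coeff_eq h l'
  have hp : (p : ℤ) ≠ 0 := by exact_mod_cast (Fact.out : p.Prime).ne_zero
  apply mul_left_cancel₀ hp
  linear_combination h1 - h2

theorem neg_ne_self (hp : p ≠ 2) {j : ZMod p} (hj : j ≠ 0) : -j ≠ j :=
  neg_ne_self_of_ne_zero hp hj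

end GaussVector

section Dual

variable {p : ℕ} [Fact p.Prime] {V : Type*} [AddCommGroup V] [Module (ZMod p) V] [Fintype V]
  {B : LinearMap.BilinForm (ZMod p) V} {s : ℕ} {f : V → ZMod p}

open scoped Classical in
/-- The set `B₊(f)` as a `Finset`. -/
noncomputable def plusFinset (B : LinearMap.BilinForm (ZMod p) V) (s : ℕ) (f : V → ZMod p) :
    Finset V := Finset.univ.filter (· ∈ Bplus B s f)

open scoped Classical in
/-- The set `B₋(f)` as a `Finset`. -/
noncomputable def minusFinset (B : LinearMap.BilinForm (ZMod p) V) (s : ℕ) (f : V → ZMod p) :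
    Finset V := Finset.univ.filter (· ∈ Bminus B s f)

@[simp] theorem mem_plusFinset {x : V} : x ∈ plusFinset B s f ↔ x ∈ Bplus B s f := by
  simp [plusFinset]

@[simp] theorem mem_minusFinset {x : V} : x ∈ minusFinset B s f ↔ x ∈ Bminus B s f := by
  simp [minusFinset]

theorem disjoint_plusFinset_minusFinset : Disjoint (plusFinset B s f) (minusFinset B s f) := by
  rw [Finset.disjoint_left]
  intro x h h'
  exact not_mem_Bplus_and_Bminus (mem_plusFinset.1 h) (mem_minusFinset.1 h')

theorem sum_walshSupport {M : Type*} [AddCommMonoid M] [DecidablePred (· ∈ walshSupport B s f)]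
    (hp : p ≠ 2) (φ : V → M) :
    ∑ x with x ∈ walshSupport B s f, φ x =
      ∑ x ∈ plusFinset B s f, φ x + ∑ x ∈ minusFinset B s f, φ x := by
  classical
  rw [← Finset.sum_union disjoint_plusFinset_minusFinset]
  congr 1
  ext x
  simp only [Finset.mem_filter, Finset.mem_univ, true_and, Finset.mem_union, mem_plusFinset,
    mem_minusFinset]
  exact ⟨mem_Bplus_or_mem_Bminus hp, fun h => h.elim (fun h => h.1) (fun h => h.1)⟩

theorem eps_of_mem_Bplus {α : V} (h : α ∈ Bplus B s f) : eps B s f α = 1 := if_pos h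

theorem eps_of_mem_Bminus {α : V} (h : α ∈ Bminus B s f) : eps B s f α = -1 := by
  rw [eps, if_neg fun h' => not_mem_Bplus_and_Bminus h' h, if_pos h]

theorem eps_of_not_mem {α : V} (h : α ∉ walshSupport B s f) : eps B s f α = 0 := by
  rw [eps, if_neg fun h' => h h'.1, if_neg fun h' => h h'.1]

theorem walsh_eq_eps_mul (hp : p ≠ 2) (hf : IsPlateaued B s f) (α : V) :
    walsh B f α = eps B s f α *
      (gam p (Module.finrank (ZMod p) V + s) * ZMod.stdAddChar (dual B s f α)) := by
  by_cases h : α ∈ walshSupport B s f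
  · rcases mem_Bplus_or_mem_Bminus hp h with h | h
    · rw [eps_of_mem_Bplus h, (mem_Bplus_iff.1 h).2]; simp
    · rw [eps_of_mem_Bminus h, (mem_Bminus_iff.1 h).2]; simp
  · rw [eps_of_not_mem h, walsh_eq_zero_of_not_mem hf h]; simp

/-- The sum of `ξ^(f* x - ⟨α, x⟩)` over a finite set `F`. -/
noncomputable def partialDual (B : LinearMap.BilinForm (ZMod p) V) (s : ℕ) (f : V → ZMod p)
    (F : Finset V) (α : V) : ℂ := ∑ x ∈ F, ZMod.stdAddChar (dual B s f x - B α x)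

theorem partialDual_eq_charSum (F : Finset V) (α : V) :
    partialDual B s f F α = charSum (fiberCard F fun x => dual B s f x - B α x) := by
  rw [charSum_fiberCard, partialDual]

theorem walshOn_eq (hp : p ≠ 2) (α : V) : walshOn B (walshSupport B s f) (dual B s f) α =
    partialDual B s f (plusFinset B s f) α + partialDual B s f (minusFinset B s f) α := by
  classical
  rw [walshOn, ← Finset.sum_filter, sum_walshSupport hp]
  rfl

/-- This is Fourier inversion for `f` at `-α`: the signs `ε_β` turn the sum over the support into a
difference. Dividing by `gam p (n + s) = p^s * gam p (n - s)` leaves the factor `±1`, which is the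
sign in `gam p (n - s) ^ 2 = ± p^(n-s)`. -/
theorem partialDual_sub (hp : p ≠ 2) (hB : B.Nondegenerate) (hBs : B.IsSymm)
    (hf : IsPlateaued B s f) (α : V) :
    partialDual B s f (plusFinset B s f) α - partialDual B s f (minusFinset B s f) α =
      ((if p ^ (Module.finrank (ZMod p) V - s) % 4 = 1 then 1 else -1 : ℤ) : ℂ) *
        (gam p (Module.finrank (ZMod p) V - s) * ZMod.stdAddChar (f (-α))) := by
  classical
  set n := Module.finrank (ZMod p) V with hn
  have hs : s ≤ n := hf.1
  have hN : n + s = (n - s) + 2 * s := by omega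
  have h1 := walsh_inversion hB f (-α)
  have h2 : ∑ β, walsh B f β * ZMod.stdAddChar (B β (-α)) =
      gam p (n + s) * (partialDual B s f (plusFinset B s f) α -
        partialDual B s f (minusFinset B s f) α) := by
    rw [← Finset.sum_subset (Finset.subset_univ (Finset.univ.filter (· ∈ walshSupport B s f)))
      (fun β _ hβ => by
        rw [walsh_eq_zero_of_not_mem hf (by simpa using hβ), zero_mul]), sum_walshSupport hp,
        partialDual, partialDual, mul_sub, Finset.mul_sum, Finset.mul_sum, sub_eq_add_neg,
        ← Finset.sum_neg_distrib]
    congr 1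
    · refine Finset.sum_congr rfl fun β hβ => ?_
      rw [(mem_Bplus_iff.1 (mem_plusFinset.1 hβ)).2, mul_assoc, ← AddChar.map_add_eq_mul, map_neg,
        hBs.eq β α, ← sub_eq_add_neg]
    · refine Finset.sum_congr rfl fun β hβ => ?_
      rw [(mem_Bminus_iff.1 (mem_minusFinset.1 hβ)).2, neg_mul, mul_assoc,
        ← AddChar.map_add_eq_mul, map_neg, hBs.eq β α, ← sub_eq_add_neg]
  rw [h1, hN, gam_add_two_mul hp] at h2
  have h3 := gam_sq (p := p) (n - s)
  have hpow : (p : ℂ) ^ n = (p : ℂ) ^ s * (p : ℂ) ^ (n - s) := by rw [← pow_add]; congr 1; omega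
  have hp0 : (p : ℂ) ≠ 0 := by exact_mod_cast (Fact.out : p.Prime).ne_zero
  apply mul_left_cancel₀ (mul_ne_zero (pow_ne_zero s hp0) (gam_ne_zero (p := p) (n - s)))
  rw [← h2, hpow]
  have hκ : ((if p ^ (n - s) % 4 = 1 then 1 else -1 : ℤ) : ℂ) *
    ((if p ^ (n - s) % 4 = 1 then 1 else -1 : ℤ) : ℂ) = 1 := by split_ifs <;> simp
  linear_combination (-(p : ℂ) ^ s * (p : ℂ) ^ (n - s) * ZMod.stdAddChar (f (-α))) * hκ -
    ((p : ℂ) ^ s * ZMod.stdAddChar (f (-α)) *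
      ((if p ^ (n - s) % 4 = 1 then 1 else -1 : ℤ) : ℂ)) * h3

/-- If the dual is bent relative to its support, then it is the dual of the dual: the Walsh
transform of `f*` is `± μ p^((n-s)/2) ξ^(f(-α))`. -/
theorem walshOn_dual_eq (hp : p ≠ 2) (hB : B.Nondegenerate) (hBs : B.IsSymm)
    (hf : IsPlateaued B s f) (hd : IsBentRel B (walshSupport B s f) (dual B s f)) (α : V) :
    ∃ ε : ℤ, (ε = 1 ∨ ε = -1) ∧ walshOn B (walshSupport B s f) (dual B s f) α =
      ε * (gam p (Module.finrank (ZMod p) V - s) * ZMod.stdAddChar (f (-α))) := by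
  set n := Module.finrank (ZMod p) V with hn
  set P := fiberCard (plusFinset B s f) fun x => dual B s f x - B α x with hP
  set M := fiberCard (minusFinset B s f) fun x => dual B s f x - B α x with hM
  have hW : walshOn B (walshSupport B s f) (dual B s f) α = charSum (P + M) := by
    rw [walshOn_eq hp, charSum_add, partialDual_eq_charSum, partialDual_eq_charSum]
  have hnorm : ‖charSum (P + M)‖ ^ 2 = (p : ℝ) ^ (n - s) := by
    rw [← hW, hd α, Real.sq_sqrt (Nat.cast_nonneg _), ncard_walshSupport hB hf]
    push_cast; rfl
  obtain ⟨j, ε, hε, hj⟩ := exists_charSum_eq_gam_mul hp _ _ hnorm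
  refine ⟨ε, hε, ?_⟩
  rw [hW, hj]
  suffices j = f (-α) by rw [this]
  -- The vectors `P + M` and `P - M` agree modulo 2. The first has its odd-one-out coefficient at
  -- `j`, the second at `i`, so `i ≠ j` is contradictory.
  by_contra hne
  obtain ⟨g, hg⟩ := exists_isGaussVector hp (n - s)
  have hsub := partialDual_sub hp hB hBs hf α
  rw [partialDual_eq_charSum, partialDual_eq_charSum, ← charSum_sub] at hsub
  have e1 := hg.coeff_sub_eq hj
  have e2 := hg.coeff_sub_eq hsub
  set i := f (-α) with hi
  set κ : ℤ := if p ^ (n - s) % 4 = 1 then 1 else -1 with hκ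
  have hκ1 : Odd κ := by rw [hκ]; split_ifs <;> decide
  have hε1 : Odd ε := by rcases hε with rfl | rfl <;> decide
  have hij : i - j ≠ 0 := fun h => hne (sub_eq_zero.1 h).symm
  -- compare the coefficients at `i` and at `i + (i - j)`, which differs from `i` and `j`
  have e3 := e1 i (i + (i - j))
  have e4 := e2 i (i + (i - j))
  simp only [Pi.add_apply, Pi.sub_apply] at e3 e4
  have h2 : i + (i - j) - j ≠ 0 := by
    intro h
    refine neg_ne_self hp hij ?_
    linear_combination -h
  rw [sub_self, show i + (i - j) - i = i - j by ring] at e4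
  have p1 : Even (ε * (g (i - j) - g (i + (i - j) - j))) := (hg.even_sub hp hij h2).mul_left _
  have p2 : Odd (κ * (g 0 - g (i - j))) := hκ1.mul (hg.odd_sub hp hij)
  rw [← e3] at p1
  rw [← e4] at p2
  have p3 := p1.add_odd p2
  rw [show P i + M i - (P (i + (i - j)) + M (i + (i - j))) +
    (P i - M i - (P (i + (i - j)) - M (i + (i - j)))) = 2 * (P i - P (i + (i - j))) by ring] at p3
  exact Int.not_odd_iff_even.2 (even_two_mul _) p3

theorem mem_BplusDual_iff (hp : p ≠ 2) (hf : IsPlateaued B s f) {α : V} : α ∈ BplusDual B s f ↔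
    walshOn B (walshSupport B s f) (dual B s f) α =
      gam p (Module.finrank (ZMod p) V - s) * ZMod.stdAddChar (f (-α)) := by
  rw [← mu_mul_dualAmp hp hf.1]; rfl

theorem mem_BminusDual_iff (hp : p ≠ 2) (hf : IsPlateaued B s f) {α : V} : α ∈ BminusDual B s f ↔
    walshOn B (walshSupport B s f) (dual B s f) α =
      -(gam p (Module.finrank (ZMod p) V - s) * ZMod.stdAddChar (f (-α))) := by
  rw [← mu_mul_dualAmp hp hf.1]; rfl

theorem mem_BplusDual_or_mem_BminusDual (hp : p ≠ 2) (hB : B.Nondegenerate) (hBs : B.IsSymm)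
    (hf : MemF B s f) (α : V) : α ∈ BplusDual B s f ∨ α ∈ BminusDual B s f := by
  rw [mem_BplusDual_iff hp hf.plateaued, mem_BminusDual_iff hp hf.plateaued]
  obtain ⟨ε, rfl | rfl, h⟩ := walshOn_dual_eq hp hB hBs hf.plateaued hf.dual_bent α
  · left; simpa using h
  · right; simpa using h

theorem not_mem_BplusDual_and_BminusDual (hp : p ≠ 2) (hf : IsPlateaued B s f) {α : V}
    (h : α ∈ BplusDual B s f) (h' : α ∈ BminusDual B s f) : False := by
  have h1 := ((mem_BplusDual_iff hp hf).1 h).symm.trans ((mem_BminusDual_iff hp hf).1 h')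
  rw [self_eq_neg] at h1
  exact mul_ne_zero (gam_ne_zero _) (stdAddChar_ne_zero _) h1

end Dual

end PlateauedCode

/-! ### Evenness and homogeneity of `f` -/

namespace PlateauedCode

section Parity

variable {p : ℕ} [Fact p.Prime] {V : Type*} [AddCommGroup V] [Module (ZMod p) V]

theorem even_fiberCard (hp : p ≠ 2) (F : Finset V) (hF : ∀ x ∈ F, -x ∈ F) (h : V → ZMod p)
    (hh : ∀ x, h (-x) = h x) {l : ZMod p} (hl : h 0 ≠ l) : Even (fiberCard F h l) := by
  classical
  rw [fiberCard, Int.even_coe_nat]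
  refine even_card_of_neg_mem (p := p) hp _ (fun x hx => ?_) (by simp [hl])
  obtain ⟨h1, h2⟩ := Finset.mem_filter.1 hx
  exact Finset.mem_filter.2 ⟨hF x h1, by rw [hh, h2]⟩

theorem odd_fiberCard (hp : p ≠ 2) (F : Finset V) (hF : ∀ x ∈ F, -x ∈ F) (h : V → ZMod p)
    (hh : ∀ x, h (-x) = h x) (h0 : 0 ∈ F) : Odd (fiberCard F h (h 0)) := by
  classical
  have h0F : (0 : V) ∈ F.filter fun x => h x = h 0 := Finset.mem_filter.2 ⟨h0, rfl⟩
  have h1 : Even ((F.filter fun x => h x = h 0).erase 0).card := by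
    refine even_card_of_neg_mem (p := p) hp _ (fun x hx => ?_) (by simp)
    obtain ⟨h1, h2⟩ := Finset.mem_erase.1 hx
    obtain ⟨h2, h3⟩ := Finset.mem_filter.1 h2
    exact Finset.mem_erase.2 ⟨neg_ne_zero.2 h1, Finset.mem_filter.2 ⟨hF x h2, by rw [hh, h3]⟩⟩
  rw [fiberCard, ← Finset.card_erase_add_one h0F]
  exact_mod_cast h1.add_one

end Parity

section Homogeneous

variable {p : ℕ} [Fact p.Prime] {V : Type*} [AddCommGroup V] [Module (ZMod p) V] [Fintype V]
  {B : LinearMap.BilinForm (ZMod p) V} {s : ℕ} {f : V → ZMod p}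

/-- As `p - 1` is even, `t - 1` must be odd. -/
theorem even_of_gcd_pred_eq_one (hp : p ≠ 2) {t : ℕ} (h2 : 2 ≤ t)
    (h : Nat.gcd (t - 1) (p - 1) = 1) : Even t := by
  have hodd := (Fact.out : p.Prime).odd_of_ne_two hp
  by_contra hne
  have h1 : 2 ∣ t - 1 := by
    have := Nat.not_even_iff.1 hne
    omega
  have h3 : 2 ∣ p - 1 := by
    have := Nat.odd_iff.1 hodd
    omega
  have := Nat.dvd_gcd h1 h3
  omega

theorem exists_pow_eq_of_gcd_eq_one {m : ℕ} (h : Nat.gcd m (p - 1) = 1) {z : ZMod p}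
    (hz : z ≠ 0) : ∃ a : ZMod p, a ≠ 0 ∧ a ^ m = z := by
  have hc : (Nat.card (ZMod p)ˣ).Coprime m := by
    rw [Nat.card_eq_fintype_card, ZMod.card_units]
    exact Nat.Coprime.symm h
  obtain ⟨a, ha⟩ := (powCoprime hc).surjective (Units.mk0 z hz)
  refine ⟨a, a.ne_zero, ?_⟩
  have := congrArg Units.val ha
  simpa using this

theorem eq_one_of_pow_eq_one_of_gcd {m : ℕ} (h : Nat.gcd m (p - 1) = 1) {a : ZMod p}
    (ha : a ≠ 0) (h1 : a ^ m = 1) : a = 1 := by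
  have h2 := ZMod.pow_card_sub_one_eq_one ha
  have := pow_gcd_eq_one.2 ⟨h1, h2⟩
  rwa [h, pow_one] at this

/-- The degree depends on which of `B₊(f*)`, `B₋(f*)` contains `x`. This pointwise form suffices for
arguments on a single line through the origin. -/
theorem exists_isFormOn (hp : p ≠ 2) (hB : B.Nondegenerate) (hBs : B.IsSymm)
    (hf : MemF B s f) (x : V) : ∃ t, 2 ≤ t ∧ Nat.gcd (t - 1) (p - 1) = 1 ∧
      ∀ a : ZMod p, a ≠ 0 → f (a • x) = a ^ t * f x := by
  rcases mem_BplusDual_or_mem_BminusDual hp hB hBs hf x with h | h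
  · obtain ⟨t, h2, -, hg, ht⟩ := hf.form_plus
    exact ⟨t, h2, hg, fun a ha => ht a ha x h⟩
  · obtain ⟨t, h2, -, hg, ht⟩ := hf.form_minus
    exact ⟨t, h2, hg, fun a ha => ht a ha x h⟩

theorem map_neg_eq (hp : p ≠ 2) (hB : B.Nondegenerate) (hBs : B.IsSymm) (hf : MemF B s f)
    (x : V) : f (-x) = f x := by
  obtain ⟨t, h2, hg, ht⟩ := exists_isFormOn hp hB hBs hf x
  have := ht (-1) (neg_ne_zero.2 one_ne_zero)
  rwa [neg_smul, one_smul, (even_of_gcd_pred_eq_one hp h2 hg).neg_one_pow, one_mul] at this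

-- Choose `a` with `a^(t-1) = z`, possible because `t - 1` is prime to `p - 1`. If `f x = ⟨β, x⟩`,
-- then `f (a x) = a^t f x = z a ⟨β, x⟩ = ⟨z β, a x⟩`, so `x ↦ a x` is a bijection between the
-- solution sets.
open scoped Classical in
theorem card_filter_form_eq {H : Set V} (hH : ∀ x ∈ H, ∀ a : ZMod p, a ≠ 0 → a • x ∈ H)
    (hf : IsFormOn H f) {z : ZMod p} (hz : z ≠ 0) (β : V) :
    (Finset.univ.filter fun x => x ∈ H ∧ f x = B (z • β) x).card =
      (Finset.univ.filter fun x => x ∈ H ∧ f x = B β x).card := by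
  obtain ⟨t, h2, -, hg, ht⟩ := hf
  obtain ⟨a, ha, haz⟩ := exists_pow_eq_of_gcd_eq_one hg hz
  have hat : a ^ t = z * a := by rw [← haz, ← pow_succ]; congr 1; omega
  symm
  refine Finset.card_nbij' (fun x => a • x) (fun x => a⁻¹ • x) ?_ ?_ ?_ ?_
  · intro x hx
    obtain ⟨hxH, hx⟩ := (Finset.mem_filter.1 hx).2
    refine Finset.mem_filter.2 ⟨Finset.mem_univ _, hH x hxH a ha, ?_⟩
    rw [ht a ha x hxH, hx, hat]
    simp only [map_smul, LinearMap.smul_apply, smul_eq_mul]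
    ring
  · intro x hx
    obtain ⟨hxH, hx⟩ := (Finset.mem_filter.1 hx).2
    have hH' := hH x hxH a⁻¹ (inv_ne_zero ha)
    refine Finset.mem_filter.2 ⟨Finset.mem_univ _, hH', ?_⟩
    have h3 := ht a ha _ hH'
    rw [smul_smul, mul_inv_cancel₀ ha, one_smul, hx, hat] at h3
    simp only [map_smul, LinearMap.smul_apply, smul_eq_mul] at h3 ⊢
    apply mul_left_cancel₀ (mul_ne_zero hz ha)
    rw [← h3]
    field_simp
  · intro x _
    simp only [smul_smul, inv_mul_cancel₀ ha, one_smul]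
  · intro x _
    simp only [smul_smul, mul_inv_cancel₀ ha, one_smul]

/-- The number of solutions of `f x = ⟨β, x⟩`. -/
noncomputable def solCard (B : LinearMap.BilinForm (ZMod p) V) (f : V → ZMod p) (β : V) : ℤ :=
  fiberCard Finset.univ (fun x => f x - B β x) 0

/-- The two degrees may require different scalars `a`, so the solutions in `B₊(f*)` and in `B₋(f*)`
are counted separately; both sets are stable under scaling. -/
theorem solCard_smul (hp : p ≠ 2) (hB : B.Nondegenerate) (hBs : B.IsSymm) (hf : MemF B s f)
    {z : ZMod p} (hz : z ≠ 0) (β : V) : solCard B f (z • β) = solCard B f β := by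
  classical
  have key : ∀ β, solCard B f β =
      ((Finset.univ.filter fun x => x ∈ BplusDual B s f ∧ f x = B β x).card : ℤ) +
      (Finset.univ.filter fun x => x ∈ BminusDual B s f ∧ f x = B β x).card := by
    intro β
    rw [solCard, fiberCard, ← Nat.cast_add, ← Finset.card_union_of_disjoint]
    · congr 2
      ext x
      simp only [Finset.mem_filter, Finset.mem_univ, true_and, Finset.mem_union, sub_eq_zero,
        ← or_and_right]
      exact ⟨fun h => ⟨mem_BplusDual_or_mem_BminusDual hp hB hBs hf x, h⟩, fun h => h.2⟩
    · rw [Finset.disjoint_left]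
      intro x h h'
      exact not_mem_BplusDual_and_BminusDual hp hf.plateaued (Finset.mem_filter.1 h).2.1
        (Finset.mem_filter.1 h').2.1
  rw [key, key, card_filter_form_eq hf.smul_plus hf.form_plus hz,
    card_filter_form_eq hf.smul_minus hf.form_minus hz]

/-- The coefficients of the Walsh transform. -/
theorem mul_fiberCard_eq (hp : p ≠ 2) (hf : IsPlateaued B s f) {g : ZMod p → ℤ}
    (hg : IsGaussVector (Module.finrank (ZMod p) V + s) g) (α : V) (l : ZMod p) :
    p * fiberCard Finset.univ (fun x => f x - B α x) l = (p : ℤ) ^ Module.finrank (ZMod p) V +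
      eps B s f α * (p * g (l - dual B s f α) - ∑ l, g l) := by
  have h := walsh_eq_eps_mul hp hf α
  rw [walsh_eq_charSum] at h
  rw [hg.mul_coeff_eq h l, sum_fiberCard, Finset.card_univ, card_eq_pow_finrank (p := p)]
  push_cast; rfl

theorem odd_fiberCard_zero (hp : p ≠ 2) (hB : B.Nondegenerate) (hBs : B.IsSymm)
    (hf : MemF B s f) : Odd (fiberCard Finset.univ (fun x => f x - B 0 x) 0) := by
  have := odd_fiberCard hp Finset.univ (fun _ _ => Finset.mem_univ _)
    (fun x => f x - B 0 x) (fun x => by simp [map_neg_eq hp hB hBs hf]) (Finset.mem_univ _)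
  simpa [hf.map_zero] using this

theorem even_fiberCard_of_ne_zero (hp : p ≠ 2) (hB : B.Nondegenerate) (hBs : B.IsSymm)
    (hf : MemF B s f) {l : ZMod p} (hl : l ≠ 0) :
    Even (fiberCard Finset.univ (fun x => f x - B 0 x) l) :=
  even_fiberCard hp Finset.univ (fun _ _ => Finset.mem_univ _)
    (fun x => f x - B 0 x) (fun x => by simp [map_neg_eq hp hB hBs hf])
    (by simpa [hf.map_zero] using hl.symm)

/-- If the Walsh value at `0` vanished, all fibres of `f` would have equal size. But `f` is even
with `f 0 = 0`, so the fibre over `0` is odd and all others are even. -/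
theorem zero_mem_walshSupport (hp : p ≠ 2) (hB : B.Nondegenerate) (hBs : B.IsSymm)
    (hf : MemF B s f) : 0 ∈ walshSupport B s f := by
  by_contra h
  obtain ⟨g, hg⟩ := exists_isGaussVector hp (Module.finrank (ZMod p) V + s)
  have h0 := mul_fiberCard_eq hp hf.plateaued hg 0 0
  have h1 := mul_fiberCard_eq hp hf.plateaued hg 0 1
  rw [eps_of_not_mem h, zero_mul] at h0 h1
  have hp0 : (p : ℤ) ≠ 0 := by exact_mod_cast (Fact.out : p.Prime).ne_zero
  have h2 := mul_left_cancel₀ hp0 (h0.trans h1.symm)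
  have h3 := odd_fiberCard_zero hp hB hBs hf
  rw [h2] at h3
  exact Int.not_even_iff_odd.2 h3 (even_fiberCard_of_ne_zero hp hB hBs hf one_ne_zero)

/-- If `d = f* 0` were nonzero, the fibres of `f` over `d` and `-d` would both be even, while the
shape of the Walsh value makes their difference odd, `d` being the odd-one-out position. -/
theorem dual_zero (hp : p ≠ 2) (hB : B.Nondegenerate) (hBs : B.IsSymm)
    (hf : MemF B s f) : dual B s f 0 = 0 := by
  by_contra h
  obtain ⟨g, hg⟩ := exists_isGaussVector hp (Module.finrank (ZMod p) V + s)
  have hw := walsh_eq_eps_mul hp hf.plateaued 0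
  rw [walsh_eq_charSum] at hw
  have h1 := hg.coeff_sub_eq hw (dual B s f 0) (-dual B s f 0)
  have hε : Odd (eps B s f 0) := by
    rcases mem_Bplus_or_mem_Bminus hp (zero_mem_walshSupport hp hB hBs hf) with h | h
    · rw [eps_of_mem_Bplus h]; decide
    · rw [eps_of_mem_Bminus h]; decide
  have h2 : -dual B s f 0 - dual B s f 0 ≠ 0 := sub_ne_zero.2 (neg_ne_self hp h)
  have h3 := (even_fiberCard_of_ne_zero hp hB hBs hf h).sub
    (even_fiberCard_of_ne_zero hp hB hBs hf (neg_ne_zero.2 h))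
  rw [h1, sub_self] at h3
  exact Int.not_even_iff_odd.2 (hε.mul (hg.odd_sub hp h2)) h3

theorem walsh_neg (hp : p ≠ 2) (hB : B.Nondegenerate) (hBs : B.IsSymm)
    (hf : MemF B s f) (α : V) : walsh B f (-α) = walsh B f α := by
  rw [walsh, walsh, ← Equiv.sum_comp (Equiv.neg V)]
  simp [map_neg_eq hp hB hBs hf]

/-- The chosen exponent depends on `α` only through the Walsh value at `α`. -/
theorem dual_neg (hp : p ≠ 2) (hB : B.Nondegenerate) (hBs : B.IsSymm)
    (hf : MemF B s f) (α : V) : dual B s f (-α) = dual B s f α := by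
  simp only [dual, walsh_neg hp hB hBs hf]

theorem neg_mem_Bplus (hp : p ≠ 2) (hB : B.Nondegenerate) (hBs : B.IsSymm)
    (hf : MemF B s f) {α : V} (h : α ∈ Bplus B s f) : -α ∈ Bplus B s f := by
  simpa only [Bplus, walshSupport, Set.mem_ofPred_eq, walsh_neg hp hB hBs hf,
    dual_neg hp hB hBs hf] using h

theorem neg_mem_Bminus (hp : p ≠ 2) (hB : B.Nondegenerate) (hBs : B.IsSymm)
    (hf : MemF B s f) {α : V} (h : α ∈ Bminus B s f) : -α ∈ Bminus B s f := by
  simpa only [Bminus, walshSupport, Set.mem_ofPred_eq, walsh_neg hp hB hBs hf,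
    dual_neg hp hB hBs hf] using h

end Homogeneous

end PlateauedCode

/-! ### Solution counts and the zeros of the dual -/

namespace PlateauedCode

theorem pow_pred_mul {p n : ℕ} (hn : 1 ≤ n) : (p : ℤ) ^ n = p * (p : ℤ) ^ (n - 1) := by
  rw [← pow_succ']; congr 1; omega

section FiberCard

variable {p : ℕ} [Fact p.Prime] {V : Type*}

theorem natCast_prime_ne_zero : (p : ℤ) ≠ 0 := by exact_mod_cast (Fact.out : p.Prime).ne_zero

theorem fiberCard_of_charSum_eq_zero (F : Finset V) (h : V → ZMod p)
    (h0 : ∑ x ∈ F, (ZMod.stdAddChar (h x) : ℂ) = 0) (l : ZMod p) :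
    p * fiberCard F h l = F.card := by
  rw [← charSum_fiberCard, charSum_eq_zero_iff] at h0
  rw [← sum_fiberCard F h, Finset.sum_congr rfl (g := fun _ => fiberCard F h l)
    (fun l' _ => h0 l' l), Finset.sum_const, Finset.card_univ, ZMod.card, nsmul_eq_mul]

theorem sum_ite_eq_fiberCard (F : Finset V) (d : V → ZMod p) (x y : ℚ) :
    (∑ b ∈ F, if d b = 0 then x else y) =
      fiberCard F d 0 * x + (F.card - fiberCard F d 0) * y := by
  classical
  have h3 := Finset.card_filter_add_card_filter_not (s := F) (fun b => d b = 0)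
  have h4 : ((F.filter fun b => d b = 0).card : ℚ) + (F.filter fun b => ¬ d b = 0).card = F.card := by
    exact_mod_cast h3
  rw [Finset.sum_ite, Finset.sum_const, Finset.sum_const, nsmul_eq_mul, nsmul_eq_mul, fiberCard]
  push_cast
  rw [← h4]
  ring

end FiberCard

section Spectrum

variable {p : ℕ} [Fact p.Prime] {V : Type*} [AddCommGroup V] [Module (ZMod p) V] [Fintype V]
  {B : LinearMap.BilinForm (ZMod p) V} {s : ℕ} {f : V → ZMod p}

theorem mul_fiberCard_bilin_left (hB : B.Nondegenerate) {x : V} (hx : x ≠ 0) (l : ZMod p) :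
    p * fiberCard Finset.univ (fun b => B b x) l = (p : ℤ) ^ Module.finrank (ZMod p) V := by
  rw [fiberCard_of_charSum_eq_zero _ _ (sum_stdAddChar_bilin hB hx), Finset.card_univ,
    card_eq_pow_finrank (p := p)]
  push_cast; rfl

theorem mul_fiberCard_bilin_right (hB : B.Nondegenerate) (hBs : B.IsSymm) {b : V} (hb : b ≠ 0)
    (l : ZMod p) :
    p * fiberCard Finset.univ (fun x => B b x) l = (p : ℤ) ^ Module.finrank (ZMod p) V := by
  rw [← mul_fiberCard_bilin_left hB hb l]
  simp only [hBs.eq b]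

/-- The first moment of the numbers of solutions of `f x = ⟨b, x⟩`. -/
theorem sum_solCard (hB : B.Nondegenerate) (hf0 : f 0 = 0) {n : ℕ}
    (hn : Module.finrank (ZMod p) V = n) (hn1 : 1 ≤ n) :
    ∑ b, solCard B f b = (p : ℤ) ^ n + ((p : ℤ) ^ n - 1) * (p : ℤ) ^ (n - 1) := by
  classical
  have h1 : ∀ b, solCard B f b = ∑ x, if B b x = f x then (1 : ℤ) else 0 := by
    intro b
    rw [solCard, fiberCard, Finset.sum_boole]
    congr 2
    ext x
    simp only [Finset.mem_filter, Finset.mem_univ, true_and, sub_eq_zero]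
    exact eq_comm
  have h2 : ∀ x, (∑ b, if B b x = f x then (1 : ℤ) else 0) =
      if x = 0 then (p : ℤ) ^ n else (p : ℤ) ^ (n - 1) := by
    intro x
    split_ifs with hx
    · simp [hx, hf0, card_eq_pow_finrank (p := p), hn]
    · have := mul_fiberCard_bilin_left hB hx (f x)
      rw [hn, pow_pred_mul hn1] at this
      rw [← mul_left_cancel₀ natCast_prime_ne_zero this, fiberCard, Finset.sum_boole]
  simp_rw [h1]
  rw [Finset.sum_comm]
  simp_rw [h2]
  rw [← Finset.add_sum_erase _ _ (Finset.mem_univ (0 : V)), if_pos rfl,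
    Finset.sum_congr rfl (g := fun _ => (p : ℤ) ^ (n - 1))
      (fun x hx => if_neg (Finset.ne_of_mem_erase hx)), Finset.sum_const,
    Finset.card_erase_of_mem (Finset.mem_univ _), Finset.card_univ,
    card_eq_pow_finrank (p := p), hn, nsmul_eq_mul,
    Nat.cast_sub (Nat.one_le_pow _ _ (Fact.out : p.Prime).pos)]
  push_cast; rfl

theorem card_plusFinset : (plusFinset B s f).card = (Bplus B s f).ncard := by
  rw [← Set.ncard_coe_finset]; congr 1; ext; simp

theorem card_plus_add_card_minus (hp : p ≠ 2) (hB : B.Nondegenerate) (hf : IsPlateaued B s f) :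
    ((plusFinset B s f).card + (minusFinset B s f).card : ℤ) =
      (p : ℤ) ^ (Module.finrank (ZMod p) V - s) := by
  classical
  have h1 := ncard_walshSupport hB hf
  have h2 := sum_walshSupport (B := B) (s := s) (f := f) hp (fun _ => (1 : ℕ))
  simp only [Finset.sum_const, smul_eq_mul, mul_one] at h2
  rw [← Nat.cast_add, ← h2]
  have h3 : (walshSupport B s f).ncard = (Finset.univ.filter (· ∈ walshSupport B s f)).card := by
    rw [← Set.ncard_coe_finset]; simp
  rw [← h3, h1]; push_cast; rfl

theorem sum_univ_eq (hp : p ≠ 2) (hB : B.Nondegenerate) (hf : IsPlateaued B s f) (φ : V → ℚ)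
    (c : ℚ) (hφ : ∀ b ∉ walshSupport B s f, φ b = c) :
    ∑ b, φ b = ((p : ℚ) ^ Module.finrank (ZMod p) V -
        (p : ℚ) ^ (Module.finrank (ZMod p) V - s)) * c +
      (∑ b ∈ plusFinset B s f, φ b + ∑ b ∈ minusFinset B s f, φ b) := by
  classical
  have h1 := card_plus_add_card_minus hp hB hf
  have h2 := sum_walshSupport (B := B) (s := s) (f := f) hp (fun _ => (1 : ℤ))
  simp only [Finset.sum_const, nsmul_eq_mul, mul_one] at h2
  rw [h1] at h2
  have h3 := Finset.card_filter_add_card_filter_not (s := (Finset.univ : Finset V))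
    (· ∈ walshSupport B s f)
  rw [Finset.card_univ, card_eq_pow_finrank (p := p)] at h3
  rw [← Finset.sum_filter_add_sum_filter_not Finset.univ (· ∈ walshSupport B s f),
    sum_walshSupport hp, add_comm]
  congr 1
  rw [Finset.sum_congr rfl (g := fun _ => c) (fun b hb => hφ b (Finset.mem_filter.1 hb).2),
    Finset.sum_const, nsmul_eq_mul]
  congr 1
  have h4 : ((Finset.univ.filter (· ∈ walshSupport B s f)).card : ℚ) =
    (p : ℚ) ^ (Module.finrank (ZMod p) V - s) := by exact_mod_cast h2
  rw [← h4]
  have h5 : ((Finset.univ.filter (· ∈ walshSupport B s f)).card : ℚ) +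
    ((Finset.univ.filter (· ∉ walshSupport B s f)).card : ℚ) =
    (p : ℚ) ^ Module.finrank (ZMod p) V := by exact_mod_cast h3
  rw [← h5]; ring

/-- The coefficient at `0` of the Walsh value at `b`. Here the Gauss vector is supported at `0`, so
only the vanishing of `f* b` matters. The shape `p^(n-1) + p * e` isolates the excess `e`; the bound
`4 ≤ n + s` keeps the exponent in `e` nonnegative. -/
theorem solCard_eq_even (hp : p ≠ 2) (hf : IsPlateaued B s f) {n : ℕ}
    (hn : Module.finrank (ZMod p) V = n) (hpar : Even (n + s)) (hn1 : 1 ≤ n) (h4 : 4 ≤ n + s)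
    (b : V) : solCard B f b = (p : ℤ) ^ (n - 1) + p * (eps B s f b *
      ((p : ℤ) ^ ((n + s) / 2 - 2) * ((if dual B s f b = 0 then (p : ℤ) else 0) - 1))) := by
  obtain ⟨g, hg⟩ := exists_isGaussVector hp (Module.finrank (ZMod p) V + s)
  have h := mul_fiberCard_eq hp hf hg b 0
  rw [hn] at hg h
  rw [hg.sum_even hpar, hg.of_even hpar, pow_pred_mul hn1,
    show (p : ℤ) ^ ((n + s) / 2) = p * (p * (p : ℤ) ^ ((n + s) / 2 - 2)) by
      rw [← pow_succ', ← pow_succ']; congr 1; omega] at h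
  simp only [zero_sub, neg_eq_zero] at h
  apply mul_left_cancel₀ (natCast_prime_ne_zero (p := p))
  rw [solCard, h]
  split_ifs <;> ring

/-- Here the Gauss vector is a multiple of the quadratic character, with sum zero. One unknown sign
`τ`, that of the Gauss sum, serves all `b`. -/
theorem solCard_eq_odd (hp : p ≠ 2) (hf : IsPlateaued B s f) {n : ℕ}
    (hn : Module.finrank (ZMod p) V = n) (hpar : Odd (n + s)) (hn1 : 1 ≤ n) (h3 : 3 ≤ n + s) :
    ∃ τ : ℤ, (τ = 1 ∨ τ = -1) ∧ ∀ b, solCard B f b = (p : ℤ) ^ (n - 1) +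
      p * ((p : ℤ) ^ ((n + s - 3) / 2) *
        (eps B s f b * τ * quadraticChar (ZMod p) (-dual B s f b))) := by
  obtain ⟨g, hg⟩ := exists_isGaussVector hp (Module.finrank (ZMod p) V + s)
  have h := fun b => mul_fiberCard_eq hp hf hg b 0
  rw [hn] at hg
  obtain ⟨τ, hτ, hgo⟩ := hg.of_odd hpar
  refine ⟨τ, hτ, fun b => ?_⟩
  have h := h b
  rw [hn, hg.sum_odd hp hpar, hgo, pow_pred_mul hn1,
    show (p : ℤ) ^ ((n + s - 1) / 2) = p * (p : ℤ) ^ ((n + s - 3) / 2) by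
      rw [← pow_succ']; congr 1; omega] at h
  simp only [zero_sub] at h
  apply mul_left_cancel₀ (natCast_prime_ne_zero (p := p))
  rw [solCard, h]
  ring

/-- For `n + s` even, the partial sums at `0` of the dual over `B₊(f)` and `B₋(f)`; `δ = 1` if
`0 ∈ B₊(f)` and `δ = 0` if `0 ∈ B₋(f)`. -/
theorem mul_fiberCard_dual_even (hp : p ≠ 2) (hB : B.Nondegenerate) (hBs : B.IsSymm)
    (hf : MemF B s f) {n : ℕ} (hn : Module.finrank (ZMod p) V = n) (hpar : Even (n + s)) :
    ∃ δ : ℤ, (0 ∈ Bplus B s f → δ = 1) ∧ (0 ∈ Bminus B s f → δ = 0) ∧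
      p * fiberCard (plusFinset B s f) (dual B s f) 0 = (plusFinset B s f).card +
        δ * ((p - 1) * (p : ℤ) ^ ((n - s) / 2)) ∧
      p * fiberCard (minusFinset B s f) (dual B s f) 0 = (minusFinset B s f).card +
        (δ - 1) * ((p - 1) * (p : ℤ) ^ ((n - s) / 2)) := by
  have hs : s ≤ n := hn ▸ hf.plateaued.1
  have hpar' : Even (n - s) := by
    rw [Nat.even_sub hs]; exact Nat.even_add.1 hpar
  obtain ⟨m, hm⟩ := hpar'
  have hsub := partialDual_sub hp hB hBs hf.plateaued 0
  obtain ⟨ε, hε, hsum⟩ := walshOn_dual_eq hp hB hBs hf.plateaued hf.dual_bent 0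
  rw [walshOn_eq hp] at hsum
  rw [hn, hm, ← two_mul, if_pos (odd_pow_two_mul_mod_four hp m), Int.cast_one, one_mul] at hsub
  rw [hn, hm, ← two_mul] at hsum
  rw [neg_zero, hf.map_zero] at hsum hsub
  -- The sum of the two partial sums has sign `ε` and their difference has sign `1`. Half the sum
  -- and half the difference of these identities give the factors `δ` and `δ - 1`.
  obtain ⟨δ, hδ⟩ : ∃ δ : ℤ, ε = 2 * δ - 1 := by
    rcases hε with rfl | rfl
    · exact ⟨1, by norm_num⟩
    · exact ⟨0, by norm_num⟩
  have hd0 : (fun x => dual B s f x - B 0 x) = dual B s f := by ext; simp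
  have hP : charSum (fiberCard (plusFinset B s f) (dual B s f)) =
      δ * (gam p (2 * m) * ZMod.stdAddChar (0 : ZMod p)) := by
    rw [partialDual_eq_charSum, partialDual_eq_charSum, hd0] at hsum hsub
    rw [hδ] at hsum
    push_cast at hsum
    linear_combination (1 / 2 : ℂ) * hsum + (1 / 2 : ℂ) * hsub
  have hM : charSum (fiberCard (minusFinset B s f) (dual B s f)) =
      (δ - 1 : ℤ) * (gam p (2 * m) * ZMod.stdAddChar (0 : ZMod p)) := by
    rw [partialDual_eq_charSum, partialDual_eq_charSum, hd0] at hsum hsub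
    rw [hδ] at hsum
    push_cast at hsum ⊢
    linear_combination (1 / 2 : ℂ) * hsum - (1 / 2 : ℂ) * hsub
  obtain ⟨g, hg⟩ := exists_isGaussVector hp (2 * m)
  have hdz := dual_zero hp hB hBs hf
  -- A symmetric set containing `0` has an odd fibre of `f*` over `0` and even fibres elsewhere, so
  -- its partial sum cannot vanish. Applied to whichever of `B₊(f)`, `B₋(f)` contains `0`, this
  -- decides `δ`.
  have hparity : ∀ (F : Finset V), (∀ x ∈ F, -x ∈ F) → 0 ∈ F → ∀ η : ℤ,
      charSum (fiberCard F (dual B s f)) = η * (gam p (2 * m) * ZMod.stdAddChar (0 : ZMod p)) →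
      η ≠ 0 := by
    intro F hF h0 η hη hη0
    have h1 := hg.coeff_sub_eq hη 0 1
    rw [hη0, zero_mul, sub_eq_zero] at h1
    have h2 := odd_fiberCard hp F hF (dual B s f) (dual_neg hp hB hBs hf) h0
    rw [hdz, h1] at h2
    exact Int.not_even_iff_odd.2 h2 (even_fiberCard hp F hF (dual B s f)
      (dual_neg hp hB hBs hf) (by rw [hdz]; exact zero_ne_one))
  have hδ01 : δ = 1 ∨ δ = 0 := by omega
  refine ⟨δ, fun h => ?_, fun h => ?_, ?_, ?_⟩
  · refine hδ01.resolve_right (hparity _ (fun x hx => ?_) (mem_plusFinset.2 h) δ hP)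
    exact mem_plusFinset.2 (neg_mem_Bplus hp hB hBs hf (mem_plusFinset.1 hx))
  · refine hδ01.resolve_left fun h1 => ?_
    refine hparity _ (fun x hx => ?_) (mem_minusFinset.2 h) _ hM (by omega)
    exact mem_minusFinset.2 (neg_mem_Bminus hp hB hBs hf (mem_minusFinset.1 hx))
  · rw [hg.mul_coeff_eq hP 0, sum_fiberCard, hg.sum_even (by simp), hg.of_even (by simp),
      sub_zero, if_pos rfl, hm, show (m + m) / 2 = m by omega, show 2 * m / 2 = m by omega]
    ring
  · rw [hg.mul_coeff_eq hM 0, sum_fiberCard, hg.sum_even (by simp), hg.of_even (by simp),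
      sub_zero, if_pos rfl, hm, show (m + m) / 2 = m by omega, show 2 * m / 2 = m by omega]
    ring

/-- The transform of `f*` at `0` has exponent `f 0 = 0`, and the quadratic character vanishes at
`0`. The zeros of `f*` on the support therefore have exactly the average number, `p^(n-s) / p`. -/
theorem fiberCard_dual_odd (hp : p ≠ 2) (hB : B.Nondegenerate) (hBs : B.IsSymm)
    (hf : MemF B s f) {n : ℕ} (hn : Module.finrank (ZMod p) V = n) (hpar : Odd (n + s))
    (hs : s + 1 ≤ n) :
    fiberCard (plusFinset B s f) (dual B s f) 0 + fiberCard (minusFinset B s f) (dual B s f) 0 =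
      (p : ℤ) ^ (n - s - 1) := by
  have hpar' : Odd (n - s) := by
    rw [Nat.odd_sub (by omega)]; exact Nat.odd_add.1 hpar
  obtain ⟨ε, hε, hsum⟩ := walshOn_dual_eq hp hB hBs hf.plateaued hf.dual_bent 0
  have hd0 : (fun x => dual B s f x - B 0 x) = dual B s f := by ext; simp
  rw [walshOn_eq hp, partialDual_eq_charSum, partialDual_eq_charSum, hd0, ← charSum_add,
    neg_zero, hf.map_zero, hn] at hsum
  obtain ⟨g, hg⟩ := exists_isGaussVector hp (n - s)
  obtain ⟨τ, -, hgo⟩ := hg.of_odd hpar'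
  have h := hg.mul_coeff_eq hsum 0
  have hc := card_plus_add_card_minus hp hB hf.plateaued
  rw [hg.sum_odd hp hpar', hgo, sub_self, MulChar.map_zero] at h
  simp only [Pi.add_apply, Finset.sum_add_distrib, sum_fiberCard, mul_zero, sub_zero, add_zero]
    at h
  rw [hc, hn, pow_pred_mul (show 1 ≤ n - s by omega)] at h
  exact mul_left_cancel₀ natCast_prime_ne_zero h

end Spectrum

end PlateauedCode

/-! ### Distribution of the excess -/

namespace PlateauedCode

section Distribution

variable {p : ℕ} [Fact p.Prime] {V : Type*} [AddCommGroup V] [Module (ZMod p) V] [Fintype V]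
  {B : LinearMap.BilinForm (ZMod p) V} {s : ℕ} {f : V → ZMod p}

/-- For `n + s` even, the distribution of the numbers of solutions of `f x = ⟨b, x⟩`. -/
theorem exists_excess_even (hp : p ≠ 2) (hB : B.Nondegenerate) (hBs : B.IsSymm)
    (hf : MemF B s f) {n k : ℕ} (hn : Module.finrank (ZMod p) V = n) (hpar : Even (n + s))
    (h2 : s + 2 ≤ n) (h4 : 4 ≤ n + s) (hk : (Bplus B s f).ncard = k) :
    ∃ (e : V → ℤ) (δ A A' : ℤ), (0 ∈ Bplus B s f → δ = 1) ∧ (0 ∈ Bminus B s f → δ = 0) ∧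
      p * A = k + δ * ((p - 1) * (p : ℤ) ^ ((n - s) / 2)) ∧
      p * A' = (p : ℤ) ^ (n - s) - k + (δ - 1) * ((p - 1) * (p : ℤ) ^ ((n - s) / 2)) ∧
      (∀ b, solCard B f b = (p : ℤ) ^ (n - 1) + p * e b) ∧
      e 0 = eps B s f 0 * ((p - 1) * (p : ℤ) ^ ((n + s) / 2 - 2)) ∧
      (∀ b, |e b| ≤ (p - 1) * (p : ℤ) ^ ((n + s) / 2 - 2)) ∧
      (5 ≤ n + s → ∀ b, (p : ℤ) ∣ e b) ∧
      ∀ φ : ℤ → ℚ, ∑ b, φ (e b) = ((p : ℚ) ^ n - (p : ℚ) ^ (n - s)) * φ 0 +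
        A * φ ((p - 1) * (p : ℤ) ^ ((n + s) / 2 - 2)) + (k - A) * φ (-(p : ℤ) ^ ((n + s) / 2 - 2)) +
        A' * φ (-((p - 1) * (p : ℤ) ^ ((n + s) / 2 - 2))) +
        ((p : ℚ) ^ (n - s) - k - A') * φ ((p : ℤ) ^ ((n + s) / 2 - 2)) := by
  obtain ⟨δ, hδ1, hδ0, hA, hA'⟩ := mul_fiberCard_dual_even hp hB hBs hf hn hpar
  have hcm := card_plus_add_card_minus hp hB hf.plateaued
  rw [hn, card_plusFinset, hk] at hcm
  rw [card_plusFinset, hk] at hA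
  have hm : ((minusFinset B s f).card : ℤ) = (p : ℤ) ^ (n - s) - k := by rw [← hcm]; ring
  rw [hm] at hA'
  set h : ℤ := (p : ℤ) ^ ((n + s) / 2 - 2) with hh
  have hh0 : 0 ≤ h := by positivity
  have hp3 : (3 : ℤ) ≤ p := by
    have := (Fact.out : p.Prime).two_le
    exact_mod_cast (show 3 ≤ p by omega)
  refine ⟨fun b => eps B s f b * (h * ((if dual B s f b = 0 then (p : ℤ) else 0) - 1)), δ, _, _,
    hδ1, hδ0, hA, hA', ?_, ?_, ?_, fun h5 b => ?_, ?_⟩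
  · exact solCard_eq_even hp hf.plateaued hn hpar (by omega) h4
  · simp only [dual_zero hp hB hBs hf, if_true]; ring
  · intro b
    have he : |eps B s f b| ≤ 1 := by
      rw [eps]; split_ifs <;> simp
    have hq : |h * ((if dual B s f b = 0 then (p : ℤ) else 0) - 1)| ≤ (p - 1) * h := by
      rw [abs_mul, abs_of_nonneg hh0, mul_comm]
      refine mul_le_mul_of_nonneg_right ?_ hh0
      split_ifs
      · rw [abs_of_nonneg (by linarith)]
      · rw [zero_sub, abs_neg, abs_one]; linarith
    rw [abs_mul]
    calc _ ≤ 1 * |h * ((if dual B s f b = 0 then (p : ℤ) else 0) - 1)| :=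
          mul_le_mul_of_nonneg_right he (abs_nonneg _)
      _ ≤ _ := by rw [one_mul]; exact hq
  -- For `n + s` even, `5 ≤ n + s` means `6 ≤ n + s`, so the exponent `(n + s) / 2 - 2` is positive.
  · refine Dvd.dvd.mul_left (Dvd.dvd.mul_right (dvd_pow_self _ ?_) _) _
    have := Nat.even_iff.1 hpar
    omega
  · intro φ
    beta_reduce
    rw [sum_univ_eq hp hB hf.plateaued _ (φ 0) (fun b hb => by simp only [eps_of_not_mem hb, zero_mul]),
      hn]
    have e1 : ∑ b ∈ plusFinset B s f,
        φ (eps B s f b * (h * ((if dual B s f b = 0 then (p : ℤ) else 0) - 1))) =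
        ∑ b ∈ plusFinset B s f, if dual B s f b = 0 then φ ((p - 1) * h) else φ (-h) := by
      refine Finset.sum_congr rfl fun b hb => ?_
      rw [eps_of_mem_Bplus (mem_plusFinset.1 hb)]
      split_ifs
      · congr 1; ring
      · congr 1; ring
    have e2 : ∑ b ∈ minusFinset B s f,
        φ (eps B s f b * (h * ((if dual B s f b = 0 then (p : ℤ) else 0) - 1))) =
        ∑ b ∈ minusFinset B s f, if dual B s f b = 0 then φ (-((p - 1) * h)) else φ h := by
      refine Finset.sum_congr rfl fun b hb => ?_
      rw [eps_of_mem_Bminus (mem_minusFinset.1 hb)]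
      split_ifs
      · congr 1; ring
      · congr 1; ring
    rw [e1, e2, sum_ite_eq_fiberCard, sum_ite_eq_fiberCard, card_plusFinset, hk]
    have hm' : ((minusFinset B s f).card : ℚ) = (p : ℚ) ^ (n - s) - k := by exact_mod_cast hm
    rw [hm']
    ring

/-- For `n + s` odd, the distribution of the numbers of solutions of `f x = ⟨b, x⟩`. -/
theorem exists_excess_odd (hp : p ≠ 2) (hB : B.Nondegenerate) (hBs : B.IsSymm)
    (hf : MemF B s f) {n : ℕ} (hn : Module.finrank (ZMod p) V = n) (hpar : Odd (n + s))
    (h1 : s + 1 ≤ n) (h3 : 3 ≤ n + s) :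
    ∃ e : V → ℤ, (∀ b, solCard B f b = (p : ℤ) ^ (n - 1) + p * e b) ∧ e 0 = 0 ∧
      (∀ b, |e b| ≤ (p : ℤ) ^ ((n + s - 3) / 2)) ∧
      (5 ≤ n + s → ∀ b, (p : ℤ) ∣ e b) ∧
      ∀ φ : ℤ → ℚ, ∑ b, φ (e b) =
        ((p : ℚ) ^ n - (p : ℚ) ^ (n - s) + (p : ℚ) ^ (n - s - 1)) * φ 0 +
        ((p : ℚ) - 1) / 2 * ((p : ℚ) ^ (n - s - 1) + (p : ℚ) ^ ((n - s - 1) / 2)) *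
          φ ((p : ℤ) ^ ((n + s - 3) / 2)) +
        ((p : ℚ) - 1) / 2 * ((p : ℚ) ^ (n - s - 1) - (p : ℚ) ^ ((n - s - 1) / 2)) *
          φ (-(p : ℤ) ^ ((n + s - 3) / 2)) := by
  obtain ⟨τ, hτ, hsol⟩ := solCard_eq_odd hp hf.plateaued hn hpar (by omega) h3
  have hn0 := fiberCard_dual_odd hp hB hBs hf hn hpar h1
  have hcm := card_plus_add_card_minus hp hB hf.plateaued
  rw [hn] at hcm
  set P : ℤ := (p : ℤ) ^ ((n + s - 3) / 2) with hP
  set σ : V → ℤ := fun b => eps B s f b * τ * quadraticChar (ZMod p) (-dual B s f b) with hσ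
  have hτ2 : τ ^ 2 = 1 := by rcases hτ with rfl | rfl <;> norm_num
  have hχ : ∀ b, (quadraticChar (ZMod p) (-dual B s f b)) ^ 2 =
      if dual B s f b = 0 then 0 else 1 := by
    intro b
    split_ifs with h
    · rw [h, neg_zero, MulChar.map_zero]; norm_num
    · exact quadraticChar_sq_one (neg_ne_zero.2 h)
  have hε : ∀ b ∈ walshSupport B s f, eps B s f b ^ 2 = 1 := by
    intro b hb
    rcases mem_Bplus_or_mem_Bminus hp hb with h | h
    · rw [eps_of_mem_Bplus h]; norm_num
    · rw [eps_of_mem_Bminus h]; norm_num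
  have hσ2 : ∀ b ∈ walshSupport B s f, ((σ b : ℚ)) ^ 2 = if dual B s f b = 0 then 0 else 1 := by
    intro b hb
    have : (σ b) ^ 2 = if dual B s f b = 0 then 0 else 1 := by
      simp only [hσ]
      rw [mul_pow, mul_pow, hε b hb, hτ2, hχ, one_mul, one_mul]
    exact_mod_cast this
  have hσv : ∀ b, σ b = 0 ∨ σ b = 1 ∨ σ b = -1 := by
    intro b
    by_cases hb : b ∈ walshSupport B s f
    · have h := hσ2 b hb
      split_ifs at h
      · left; exact_mod_cast pow_eq_zero_iff (two_ne_zero) |>.1 h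
      · right
        have h' : (σ b) ^ 2 = 1 := by exact_mod_cast h
        exact mul_self_eq_one_iff.1 (by rwa [← sq])
    · left; simp [hσ, eps_of_not_mem hb]
  -- The second moment counts the points of the support where `f*` does not vanish.
  have hsq : ∑ b, (σ b : ℚ) ^ 2 = (p : ℚ) ^ (n - s) - (p : ℚ) ^ (n - s - 1) := by
    rw [sum_univ_eq hp hB hf.plateaued _ 0 (fun b hb => by simp [hσ, eps_of_not_mem hb]),
      Finset.sum_congr rfl (fun b hb => hσ2 b (mem_plusFinset.1 hb).1),
      Finset.sum_congr rfl (fun b hb => hσ2 b (mem_minusFinset.1 hb).1),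
      sum_ite_eq_fiberCard, sum_ite_eq_fiberCard]
    have e1 : ((plusFinset B s f).card + (minusFinset B s f).card : ℚ) = (p : ℚ) ^ (n - s) := by
      exact_mod_cast hcm
    have e2 : (fiberCard (plusFinset B s f) (dual B s f) 0 +
        fiberCard (minusFinset B s f) (dual B s f) 0 : ℚ) = (p : ℚ) ^ (n - s - 1) := by
      exact_mod_cast hn0
    linear_combination e1 - e2
  -- The first moment comes from double counting the pairs `(b, x)` with `f x = ⟨b, x⟩`. It settles
  -- how often `1` and `-1` occur without knowledge of `τ`.
  have hsum : ∑ b, (σ b : ℚ) = (p - 1) * (p : ℚ) ^ ((n - s - 1) / 2) := by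
    have h := sum_solCard hB hf.map_zero hn (by omega)
    rw [Finset.sum_congr rfl fun b _ => hsol b, Finset.sum_add_distrib, Finset.sum_const,
      Finset.card_univ, card_eq_pow_finrank (p := p), hn, ← Finset.mul_sum, ← Finset.mul_sum,
      nsmul_eq_mul, ← mul_assoc] at h
    have e1 : (p : ℤ) * P = (p : ℤ) ^ ((n + s - 1) / 2) := by
      rw [hP, ← pow_succ']; congr 1; omega
    have e2 : (p : ℤ) ^ (n - 1) = (p : ℤ) ^ ((n + s - 1) / 2) * (p : ℤ) ^ ((n - s - 1) / 2) := by
      rw [← pow_add]; congr 1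
      have := Nat.odd_iff.1 hpar
      omega
    have e3 : (p : ℤ) ^ n = p * (p : ℤ) ^ (n - 1) := pow_pred_mul (by omega)
    rw [e1] at h
    have : ∑ b, σ b = (p - 1) * (p : ℤ) ^ ((n - s - 1) / 2) := by
      apply mul_left_cancel₀ (pow_ne_zero ((n + s - 1) / 2) (natCast_prime_ne_zero (p := p)))
      push_cast at h
      linear_combination h + e3 + (p - 1) * e2
    exact_mod_cast this
  -- Lagrange interpolation at the three values of `σ`, which reduces any statistic to the two
  -- moments.
  have hpow : ∀ φ : ℤ → ℚ, ∀ b, φ (P * σ b) = φ 0 * (1 - (σ b : ℚ) ^ 2) +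
      φ P * (((σ b : ℚ) ^ 2 + σ b) / 2) + φ (-P) * (((σ b : ℚ) ^ 2 - σ b) / 2) := by
    intro φ b
    rcases hσv b with h | h | h <;> rw [h] <;> norm_num
  refine ⟨fun b => P * σ b, hsol, ?_, ?_, fun h5 b => ?_, ?_⟩
  · simp [hσ, dual_zero hp hB hBs hf]
  · intro b
    have hP0 : 0 ≤ P := by positivity
    rcases hσv b with h | h | h <;> simp [h, abs_of_nonneg hP0, hP0]
  · exact Dvd.dvd.mul_right (dvd_pow_self _ (by omega)) _
  · intro φ
    simp_rw [hpow φ]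
    rw [Finset.sum_add_distrib, Finset.sum_add_distrib, ← Finset.mul_sum, ← Finset.mul_sum,
      ← Finset.mul_sum, ← Finset.sum_div, ← Finset.sum_div, Finset.sum_sub_distrib,
      Finset.sum_add_distrib, Finset.sum_sub_distrib, hsq, hsum, Finset.sum_const,
      Finset.card_univ, card_eq_pow_finrank (p := p), hn, nsmul_eq_mul]
    have e4 : (p : ℚ) ^ (n - s) = p * (p : ℚ) ^ (n - s - 1) := by
      rw [← pow_succ']; congr 1; omega
    push_cast
    rw [e4]
    ring

end Distribution

end PlateauedCode

/-! ### The encoding map and the weights of codewords -/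

namespace PlateauedCode

section Encode

variable {p : ℕ} [Fact p.Prime] {V : Type*} [AddCommGroup V] [Module (ZMod p) V]
  {B : LinearMap.BilinForm (ZMod p) V} {f : V → ZMod p}

/-- The encoding map of the punctured code. -/
def encode (B : LinearMap.BilinForm (ZMod p) V) (f : V → ZMod p) :
    (ZMod p × V) →ₗ[ZMod p] ({x : V // f x ≠ 0} → ZMod p) where
  toFun ab := fun x => ab.1 * f x.1 + B ab.2 x.1
  map_add' u v := by
    funext x
    simp only [Prod.fst_add, Prod.snd_add, map_add, LinearMap.add_apply, Pi.add_apply]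
    ring
  map_smul' c u := by
    funext x
    simp only [Prod.smul_fst, Prod.smul_snd, map_smul, LinearMap.smul_apply, smul_eq_mul,
      Pi.smul_apply, RingHom.id_apply]
    ring

theorem range_encode : LinearMap.range (encode B f) = puncturedCode B f := by
  ext c
  constructor
  · rintro ⟨⟨a, b⟩, rfl⟩
    exact ⟨a, b, rfl⟩
  · rintro ⟨a, b, rfl⟩
    exact ⟨(a, b), rfl⟩

end Encode

/-- The indicator of `v = w`. -/
def indicatorEq (w v : ℤ) : ℚ := if v = w then 1 else 0

section Weights

variable {p : ℕ} [Fact p.Prime] {V : Type*} [AddCommGroup V] [Module (ZMod p) V] [Fintype V]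
  {B : LinearMap.BilinForm (ZMod p) V} {s : ℕ} {f : V → ZMod p}

/-- The weight of the codeword `(a f(x) + ⟨b, x⟩)_{x : f x ≠ 0}`. -/
def codeWeight (B : LinearMap.BilinForm (ZMod p) V) (f : V → ZMod p) (a : ZMod p) (b : V) : ℤ :=
  (Finset.univ.filter fun x => f x ≠ 0 ∧ a * f x + B b x ≠ 0).card

theorem card_bilin_eq_zero (hB : B.Nondegenerate) (hBs : B.IsSymm) {n : ℕ}
    (hn : Module.finrank (ZMod p) V = n) (hn1 : 1 ≤ n) {b : V} (hb : b ≠ 0) :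
    ((Finset.univ.filter fun x => B b x = 0).card : ℤ) = (p : ℤ) ^ (n - 1) := by
  have h := mul_fiberCard_bilin_right hB hBs hb 0
  rw [hn, pow_pred_mul hn1] at h
  have := mul_left_cancel₀ natCast_prime_ne_zero h
  rw [← this, fiberCard]

theorem solCard_eq_card (b : V) :
    solCard B f b = (Finset.univ.filter fun x => f x = B b x).card := by
  rw [solCard, fiberCard]
  congr 2
  ext x
  simp [sub_eq_zero]

theorem solCard_zero_eq_card :
    solCard B f 0 = (Finset.univ.filter fun x => f x = 0).card := by
  simp [solCard_eq_card]

/-- Count the pairs `(x, z)` with `f x = z ⟨b, x⟩` in two ways. A point with `⟨b, x⟩ ≠ 0` admits one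
`z`; a point with `⟨b, x⟩ = 0` admits all `p` if `f x = 0` and none otherwise. For fixed `z ≠ 0` the
number of `x` is that for `z = 1`, by scaling invariance. -/
theorem mul_card_inter (hp : p ≠ 2) (hB : B.Nondegenerate) (hBs : B.IsSymm) (hf : MemF B s f)
    {n : ℕ} (hn : Module.finrank (ZMod p) V = n) (hn1 : 1 ≤ n) {b : V} (hb : b ≠ 0) :
    p * ((Finset.univ.filter fun x => f x = 0 ∧ B b x = 0).card : ℤ) =
      solCard B f 0 + (p - 1) * solCard B f b - (p - 1) * (p : ℤ) ^ (n - 1) := by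
  have h1 : ∑ z : ZMod p, solCard B f (z • b) = solCard B f 0 + (p - 1) * solCard B f b := by
    rw [← Finset.add_sum_erase _ _ (Finset.mem_univ (0 : ZMod p)), zero_smul,
      Finset.sum_congr rfl fun z hz => solCard_smul hp hB hBs hf (Finset.ne_of_mem_erase hz) b,
      Finset.sum_const, Finset.card_erase_of_mem (Finset.mem_univ _), Finset.card_univ, ZMod.card,
      nsmul_eq_mul, Nat.cast_sub (Fact.out : p.Prime).one_le, Nat.cast_one]
  have h2 : ∑ z : ZMod p, solCard B f (z • b) =
      ∑ x, ∑ z : ZMod p, if f x = z * B b x then (1 : ℤ) else 0 := by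
    rw [Finset.sum_comm]
    refine Finset.sum_congr rfl fun z _ => ?_
    rw [solCard_eq_card, Finset.sum_boole]
    simp
  have h3 : ∀ x, (∑ z : ZMod p, if f x = z * B b x then (1 : ℤ) else 0) =
      1 - (if B b x = 0 then 1 else 0) + p * (if f x = 0 ∧ B b x = 0 then 1 else 0) := by
    intro x
    by_cases hx : B b x = 0
    · by_cases hfx : f x = 0
      · simp [hx, hfx]
      · simp [hx, hfx]
    · rw [Finset.sum_eq_single (f x / B b x)]
      · simp [hx]
      · intro z _ hz
        rw [if_neg]
        intro h
        exact hz (by rw [h]; field_simp)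
      · simp
  have h4 := card_bilin_eq_zero hB hBs hn hn1 hb
  rw [h1, Finset.sum_congr rfl fun x _ => h3 x, Finset.sum_add_distrib, Finset.sum_sub_distrib,
    ← Finset.mul_sum, Finset.sum_boole, Finset.sum_boole, Finset.sum_const, Finset.card_univ,
    card_eq_pow_finrank (p := p), hn] at h2
  have h5 : (p : ℤ) ^ n = p * (p : ℤ) ^ (n - 1) := pow_pred_mul hn1
  simp only [Nat.cast_pow, nsmul_eq_mul, mul_one] at h2
  linear_combination -h2 - h5 + h4

/-- Inclusion and exclusion; where `f x = 0`, the second condition does not involve `a`. -/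
theorem codeWeight_eq (a : ZMod p) (b : V) {n : ℕ} (hn : Module.finrank (ZMod p) V = n) :
    codeWeight B f a b = (p : ℤ) ^ n - solCard B f 0 -
      (Finset.univ.filter fun x => a * f x + B b x = 0).card +
      (Finset.univ.filter fun x => f x = 0 ∧ B b x = 0).card := by
  have h : ∀ x, (if f x ≠ 0 ∧ a * f x + B b x ≠ 0 then (1 : ℤ) else 0) =
      1 - (if f x = 0 then 1 else 0) - (if a * f x + B b x = 0 then 1 else 0) +
      (if f x = 0 ∧ B b x = 0 then 1 else 0) := by
    intro x
    by_cases h1 : f x = 0 <;> by_cases h2 : a * f x + B b x = 0 <;> simp_all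
  have h2 := Finset.sum_congr (rfl : (Finset.univ : Finset V) = Finset.univ) fun x _ => h x
  rw [Finset.sum_add_distrib, Finset.sum_sub_distrib, Finset.sum_sub_distrib, Finset.sum_boole,
    Finset.sum_boole, Finset.sum_boole, Finset.sum_boole, Finset.sum_const, Finset.card_univ,
    card_eq_pow_finrank (p := p), hn] at h2
  rw [codeWeight, solCard_zero_eq_card]
  simpa using h2

theorem codeWeight_zero_zero : codeWeight B f 0 0 = 0 := by
  simp [codeWeight]

theorem card_support {n : ℕ} (hn : Module.finrank (ZMod p) V = n) :
    ((Finset.univ.filter fun x => f x ≠ 0).card : ℤ) = (p : ℤ) ^ n - solCard B f 0 := by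
  have h3 := Finset.card_filter_add_card_filter_not (s := (Finset.univ : Finset V))
    (fun x => f x = 0)
  rw [Finset.card_univ, card_eq_pow_finrank (p := p), hn] at h3
  rw [solCard_zero_eq_card, eq_sub_iff_add_eq, add_comm]
  exact_mod_cast h3

theorem codeWeight_right_zero {a : ZMod p} (ha : a ≠ 0) :
    codeWeight B f a 0 = (Finset.univ.filter fun x => f x ≠ 0).card := by
  simp [codeWeight, ha]

variable {n : ℕ} {e : V → ℤ}

theorem codeWeight_zero_left (hp : p ≠ 2) (hB : B.Nondegenerate) (hBs : B.IsSymm) (hf : MemF B s f)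
    (hn : Module.finrank (ZMod p) V = n) (hn2 : 2 ≤ n)
    (he : ∀ b, solCard B f b = (p : ℤ) ^ (n - 1) + p * e b) {b : V} (hb : b ≠ 0) :
    codeWeight B f 0 b = (p - 1) ^ 2 * (p : ℤ) ^ (n - 2) + (p - 1) * (e b - e 0) := by
  have h1 := mul_card_inter hp hB hBs hf hn (by omega) hb
  have h2 := codeWeight_eq (B := B) (f := f) 0 b hn
  have h3 := card_bilin_eq_zero hB hBs hn (by omega) hb
  simp only [zero_mul, zero_add] at h2
  have h5 : (p : ℤ) ^ n = p * (p : ℤ) ^ (n - 1) := pow_pred_mul (by omega)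
  have h6 : (p : ℤ) ^ (n - 1) = p * (p : ℤ) ^ (n - 2) := pow_pred_mul (n := n - 1) (by omega)
  rw [h3, he] at h2
  rw [he, he, h6] at h1
  apply mul_left_cancel₀ (natCast_prime_ne_zero (p := p))
  rw [h2, h5, h6]
  linear_combination h1

theorem codeWeight_of_ne_zero (hp : p ≠ 2) (hB : B.Nondegenerate) (hBs : B.IsSymm)
    (hf : MemF B s f) (hn : Module.finrank (ZMod p) V = n) (hn2 : 2 ≤ n)
    (he : ∀ b, solCard B f b = (p : ℤ) ^ (n - 1) + p * e b) {a : ZMod p} (ha : a ≠ 0)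
    {b : V} (hb : b ≠ 0) :
    codeWeight B f a b = (p - 1) ^ 2 * (p : ℤ) ^ (n - 2) - (p - 1) * e 0 - e b := by
  have h1 := codeWeight_zero_left hp hB hBs hf hn hn2 he hb
  have h2 := codeWeight_eq (B := B) (f := f) 0 b hn
  have h2' := codeWeight_eq (B := B) (f := f) a b hn
  have h3 := card_bilin_eq_zero hB hBs hn (by omega) hb
  -- The equation reads `f x = ⟨-a⁻¹ b, x⟩`, and scaling invariance removes the factor `-a⁻¹`.
  have h4 : ((Finset.univ.filter fun x => a * f x + B b x = 0).card : ℤ) = solCard B f b := by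
    rw [← solCard_smul hp hB hBs hf (neg_ne_zero.2 (inv_ne_zero ha)) b, solCard_eq_card]
    congr 2
    ext x
    simp only [Finset.mem_filter, Finset.mem_univ, true_and, map_smul, LinearMap.smul_apply,
      smul_eq_mul]
    constructor
    · intro h
      have : a * f x = -B b x := eq_neg_of_add_eq_zero_left h
      apply mul_left_cancel₀ ha
      rw [this]
      field_simp
    · intro h
      rw [h]
      field_simp
      ring
  simp only [zero_mul, zero_add] at h2
  rw [h3] at h2
  rw [h4, he 0, he b] at h2'
  rw [he 0] at h2
  linear_combination h2' + h1 - h2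

/-- This gives injectivity of the encoding. The bound `h1` makes the weights with `a = 0` positive,
`h2` those with `a` and `b` nonzero, and `h2` at `b = 0` those with `b = 0`. -/
theorem codeWeight_ne_zero (hp : p ≠ 2) (hB : B.Nondegenerate) (hBs : B.IsSymm)
    (hf : MemF B s f) (hn : Module.finrank (ZMod p) V = n) (hn2 : 2 ≤ n)
    (he : ∀ b, solCard B f b = (p : ℤ) ^ (n - 1) + p * e b)
    (h1 : ∀ b, e 0 - e b < (p - 1) * (p : ℤ) ^ (n - 2))
    (h2 : ∀ b, (p - 1) * e 0 + e b < (p - 1) ^ 2 * (p : ℤ) ^ (n - 2))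
    {a : ZMod p} {b : V} (hab : a ≠ 0 ∨ b ≠ 0) : codeWeight B f a b ≠ 0 := by
  have hp2 : (2 : ℤ) ≤ p := by exact_mod_cast (Fact.out : p.Prime).two_le
  by_cases hb : b = 0
  · have ha := hab.resolve_right (not_not.2 hb)
    rw [hb, codeWeight_right_zero ha, card_support (B := B) hn, he,
      show (p : ℤ) ^ n = p * (p : ℤ) ^ (n - 1) from pow_pred_mul (by omega),
      show (p : ℤ) ^ (n - 1) = p * (p : ℤ) ^ (n - 2) from pow_pred_mul (n := n - 1) (by omega)]
    have h3 := h2 0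
    have h4 : 0 < (p : ℤ) ^ (n - 2) := by positivity
    apply ne_of_gt
    nlinarith
  · by_cases ha : a = 0
    · rw [ha, codeWeight_zero_left hp hB hBs hf hn hn2 he hb]
      have h3 := h1 b
      apply ne_of_gt
      have : 0 < ((p : ℤ) - 1) * ((p - 1) * (p : ℤ) ^ (n - 2) - (e 0 - e b)) :=
        mul_pos (by linarith) (by linarith)
      linarith
    · rw [codeWeight_of_ne_zero hp hB hBs hf hn hn2 he ha hb]
      have h3 := h2 b
      apply ne_of_gt
      linarith

theorem hammingNorm_encode (a : ZMod p) (b : V) :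
    (hammingNorm (encode B f (a, b)) : ℤ) = codeWeight B f a b := by
  rw [hammingNorm, codeWeight, Nat.cast_inj, ← Finset.card_map (Function.Embedding.subtype _)]
  congr 1
  ext x
  simp only [Finset.mem_map, Finset.mem_filter, Finset.mem_univ, true_and]
  constructor
  · rintro ⟨⟨y, hy⟩, h, rfl⟩
    exact ⟨hy, h⟩
  · rintro ⟨hx, h⟩
    exact ⟨⟨x, hx⟩, h, rfl⟩

theorem encode_injective (h : ∀ (a : ZMod p) (b : V), a ≠ 0 ∨ b ≠ 0 → codeWeight B f a b ≠ 0) :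
    Function.Injective (encode B f) := by
  rw [← LinearMap.ker_eq_bot, LinearMap.ker_eq_bot']
  rintro ⟨a, b⟩ hab
  by_contra hne
  refine h a b ?_ ?_
  · by_contra hc
    push Not at hc
    exact hne (by rw [hc.1, hc.2]; rfl)
  · rw [← hammingNorm_encode, hab, hammingNorm_zero, Nat.cast_zero]

theorem finrank_puncturedCode (hn : Module.finrank (ZMod p) V = n)
    (h : ∀ (a : ZMod p) (b : V), a ≠ 0 ∨ b ≠ 0 → codeWeight B f a b ≠ 0) :
    Module.finrank (ZMod p) (puncturedCode B f) = n + 1 := by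
  rw [← range_encode, LinearMap.finrank_range_of_inj (encode_injective h), Module.finrank_prod,
    Module.finrank_self, hn, add_comm]

/-- The number of codewords of weight `w`, in terms of the numbers of solutions of
`f x = ⟨b, x⟩`. -/
theorem ncard_weight_eq (hp : p ≠ 2) (hB : B.Nondegenerate) (hBs : B.IsSymm)
    (hf : MemF B s f) (hn : Module.finrank (ZMod p) V = n) (hn2 : 2 ≤ n)
    (he : ∀ b, solCard B f b = (p : ℤ) ^ (n - 1) + p * e b)
    (h : ∀ (a : ZMod p) (b : V), a ≠ 0 ∨ b ≠ 0 → codeWeight B f a b ≠ 0) (w : ℤ)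
    (φ₀ φ₁ : ℤ → ℚ)
    (hφ₀ : φ₀ = fun t => indicatorEq w ((p - 1) ^ 2 * (p : ℤ) ^ (n - 2) + (p - 1) * (t - e 0)))
    (hφ₁ : φ₁ = fun t => indicatorEq w ((p - 1) ^ 2 * (p : ℤ) ^ (n - 2) - (p - 1) * e 0 - t)) :
    (({c : {x : V // f x ≠ 0} → ZMod p | c ∈ puncturedCode B f ∧
      (hammingNorm c : ℤ) = w}.ncard : ℕ) : ℚ) =
      indicatorEq w 0 + (p - 1) * indicatorEq w ((p - 1) * (p : ℤ) ^ (n - 1) - p * e 0) +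
      (∑ b, φ₀ (e b) - φ₀ (e 0)) + (p - 1) * (∑ b, φ₁ (e b) - φ₁ (e 0)) := by
  unfold indicatorEq at hφ₀ hφ₁ ⊢
  classical
  have hset : {c : {x : V // f x ≠ 0} → ZMod p | c ∈ puncturedCode B f ∧
      (hammingNorm c : ℤ) = w} = encode B f ''
      (Finset.univ.filter fun ab : ZMod p × V => codeWeight B f ab.1 ab.2 = w : Finset _) := by
    ext c
    simp only [← range_encode, Set.mem_ofPred_eq, LinearMap.mem_range, Set.mem_image,
      Finset.coe_filter, Finset.mem_univ, true_and]
    constructor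
    · rintro ⟨⟨ab, rfl⟩, h2⟩
      exact ⟨ab, by rw [← h2, ← hammingNorm_encode], rfl⟩
    · rintro ⟨ab, h2, rfl⟩
      exact ⟨⟨ab, rfl⟩, by rw [← h2, ← hammingNorm_encode]⟩
  rw [hset, Set.ncard_image_of_injective _ (encode_injective h), Set.ncard_coe_finset,
    ← Finset.sum_boole, Fintype.sum_prod_type]
  have hz : ∀ b, b ∈ Finset.univ.erase (0 : V) →
      (if codeWeight B f 0 b = w then (1 : ℚ) else 0) = φ₀ (e b) := by
    intro b hb
    rw [codeWeight_zero_left hp hB hBs hf hn hn2 he (Finset.ne_of_mem_erase hb), hφ₀]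
  have hnz : ∀ a : ZMod p, a ≠ 0 → ∀ b, b ∈ Finset.univ.erase (0 : V) →
      (if codeWeight B f a b = w then (1 : ℚ) else 0) = φ₁ (e b) := by
    intro a ha b hb
    rw [codeWeight_of_ne_zero hp hB hBs hf hn hn2 he ha (Finset.ne_of_mem_erase hb), hφ₁]
  have hm : ∀ a : ZMod p, a ≠ 0 → codeWeight B f a 0 = (p - 1) * (p : ℤ) ^ (n - 1) - p * e 0 := by
    intro a ha
    rw [codeWeight_right_zero ha, card_support (B := B) hn, he,
      show (p : ℤ) ^ n = p * (p : ℤ) ^ (n - 1) from pow_pred_mul (by omega)]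
    ring
  have hrow : ∀ a ∈ Finset.univ.erase (0 : ZMod p),
      (∑ b, if codeWeight B f a b = w then (1 : ℚ) else 0) =
      (if (p - 1) * (p : ℤ) ^ (n - 1) - p * e 0 = w then 1 else 0) +
        ∑ b ∈ Finset.univ.erase 0, φ₁ (e b) := by
    intro a ha
    rw [← Finset.add_sum_erase _ _ (Finset.mem_univ (0 : V)), hm a (Finset.ne_of_mem_erase ha),
      Finset.sum_congr rfl (hnz a (Finset.ne_of_mem_erase ha))]
  -- The pairs `(a, b)` split according to whether `a` and `b` vanish. The sums over `b ≠ 0` are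
  -- full sums minus the term at `0`.
  rw [← Finset.add_sum_erase _ _ (Finset.mem_univ (0 : ZMod p)),
    ← Finset.add_sum_erase _ _ (Finset.mem_univ (0 : V)), codeWeight_zero_zero,
    Finset.sum_congr rfl hz, Finset.sum_congr rfl hrow, Finset.sum_const, Finset.card_erase_of_mem (Finset.mem_univ _), Finset.card_univ, ZMod.card,
    nsmul_eq_mul, Nat.cast_sub (Fact.out : p.Prime).one_le, Nat.cast_one,
    Finset.sum_erase_eq_sub (Finset.mem_univ _), Finset.sum_erase_eq_sub (Finset.mem_univ _)]
  ring

end Weights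

end PlateauedCode

/-! ### The dual code and its minimum distance -/

namespace PlateauedCode

section Codes

variable {F : Type*} [Field F] {ι : Type*} [Fintype ι]

theorem finrank_dualCode (C : Submodule F (ι → F)) :
    (Module.finrank F (dualCode C) : ℤ) = Fintype.card ι - Module.finrank F C := by
  let D : LinearMap.BilinForm F (ι → F) := dotProductBilin F F
  have hD : D.Nondegenerate :=
    ⟨fun x hx => dotProduct_eq_zero x hx,
      fun x hx => dotProduct_eq_zero x fun y => by rw [dotProduct_comm]; exact hx y⟩
  have h := LinearMap.BilinForm.finrank_orthogonal hD C
  have h2 : dualCode C = LinearMap.BilinForm.orthogonal D C := by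
    ext x
    refine forall₂_congr fun y _ => ?_
    rw [dotProduct_comm]
    rfl
  have h3 := Submodule.finrank_le C
  rw [h2, h, Nat.cast_sub h3, Module.finrank_fintype_fun_eq_card]

variable [DecidableEq F]

theorem hasMinDist_of_norm {C : Submodule F (ι → F)} {d : ℕ}
    (h1 : ∀ c ∈ C, c ≠ 0 → d ≤ hammingNorm c) (h2 : ∃ c ∈ C, c ≠ 0 ∧ hammingNorm c ≤ d) :
    HasMinDist C d := by
  constructor
  · obtain ⟨c, hc, hc0, hcd⟩ := h2
    refine ⟨c, hc, 0, C.zero_mem, hc0, ?_⟩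
    rw [hammingDist_zero_right]
    exact le_antisymm hcd (h1 c hc hc0)
  · rintro m ⟨x, hx, y, hy, hxy, rfl⟩
    rw [hammingDist_eq_hammingNorm]
    exact h1 _ (C.add_mem (C.neg_mem hx) hy) (fun h => hxy (neg_add_eq_zero.1 h))

/-- Makes a table linear in indicators of its weights, so that rows with coinciding weights need no
case distinction. -/
theorem table_sum_eq (T : List (ℤ × ℚ)) (w : ℤ) :
    ((T.filter (fun r => r.1 = w)).map Prod.snd).sum =
      (T.map fun r => r.2 * indicatorEq w r.1).sum := by
  induction T with
  | nil => rfl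
  | cons r T ih =>
    rw [List.filter_cons, List.map_cons, List.sum_cons, ← ih]
    by_cases h : r.1 = w <;> simp [h, indicatorEq]

end Codes

section Dual

variable {p : ℕ} [Fact p.Prime] {V : Type*} [AddCommGroup V] [Module (ZMod p) V] [Fintype V]
  {B : LinearMap.BilinForm (ZMod p) V} {s : ℕ} {f : V → ZMod p}

/-- Dual words are the linear relations between the vectors `(f x, x)`: test against `(a, b) = (1,
0)` and `(0, b)`, and use nondegeneracy. -/
theorem mem_dualCode_iff (hB : B.Nondegenerate) (c : {x : V // f x ≠ 0} → ZMod p) :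
    c ∈ dualCode (puncturedCode B f) ↔
      ∑ i, c i * f i.1 = 0 ∧ ∑ i, c i • i.1 = 0 := by
  constructor
  · intro h
    constructor
    · have := h _ ⟨1, 0, rfl⟩
      simpa [dotProduct] using this
    · refine hB.2 _ fun b => ?_
      have := h _ ⟨0, b, rfl⟩
      simpa [dotProduct] using this
  · rintro ⟨h1, h2⟩ _ ⟨a, b, rfl⟩
    have h3 : ∑ i, c i * B b i.1 = 0 := by
      have := congrArg (B b) h2
      simpa using this
    simp only [dotProduct, mul_add, Finset.sum_add_distrib, h3, add_zero]
    have h4 : ∑ i, c i * (a * f i.1) = a * ∑ i, c i * f i.1 := by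
      rw [Finset.mul_sum]
      exact Finset.sum_congr rfl fun i _ => by ring
    rw [h4, h1, mul_zero]

/-- Weight 1 is excluded by `f x ≠ 0`. Weight 2 gives `x = l y` and `f x = l f y` with `x ≠ y`;
homogeneity yields `l^t = l`, and `gcd (t - 1, p - 1) = 1` forces `l = 1`. -/
theorem three_le_hammingNorm_of_mem_dualCode (hp : p ≠ 2) (hB : B.Nondegenerate) (hBs : B.IsSymm)
    (hf : MemF B s f) {c : {x : V // f x ≠ 0} → ZMod p} (hc : c ∈ dualCode (puncturedCode B f))
    (hc0 : c ≠ 0) : 3 ≤ hammingNorm c := by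
  classical
  obtain ⟨h1, h2⟩ := (mem_dualCode_iff hB c).1 hc
  set T := Finset.univ.filter fun i => c i ≠ 0 with hT
  have hTc : ∀ i, i ∉ T → c i = 0 := fun i hi => by simpa [hT] using hi
  have hcard : hammingNorm c = T.card := by rw [hammingNorm]
  rw [← Finset.sum_subset (Finset.subset_univ T) fun i _ hi => by rw [hTc i hi, zero_mul]] at h1
  rw [← Finset.sum_subset (Finset.subset_univ T) fun i _ hi => by rw [hTc i hi, zero_smul]] at h2
  by_contra hlt
  have hpos : T.card ≠ 0 := by
    rw [← hcard]
    exact hammingNorm_ne_zero_iff.2 hc0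
  have h12 : T.card = 1 ∨ T.card = 2 := by omega
  rcases h12 with h | h
  · obtain ⟨i, hi⟩ := Finset.card_eq_one.1 h
    have hci : c i ≠ 0 := by
      have : i ∈ T := by rw [hi]; simp
      simpa [hT] using this
    rw [hi, Finset.sum_singleton] at h1
    exact mul_ne_zero hci i.2 h1
  · obtain ⟨i, j, hij, hTij⟩ := Finset.card_eq_two.1 h
    have hci : c i ≠ 0 := by
      have : i ∈ T := by rw [hTij]; simp
      simpa [hT] using this
    have hcj : c j ≠ 0 := by
      have : j ∈ T := by rw [hTij]; simp
      simpa [hT] using this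
    rw [hTij, Finset.sum_pair hij] at h1 h2
    obtain ⟨t, ht2, hg, ht⟩ := exists_isFormOn hp hB hBs hf j.1
    set l : ZMod p := -(c j / c i) with hl
    have hl0 : l ≠ 0 := neg_ne_zero.2 (div_ne_zero hcj hci)
    have hx : i.1 = l • j.1 := by
      have : c i • i.1 = -(c j • j.1) := eq_neg_of_add_eq_zero_left h2
      rw [hl, neg_smul, div_eq_inv_mul, mul_smul, ← smul_neg, ← this, smul_smul,
        inv_mul_cancel₀ hci, one_smul]
    have hfx : f i.1 = l * f j.1 := by
      have : c i * f i.1 = -(c j * f j.1) := eq_neg_of_add_eq_zero_left h1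
      apply mul_left_cancel₀ hci
      rw [this, hl]
      field_simp
    have h3 : l ^ (t - 1) = 1 := by
      have h4 := ht l hl0
      rw [← hx, hfx] at h4
      have h5 := mul_right_cancel₀ j.2 h4
      rw [show t = (t - 1) + 1 by omega, pow_succ] at h5
      exact (mul_right_cancel₀ hl0 (by rw [one_mul]; exact h5)).symm
    have h6 := eq_one_of_pow_eq_one_of_gcd hg hl0 h3
    rw [h6, one_smul] at hx
    exact hij (Subtype.ext hx)

/-- The points `i` and `j` may coincide: the nonzero coordinate at `l` alone keeps the word nonzero.
-/
theorem exists_mem_dualCode_of_relation (hB : B.Nondegenerate) (i j l : {x : V // f x ≠ 0})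
    (hil : i ≠ l) (hjl : j ≠ l) {a b d : ZMod p} (hd : d ≠ 0)
    (h1 : a * f i.1 + b * f j.1 + d * f l.1 = 0) (h2 : a • i.1 + b • j.1 + d • l.1 = 0) :
    ∃ c ∈ dualCode (puncturedCode B f), c ≠ 0 ∧ hammingNorm c ≤ 3 := by
  classical
  refine ⟨Pi.single i a + Pi.single j b + Pi.single l d, ?_, ?_, ?_⟩
  · rw [mem_dualCode_iff hB]
    constructor
    · simpa [add_mul, Finset.sum_add_distrib, Pi.single_apply, ite_mul] using h1
    · simpa [add_smul, Finset.sum_add_distrib, Pi.single_apply, ite_smul] using h2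
  · intro h
    have := congrFun h l
    simp [hil.symm, hjl.symm, hd] at this
  · rw [hammingNorm]
    refine (Finset.card_le_card (t := {i, j, l}) fun x hx => ?_).trans Finset.card_le_three
    by_contra hne
    simp only [Finset.mem_insert, Finset.mem_singleton, not_or] at hne
    refine (Finset.mem_filter.1 hx).2 ?_
    simp [hne.1, hne.2.1, hne.2.2]

theorem exists_dual_word_of_five_le (hp : p ≠ 2) (hp3 : p ≠ 3) (hB : B.Nondegenerate)
    (hBs : B.IsSymm) (hf : MemF B s f) (hne : ∃ x, f x ≠ 0) :
    ∃ c ∈ dualCode (puncturedCode B f), c ≠ 0 ∧ hammingNorm c ≤ 3 := by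
  obtain ⟨x, hx⟩ := hne
  have hx0 : x ≠ 0 := fun h => hx (by rw [h, hf.map_zero])
  have hp2' : (2 : ZMod p) ≠ 0 := Ring.two_ne_zero (by rwa [ZMod.ringChar_zmod_n])
  have hp3' : (3 : ZMod p) ≠ 0 := by
    intro h
    have h3 : ((3 : ℕ) : ZMod p) = 0 := by exact_mod_cast h
    rw [ZMod.natCast_eq_zero_iff] at h3
    exact hp3 ((Nat.prime_dvd_prime_iff_eq Fact.out Nat.prime_three).1 h3)
  obtain ⟨t, -, -, ht⟩ := exists_isFormOn hp hB hBs hf x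
  have h2x := ht 2 hp2'
  -- The points `x, -x, 2x` lie on a line and carry the `f`-values `f x, f x, 2^t f x`; the
  -- coefficients solve the resulting two linear equations. For `p ≥ 5` the point `2x` differs from
  -- `±x`.
  refine exists_mem_dualCode_of_relation hB ⟨x, hx⟩
    ⟨-x, by rwa [map_neg_eq hp hB hBs hf]⟩
    ⟨(2 : ZMod p) • x, by rw [h2x]; exact mul_ne_zero (pow_ne_zero _ hp2') hx⟩ ?_ ?_
    (a := 2 ^ t + 2) (b := 2 ^ t - 2) (d := -2) (neg_ne_zero.2 hp2') ?_ ?_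
  · intro h
    have h' : x = (2 : ZMod p) • x := congrArg Subtype.val h
    rw [two_smul, left_eq_add] at h'
    exact hx0 h'
  · intro h
    have h' : -x = (2 : ZMod p) • x := congrArg Subtype.val h
    have : (3 : ZMod p) • x = 0 := by
      rw [show (3 : ZMod p) = 2 + 1 by norm_num, add_smul, one_smul, ← h', neg_add_cancel]
    exact (smul_ne_zero hp3' hx0) this
  · simp only [map_neg_eq hp hB hBs hf, h2x]
    ring
  · simp only [smul_neg, smul_smul, ← neg_smul, ← add_smul]
    rw [show (2 ^ t + 2 + -(2 ^ t - 2) + -2 * 2 : ZMod p) = 0 by ring, zero_smul]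

theorem sq_eq_one_of_ne_zero (hp3 : p = 3) {a : ZMod p} (ha : a ≠ 0) : a * a = 1 := by
  have key : ∀ a : ZMod 3, a ≠ 0 → a * a = 1 := by decide
  subst hp3
  exact key a ha

theorem eq_zero_or_one_or_neg_one (hp3 : p = 3) (a : ZMod p) : a = 0 ∨ a = 1 ∨ a = -1 := by
  have key : ∀ a : ZMod 3, a = 0 ∨ a = 1 ∨ a = -1 := by decide
  subst hp3
  exact key a

/-- For `p = 3` a line through `0` has only the nonzero points `±x`, so a plane is needed. If `f` is
nonzero at `x`, `y` and `x + y`, replace each such `v` by `f(v) v`, which keeps the value `f v`. The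
relation `x + y - (x + y) = 0` then has values adding up to a sum of three squares, `1 + 1 + 1 = 0`.
-/
theorem exists_dual_word_of_eq_three (hp3 : p = 3) (hB : B.Nondegenerate)
    (hBs : B.IsSymm) (hf : MemF B s f) {n : ℕ} (hn : Module.finrank (ZMod p) V = n) (hn1 : 1 ≤ n)
    (hcard : p ^ (n - 1) + 1 < (Finset.univ.filter fun x => f x ≠ 0).card) :
    ∃ c ∈ dualCode (puncturedCode B f), c ≠ 0 ∧ hammingNorm c ≤ 3 := by
  classical
  have hp : p ≠ 2 := by omega
  have hneg := map_neg_eq hp hB hBs hf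
  set X := Finset.univ.filter fun x => f x ≠ 0 with hX
  have hmem : ∀ x, x ∈ X ↔ f x ≠ 0 := fun x => by simp [hX]
  obtain ⟨x, hxX⟩ : X.Nonempty := Finset.card_pos.1 (by omega)
  have hx := (hmem x).1 hxX
  have hone : (1 : ZMod p) + 1 + 1 = 0 := by
    have key : (1 : ZMod 3) + 1 + 1 = 0 := by decide
    subst hp3
    exact key
  -- a line of the plane spanned by `x` and `y` meets the support in three points
  by_cases hex : ∃ y, f y ≠ 0 ∧ y ≠ x ∧ y ≠ -x ∧ f (x + y) ≠ 0
  · obtain ⟨y, hy, hyx, hyx', hz⟩ := hex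
    have hsm : ∀ v, f v ≠ 0 → f (f v • v) = f v := by
      intro v hv
      rcases eq_zero_or_one_or_neg_one hp3 (f v) with h | h | h
      · exact absurd h hv
      · rw [h, one_smul, h]
      · rw [h, neg_smul, one_smul, hneg, h]
    have hsgn : ∀ v, f v ≠ 0 → f v • v = v ∨ f v • v = -v := by
      intro v hv
      rcases eq_zero_or_one_or_neg_one hp3 (f v) with h | h | h
      · exact absurd h hv
      · left; rw [h, one_smul]
      · right; rw [h, neg_smul, one_smul]
    have hx0 : x ≠ 0 := fun h => hx (by rw [h, hf.map_zero])
    have hy0 : y ≠ 0 := fun h => hy (by rw [h, hf.map_zero])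
    have h3 : ∀ v : V, v + v + v = 0 := by
      intro v
      rw [← one_smul (ZMod p) v, ← add_smul, ← add_smul, hone, zero_smul]
    have hsum : ∀ u v : V, v ≠ 0 → v ≠ u → u ≠ u + v ∧ u ≠ -(u + v) := by
      intro u v hv huv
      refine ⟨fun h => hv (left_eq_add.1 h), fun h => huv ?_⟩
      have h4 : u + u + v = 0 := by rw [add_assoc]; nth_rw 1 [h]; exact neg_add_cancel _
      exact add_left_cancel (h4.trans (h3 u).symm)
    obtain ⟨hxz, hxz'⟩ := hsum x y hy0 hyx
    obtain ⟨hyz, hyz'⟩ := hsum y x hx0 (Ne.symm hyx)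
    rw [add_comm y x] at hyz hyz'
    refine exists_mem_dualCode_of_relation hB ⟨f x • x, by rwa [hsm x hx]⟩
      ⟨f y • y, by rwa [hsm y hy]⟩ ⟨-(f (x + y) • (x + y)), by rwa [hneg, hsm _ hz]⟩ ?_ ?_
      (a := f x) (b := f y) (d := f (x + y)) hz ?_ ?_
    · intro h
      have h' : f x • x = -(f (x + y) • (x + y)) := congrArg Subtype.val h
      rcases hsgn x hx with e1 | e1 <;> rcases hsgn _ hz with e2 | e2 <;> rw [e1, e2] at h'
      · exact hxz' h'
      · exact hxz (by simpa using h')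
      · exact hxz (neg_inj.1 h')
      · exact hxz' (neg_inj.1 h')
    · intro h
      have h' : f y • y = -(f (x + y) • (x + y)) := congrArg Subtype.val h
      rcases hsgn y hy with e1 | e1 <;> rcases hsgn _ hz with e2 | e2 <;> rw [e1, e2] at h'
      · exact hyz' h'
      · exact hyz (by simpa using h')
      · exact hyz (neg_inj.1 h')
      · exact hyz' (neg_inj.1 h')
    · simp only [hneg, hsm x hx, hsm y hy, hsm _ hz, sq_eq_one_of_ne_zero hp3 hx,
        sq_eq_one_of_ne_zero hp3 hy, sq_eq_one_of_ne_zero hp3 hz, hone]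
    · simp only [smul_neg, smul_smul, sq_eq_one_of_ne_zero hp3 hx,
        sq_eq_one_of_ne_zero hp3 hy, sq_eq_one_of_ne_zero hp3 hz, one_smul, add_neg_cancel]
  · exfalso
    push Not at hex
    have hstep : ∀ y ∈ X.erase x, ∀ y' ∈ X.erase x, y' ≠ x + y := by
      intro y hy y' hy' h
      obtain ⟨hyx, hyX⟩ := Finset.mem_erase.1 hy
      have hy'0 := (hmem y').1 (Finset.mem_erase.1 hy').2
      rw [h] at hy'0
      by_cases hyn : y = -x
      · rw [hyn, add_neg_cancel, hf.map_zero] at hy'0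
        exact hy'0 rfl
      · exact hy'0 (hex y ((hmem y).1 hyX) hyx hyn)
    -- With no suitable `y`, the translates of the support without `x` by `0`, `x`, `-x` are
    -- disjoint. So three times its size is at most `3^n`, against `hcard`.
    have hinj : Set.InjOn (fun yc : V × ZMod p => yc.1 + yc.2 • x)
        ((X.erase x ×ˢ (Finset.univ : Finset (ZMod p)) : Finset _) : Set (V × ZMod p)) := by
      rintro ⟨y, c⟩ hy ⟨y', c'⟩ hy' h
      have hyX := (Finset.mem_product.1 (Finset.mem_coe.1 hy)).1
      have hyX' := (Finset.mem_product.1 (Finset.mem_coe.1 hy')).1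
      simp only at h hyX hyX'
      have hd : y' = y + (c - c') • x := by
        rw [sub_smul, ← add_sub_assoc, h, add_sub_cancel_right]
      rcases eq_zero_or_one_or_neg_one hp3 (c - c') with h0 | h0 | h0
      · rw [h0, zero_smul, add_zero] at hd
        rw [hd, sub_eq_zero.1 h0]
      · rw [h0, one_smul, add_comm] at hd
        exact absurd hd (hstep y hyX y' hyX')
      · rw [h0, neg_smul, one_smul] at hd
        exact absurd (by rw [hd]; abel) (hstep y' hyX' y hyX)
    have hle := Finset.card_le_card_of_injOn _ (fun _ _ => Finset.mem_univ _) hinj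
    rw [Finset.card_product, Finset.card_erase_of_mem hxX, Finset.card_univ, Finset.card_univ,
      ZMod.card, card_eq_pow_finrank (p := p), hn] at hle
    have h5 : p ^ n = p ^ (n - 1) * p := by rw [← pow_succ]; congr 1; omega
    rw [h5] at hle
    have := Nat.le_of_mul_le_mul_right hle (Fact.out : p.Prime).pos
    omega

theorem hasMinDist_dualCode (hp : p ≠ 2) (hB : B.Nondegenerate)
    (hBs : B.IsSymm) (hf : MemF B s f) {n : ℕ} (hn : Module.finrank (ZMod p) V = n) (hn1 : 1 ≤ n)
    (hcard : p ^ (n - 1) + 1 < (Finset.univ.filter fun x => f x ≠ 0).card) :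
    HasMinDist (dualCode (puncturedCode B f)) 3 := by
  refine hasMinDist_of_norm
    (fun c hc hc0 => three_le_hammingNorm_of_mem_dualCode hp hB hBs hf hc hc0) ?_
  by_cases hp3 : p = 3
  · exact exists_dual_word_of_eq_three hp3 hB hBs hf hn hn1 hcard
  · refine exists_dual_word_of_five_le hp hp3 hB hBs hf ?_
    obtain ⟨x, hx⟩ := Finset.card_pos.1 (lt_of_le_of_lt (Nat.zero_le _) hcard)
    exact ⟨x, (Finset.mem_filter.1 hx).2⟩

end Dual

end PlateauedCode

/-! ### Self-orthogonality -/

namespace PlateauedCode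

theorem sum_eq_zero_of_odd {p : ℕ} [Fact p.Prime] {V : Type*} [AddCommGroup V] [Fintype V]
    (hp : p ≠ 2) {u : V → ZMod p} (hu : ∀ x, u (-x) = -u x) : ∑ x, u x = 0 := by
  have h : ∑ x, u x = -∑ x, u x := by
    conv_lhs => rw [← Equiv.sum_comp (Equiv.neg V)]
    simp [hu]
  by_contra hne
  exact neg_ne_self hp hne h.symm

section SelfOrthogonal

variable {p : ℕ} [Fact p.Prime] {V : Type*} [AddCommGroup V] [Module (ZMod p) V] [Fintype V]
  {B : LinearMap.BilinForm (ZMod p) V} {s : ℕ} {f : V → ZMod p}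

/-- The bilinear form `(b, b') ↦ ∑_{f x ≠ 0} ⟨b, x⟩ ⟨b', x⟩`. -/
def supportForm (B : LinearMap.BilinForm (ZMod p) V) (f : V → ZMod p) (b b' : V) : ZMod p :=
  ∑ x ∈ Finset.univ.filter fun x => f x ≠ 0, B b x * B b' x

/-- Expanding a dot product of codewords, the mixed terms are sums of the odd functions `f x ⟨b, x⟩`
and vanish. -/
theorem isSelfOrthogonal_puncturedCode (hp : p ≠ 2) (hB : B.Nondegenerate) (hBs : B.IsSymm)
    (hf : MemF B s f) (h1 : ∑ x, f x * f x = 0) (h2 : ∀ b b', supportForm B f b b' = 0) :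
    IsSelfOrthogonal (puncturedCode B f) := by
  have hmix : ∀ b, ∑ x, f x * B b x = 0 := fun b =>
    sum_eq_zero_of_odd hp fun x => by rw [map_neg_eq hp hB hBs hf, map_neg, mul_neg]
  have hsum : ∀ u : V → ZMod p, ∑ i : {x : V // f x ≠ 0}, u i.1 =
      ∑ x ∈ Finset.univ.filter fun x => f x ≠ 0, u x := fun u =>
    (Finset.sum_subtype _ (fun x => by simp) u).symm
  have hfull : ∀ u : V → ZMod p, ∑ x ∈ Finset.univ.filter (fun x => f x ≠ 0), f x * u x =
      ∑ x, f x * u x := fun u =>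
    Finset.sum_subset (Finset.filter_subset _ _) fun x _ hx => by
      have : f x = 0 := by simpa using hx
      rw [this, zero_mul]
  rintro _ ⟨a, b, rfl⟩ _ ⟨a', b', rfl⟩
  rw [dotProduct, hsum fun x => (a * f x + B b x) * (a' * f x + B b' x)]
  have h3 : ∀ x, (a * f x + B b x) * (a' * f x + B b' x) = a * a' * (f x * f x) +
      a * (f x * B b' x) + a' * (f x * B b x) + B b x * B b' x := fun x => by ring
  simp only [h3, Finset.sum_add_distrib, ← Finset.mul_sum]
  rw [hfull, hfull, hfull, h1, hmix, hmix, ← supportForm, h2]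
  ring

/-- Every fibre of `f` has size divisible by `p`, as its expression through the Gauss vector shows,
and `f²` is constant on fibres. -/
theorem sum_mul_self_eq_zero (hp : p ≠ 2) (hB : B.Nondegenerate) (hBs : B.IsSymm)
    (hf : MemF B s f) {n : ℕ} (hn : Module.finrank (ZMod p) V = n) (hn2 : 2 ≤ n)
    (h3 : 3 ≤ n + s) : ∑ x, f x * f x = 0 := by
  obtain ⟨g, hg⟩ := exists_isGaussVector hp (Module.finrank (ZMod p) V + s)
  have hdvd : ∀ l, (p : ℤ) ∣ fiberCard Finset.univ f l := by
    intro l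
    have h := mul_fiberCard_eq hp hf.plateaued hg 0 l
    simp only [map_zero, LinearMap.zero_apply, sub_zero, dual_zero hp hB hBs hf] at h
    rw [hn] at hg h
    have e1 : (p : ℤ) ^ n = p * (p * (p : ℤ) ^ (n - 2)) := by
      rw [← pow_succ', ← pow_succ']; congr 1; omega
    have hp0 := natCast_prime_ne_zero (p := p)
    rcases Nat.even_or_odd (n + s) with hpar | hpar
    · obtain ⟨m, hm⟩ := hpar
      have e2 : (p : ℤ) ^ ((n + s) / 2) = p * (p * (p : ℤ) ^ ((n + s) / 2 - 2)) := by
        rw [← pow_succ', ← pow_succ']; congr 1; omega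
      rw [hg.sum_even ⟨m, hm⟩, hg.of_even ⟨m, hm⟩, e1, e2] at h
      refine ⟨(p : ℤ) ^ (n - 2) + eps B s f 0 *
        ((if l = 0 then p * (p : ℤ) ^ ((n + s) / 2 - 2) else 0) - (p : ℤ) ^ ((n + s) / 2 - 2)), ?_⟩
      apply mul_left_cancel₀ hp0
      rw [h]
      split_ifs <;> ring
    · obtain ⟨τ, -, hgo⟩ := hg.of_odd hpar
      have e2 : (p : ℤ) ^ ((n + s - 1) / 2) = p * (p : ℤ) ^ ((n + s - 3) / 2) := by
        rw [← pow_succ']; congr 1; omega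
      rw [hg.sum_odd hp hpar, hgo, e1, e2] at h
      refine ⟨(p : ℤ) ^ (n - 2) + eps B s f 0 *
        (τ * (p : ℤ) ^ ((n + s - 3) / 2) * quadraticChar (ZMod p) l), ?_⟩
      apply mul_left_cancel₀ hp0
      rw [h]
      ring
  rw [← Finset.sum_fiberwise Finset.univ f]
  refine Finset.sum_eq_zero fun l _ => ?_
  rw [Finset.sum_congr rfl fun x hx => by rw [(Finset.mem_filter.1 hx).2], Finset.sum_const,
    nsmul_eq_mul]
  have := (ZMod.intCast_zmod_eq_zero_iff_dvd _ p).2 (hdvd l)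
  rw [fiberCard, Int.cast_natCast] at this
  rw [this, zero_mul]

/-- The substitution `x ↦ 2x` preserves the support of `f` and multiplies the form by 4, so three
times the form is zero. -/
theorem supportForm_eq_zero_of_ne_three (hp : p ≠ 2) (hp3 : p ≠ 3) (hB : B.Nondegenerate)
    (hBs : B.IsSymm) (hf : MemF B s f) (b b' : V) : supportForm B f b b' = 0 := by
  have hp2' : (2 : ZMod p) ≠ 0 := Ring.two_ne_zero (by rwa [ZMod.ringChar_zmod_n])
  have hp3' : (3 : ZMod p) ≠ 0 := by
    intro h
    have h3 : ((3 : ℕ) : ZMod p) = 0 := by exact_mod_cast h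
    rw [ZMod.natCast_eq_zero_iff] at h3
    exact hp3 ((Nat.prime_dvd_prime_iff_eq Fact.out Nat.prime_three).1 h3)
  have hf2 : ∀ x, f ((2 : ZMod p) • x) = 0 ↔ f x = 0 := fun x => by
    obtain ⟨t, -, -, ht⟩ := exists_isFormOn hp hB hBs hf x
    rw [ht 2 hp2', mul_eq_zero, or_iff_right (pow_ne_zero _ hp2')]
  have h : supportForm B f b b' = 4 * supportForm B f b b' := by
    conv_lhs => rw [supportForm, Finset.sum_filter,
      ← Equiv.sum_comp (MulAction.toPerm (Units.mk0 (2 : ZMod p) hp2'))]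
    rw [supportForm, Finset.mul_sum, Finset.sum_filter]
    refine Finset.sum_congr rfl fun x _ => ?_
    simp only [MulAction.toPerm_apply, Units.smul_mk0, map_smul, smul_eq_mul, ne_eq, hf2]
    congr 1
    ring
  exact (mul_eq_zero.1 (show 3 * supportForm B f b b' = 0 by linear_combination -h)).resolve_left
    hp3'

/-- Nonzero squares in `𝔽₃` are `1`, so the diagonal value at `b` is the weight of the codeword `(0,
b)` mod 3. That weight is divisible by 3, and polarization gives the rest. -/
theorem supportForm_eq_zero_of_eq_three (hp3 : p = 3) (hB : B.Nondegenerate)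
    (hBs : B.IsSymm) (hf : MemF B s f) {n : ℕ} (hn : Module.finrank (ZMod p) V = n) (hn3 : 3 ≤ n)
    {e : V → ℤ} (he : ∀ b, solCard B f b = (p : ℤ) ^ (n - 1) + p * e b) (hpe : ∀ b, (p : ℤ) ∣ e b)
    (b b' : V) : supportForm B f b b' = 0 := by
  have hp : p ≠ 2 := by omega
  have hp2' : (2 : ZMod p) ≠ 0 := Ring.two_ne_zero (by rwa [ZMod.ringChar_zmod_n])
  have hdiag : ∀ b, supportForm B f b b = 0 := by
    intro b
    by_cases hb : b = 0
    · simp [supportForm, hb]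
    have h1 : supportForm B f b b = (codeWeight B f 0 b : ZMod p) := by
      rw [supportForm, codeWeight, Int.cast_natCast, ← Finset.sum_boole, Finset.sum_filter]
      refine Finset.sum_congr rfl fun x _ => ?_
      by_cases hx : B b x = 0
      · simp [hx]
      · simp [hx, sq_eq_one_of_ne_zero hp3 hx]
    rw [h1, ZMod.intCast_zmod_eq_zero_iff_dvd,
      codeWeight_zero_left hp hB hBs hf hn (by omega) he hb]
    exact dvd_add (Dvd.dvd.mul_left (dvd_pow_self _ (by omega)) _)
      (Dvd.dvd.mul_left (dvd_sub (hpe b) (hpe 0)) _)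
  have hpol : supportForm B f (b + b') (b + b') =
      supportForm B f b b + supportForm B f b' b' + 2 * supportForm B f b b' := by
    simp only [supportForm, Finset.mul_sum, ← Finset.sum_add_distrib]
    refine Finset.sum_congr rfl fun x _ => ?_
    rw [map_add, LinearMap.add_apply]
    ring
  rw [hdiag, hdiag, hdiag, add_zero, zero_add] at hpol
  exact (mul_eq_zero.1 hpol.symm).resolve_left hp2'

end SelfOrthogonal

end PlateauedCode

/-! ### Verification of the weight tables -/

namespace PlateauedCode

section Tables

variable {p : ℕ} [Fact p.Prime] {V : Type*} [AddCommGroup V] [Module (ZMod p) V] [Fintype V]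
  {B : LinearMap.BilinForm (ZMod p) V} {s : ℕ} {f : V → ZMod p} {n : ℕ} {e : V → ℤ}

theorem hasWeightTable_tableOdd (hp : p ≠ 2) (hB : B.Nondegenerate) (hBs : B.IsSymm)
    (hf : MemF B s f) (hn : Module.finrank (ZMod p) V = n) (hn2 : 2 ≤ n) (h1 : s + 1 ≤ n)
    (he : ∀ b, solCard B f b = (p : ℤ) ^ (n - 1) + p * e b)
    (h : ∀ (a : ZMod p) (b : V), a ≠ 0 ∨ b ≠ 0 → codeWeight B f a b ≠ 0) (he0 : e 0 = 0)
    (hφ : ∀ φ : ℤ → ℚ, ∑ b, φ (e b) =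
        ((p : ℚ) ^ n - (p : ℚ) ^ (n - s) + (p : ℚ) ^ (n - s - 1)) * φ 0 +
        ((p : ℚ) - 1) / 2 * ((p : ℚ) ^ (n - s - 1) + (p : ℚ) ^ ((n - s - 1) / 2)) *
          φ ((p : ℤ) ^ ((n + s - 3) / 2)) +
        ((p : ℚ) - 1) / 2 * ((p : ℚ) ^ (n - s - 1) - (p : ℚ) ^ ((n - s - 1) / 2)) *
          φ (-(p : ℤ) ^ ((n + s - 3) / 2))) :
    HasWeightTable (puncturedCode B f) (tableOdd p n s) := by
  intro w
  have s0 := hφ fun t => indicatorEq w ((p - 1) ^ 2 * (p : ℤ) ^ (n - 2) + (p - 1) * (t - e 0))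
  have s1 := hφ fun t => indicatorEq w ((p - 1) ^ 2 * (p : ℤ) ^ (n - 2) - (p - 1) * e 0 - t)
  beta_reduce at s0 s1
  rw [ncard_weight_eq hp hB hBs hf hn hn2 he h w _ _ rfl rfl,
    table_sum_eq]
  rw [s0, s1, he0]
  have e1 : (p : ℤ) ^ (n - 1) = p * (p : ℤ) ^ (n - 2) := pow_pred_mul (n := n - 1) (by omega)
  have e2 : (p : ℚ) ^ (n - s) = p * (p : ℚ) ^ (n - s - 1) := by
    rw [← pow_succ']; congr 1; omega
  simp only [tableOdd, List.map_cons, List.map_nil, List.sum_cons, List.sum_nil, pow_succ _ n,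
    pow_succ _ (n - s), e1, e2]
  -- Once the powers are independent variables, both sides are combinations of indicators whose
  -- arguments agree after normalization.
  generalize (p : ℤ) ^ (n - 2) = q
  generalize (p : ℤ) ^ ((n + s - 3) / 2) = P
  generalize (p : ℚ) ^ (n - s - 1) = r
  generalize (p : ℚ) ^ ((n - s - 1) / 2) = d
  ring_nf

theorem hasWeightTable_tableEvenPlus (hp : p ≠ 2) (hB : B.Nondegenerate) (hBs : B.IsSymm)
    (hf : MemF B s f) (hn : Module.finrank (ZMod p) V = n) (hpar : Even (n + s)) (h2 : s + 2 ≤ n)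
    (h4 : 4 ≤ n + s)
    (he : ∀ b, solCard B f b = (p : ℤ) ^ (n - 1) + p * e b)
    (h : ∀ (a : ZMod p) (b : V), a ≠ 0 ∨ b ≠ 0 → codeWeight B f a b ≠ 0)
    (he0 : e 0 = (p - 1) * (p : ℤ) ^ ((n + s) / 2 - 2)) {k : ℕ} {A A' : ℤ}
    (hA : p * A = k + (p - 1) * (p : ℤ) ^ ((n - s) / 2)) (hA' : p * A' = (p : ℤ) ^ (n - s) - k)
    (hφ : ∀ φ : ℤ → ℚ, ∑ b, φ (e b) = ((p : ℚ) ^ n - (p : ℚ) ^ (n - s)) * φ 0 +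
        A * φ ((p - 1) * (p : ℤ) ^ ((n + s) / 2 - 2)) + (k - A) * φ (-(p : ℤ) ^ ((n + s) / 2 - 2)) +
        A' * φ (-((p - 1) * (p : ℤ) ^ ((n + s) / 2 - 2))) +
        ((p : ℚ) ^ (n - s) - k - A') * φ ((p : ℤ) ^ ((n + s) / 2 - 2))) :
    HasWeightTable (puncturedCode B f) (tableEvenPlus p n s k) := by
  intro w
  have s0 := hφ fun t => indicatorEq w ((p - 1) ^ 2 * (p : ℤ) ^ (n - 2) + (p - 1) * (t - e 0))
  have s1 := hφ fun t => indicatorEq w ((p - 1) ^ 2 * (p : ℤ) ^ (n - 2) - (p - 1) * e 0 - t)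
  beta_reduce at s0 s1
  rw [ncard_weight_eq hp hB hBs hf hn (by omega) he h w _ _ rfl rfl,
    table_sum_eq]
  rw [s0, s1, he0]
  obtain ⟨m, hm⟩ := hpar
  have e1 : (p : ℤ) ^ (n - 1) = p * (p : ℤ) ^ (n - 2) := pow_pred_mul (n := n - 1) (by omega)
  have e2 : (p : ℚ) ^ (n - s) = p * (p : ℚ) ^ (n - s - 1) := by
    rw [← pow_succ']; congr 1; omega
  have e3 : (p : ℚ) ^ ((n - s) / 2) = p * (p : ℚ) ^ ((n - s) / 2 - 1) := by
    rw [← pow_succ']; congr 1; omega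
  have e4 : (p : ℤ) ^ ((n + s) / 2 - 1) = p * (p : ℤ) ^ ((n + s) / 2 - 2) := by
    rw [← pow_succ']; congr 1; omega
  have hp0 : (p : ℚ) ≠ 0 := by exact_mod_cast (Fact.out : p.Prime).ne_zero
  -- The tables contain `k / p`; working with `κ = k / p` removes all denominators.
  obtain ⟨κ, hκ⟩ : ∃ κ : ℚ, (k : ℚ) = p * κ := ⟨k / p, by field_simp⟩
  have hAq : (p : ℚ) * A = k + (p - 1) * (p : ℚ) ^ ((n - s) / 2) := by exact_mod_cast hA
  have hAq' : (p : ℚ) * A' = (p : ℚ) ^ (n - s) - k := by exact_mod_cast hA'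
  rw [hκ, e3] at hAq
  rw [hκ, e2] at hAq'
  replace hAq : (A : ℚ) = κ + (p - 1) * (p : ℚ) ^ ((n - s) / 2 - 1) :=
    mul_left_cancel₀ hp0 (by linear_combination hAq)
  replace hAq' : (A' : ℚ) = (p : ℚ) ^ (n - s - 1) - κ :=
    mul_left_cancel₀ hp0 (by linear_combination hAq')
  simp only [tableEvenPlus, List.map_cons, List.map_nil, List.sum_cons, List.sum_nil,
    pow_succ _ n, pow_succ _ (n - s), e1, e2, e4, hAq, hAq', hκ, mul_div_assoc,
    mul_div_cancel_left₀ _ hp0]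
  generalize (p : ℤ) ^ (n - 2) = q
  generalize (p : ℤ) ^ ((n + s) / 2 - 2) = P
  generalize (p : ℚ) ^ (n - s - 1) = r
  generalize (p : ℚ) ^ ((n - s) / 2 - 1) = d
  ring_nf

theorem hasWeightTable_tableEvenMinus (hp : p ≠ 2) (hB : B.Nondegenerate) (hBs : B.IsSymm)
    (hf : MemF B s f) (hn : Module.finrank (ZMod p) V = n) (hpar : Even (n + s)) (h2 : s + 2 ≤ n)
    (h4 : 4 ≤ n + s)
    (he : ∀ b, solCard B f b = (p : ℤ) ^ (n - 1) + p * e b)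
    (h : ∀ (a : ZMod p) (b : V), a ≠ 0 ∨ b ≠ 0 → codeWeight B f a b ≠ 0)
    (he0 : e 0 = -((p - 1) * (p : ℤ) ^ ((n + s) / 2 - 2))) {k : ℕ} {A A' : ℤ}
    (hA : p * A = k)
    (hA' : p * A' = (p : ℤ) ^ (n - s) - k - (p - 1) * (p : ℤ) ^ ((n - s) / 2))
    (hφ : ∀ φ : ℤ → ℚ, ∑ b, φ (e b) = ((p : ℚ) ^ n - (p : ℚ) ^ (n - s)) * φ 0 +
        A * φ ((p - 1) * (p : ℤ) ^ ((n + s) / 2 - 2)) + (k - A) * φ (-(p : ℤ) ^ ((n + s) / 2 - 2)) +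
        A' * φ (-((p - 1) * (p : ℤ) ^ ((n + s) / 2 - 2))) +
        ((p : ℚ) ^ (n - s) - k - A') * φ ((p : ℤ) ^ ((n + s) / 2 - 2))) :
    HasWeightTable (puncturedCode B f) (tableEvenMinus p n s k) := by
  intro w
  have s0 := hφ fun t => indicatorEq w ((p - 1) ^ 2 * (p : ℤ) ^ (n - 2) + (p - 1) * (t - e 0))
  have s1 := hφ fun t => indicatorEq w ((p - 1) ^ 2 * (p : ℤ) ^ (n - 2) - (p - 1) * e 0 - t)
  beta_reduce at s0 s1
  rw [ncard_weight_eq hp hB hBs hf hn (by omega) he h w _ _ rfl rfl,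
    table_sum_eq]
  rw [s0, s1, he0]
  obtain ⟨m, hm⟩ := hpar
  have e1 : (p : ℤ) ^ (n - 1) = p * (p : ℤ) ^ (n - 2) := pow_pred_mul (n := n - 1) (by omega)
  have e2 : (p : ℚ) ^ (n - s) = p * (p : ℚ) ^ (n - s - 1) := by
    rw [← pow_succ']; congr 1; omega
  have e3 : (p : ℚ) ^ ((n - s) / 2) = p * (p : ℚ) ^ ((n - s) / 2 - 1) := by
    rw [← pow_succ']; congr 1; omega
  have e4 : (p : ℤ) ^ ((n + s) / 2 - 1) = p * (p : ℤ) ^ ((n + s) / 2 - 2) := by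
    rw [← pow_succ']; congr 1; omega
  have hp0 : (p : ℚ) ≠ 0 := by exact_mod_cast (Fact.out : p.Prime).ne_zero
  have hκ : (k : ℚ) = p * A := by exact_mod_cast hA.symm
  have hAq' : (p : ℚ) * A' = (p : ℚ) ^ (n - s) - k - (p - 1) * (p : ℚ) ^ ((n - s) / 2) := by
    exact_mod_cast hA'
  rw [hκ, e2, e3] at hAq'
  replace hAq' : (A' : ℚ) = (p : ℚ) ^ (n - s - 1) - A - (p - 1) * (p : ℚ) ^ ((n - s) / 2 - 1) :=
    mul_left_cancel₀ hp0 (by linear_combination hAq')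
  simp only [tableEvenMinus, List.map_cons, List.map_nil, List.sum_cons, List.sum_nil,
    pow_succ _ n, pow_succ _ (n - s), e1, e2, e4, hAq', hκ, mul_div_assoc,
    mul_div_cancel_left₀ _ hp0]
  generalize (p : ℤ) ^ (n - 2) = q
  generalize (p : ℤ) ^ ((n + s) / 2 - 2) = P
  generalize (p : ℚ) ^ (n - s - 1) = r
  generalize (p : ℚ) ^ ((n - s) / 2 - 1) = d
  ring_nf

end Tables

end PlateauedCode

/-! ### Code parameters and the final assembly -/

namespace PlateauedCode

section Parameters

variable {p : ℕ} [Fact p.Prime] {V : Type*} [AddCommGroup V] [Module (ZMod p) V] [Fintype V]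
  {B : LinearMap.BilinForm (ZMod p) V} {s : ℕ} {f : V → ZMod p} {n : ℕ} {e : V → ℤ}

theorem natCast_card_support (hn : Module.finrank (ZMod p) V = n) (hn1 : 1 ≤ n)
    (he : ∀ b, solCard B f b = (p : ℤ) ^ (n - 1) + p * e b) :
    ((Finset.univ.filter fun x => f x ≠ 0).card : ℤ) = (p - 1) * (p : ℤ) ^ (n - 1) - p * e 0 := by
  rw [card_support (B := B) hn, he, show (p : ℤ) ^ n = p * (p : ℤ) ^ (n - 1) from pow_pred_mul hn1]
  ring

theorem hasParams_puncturedCode (hn : Module.finrank (ZMod p) V = n) (hn1 : 1 ≤ n)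
    (he : ∀ b, solCard B f b = (p : ℤ) ^ (n - 1) + p * e b)
    (h : ∀ (a : ZMod p) (b : V), a ≠ 0 ∨ b ≠ 0 → codeWeight B f a b ≠ 0) {m : ℤ}
    (hm : (p - 1) * (p : ℤ) ^ (n - 1) - p * e 0 = m) :
    HasParams (puncturedCode B f) m (n + 1) := by
  constructor
  · rw [← hm, ← natCast_card_support hn hn1 he, Fintype.card_subtype]
  · rw [finrank_puncturedCode hn h]
    push_cast
    rfl

theorem HasParams.dualCode {F : Type*} [Field F] {ι : Type*} [Fintype ι]
    {C : Submodule F (ι → F)} {m k : ℤ} (h : HasParams C m k) :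
    HasParams (dualCode C) m (m - k) :=
  ⟨h.1, by rw [finrank_dualCode, h.1, h.2]⟩

/-- The support has `(p - 1) p^(n-1) - p e_0` points, and `he0` says that this exceeds `p^(n-1) +
1`. -/
theorem hasMinDist_dualCode_of_excess (hp : p ≠ 2) (hB : B.Nondegenerate)
    (hBs : B.IsSymm) (hf : MemF B s f) (hn : Module.finrank (ZMod p) V = n) (hn2 : 2 ≤ n)
    (he : ∀ b, solCard B f b = (p : ℤ) ^ (n - 1) + p * e b)
    (he0 : p * e 0 + 1 < (p - 2) * (p : ℤ) ^ (n - 1)) :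
    HasMinDist (dualCode (puncturedCode B f)) 3 := by
  refine hasMinDist_dualCode hp hB hBs hf hn (by omega) ?_
  have h := natCast_card_support hn (by omega) he
  zify
  rw [h]
  linarith

theorem isSelfOrthogonal_of_excess (hp : p ≠ 2) (hB : B.Nondegenerate)
    (hBs : B.IsSymm) (hf : MemF B s f) (hn : Module.finrank (ZMod p) V = n) (hn2 : 2 ≤ n)
    (hns : 3 ≤ n + s) (he : ∀ b, solCard B f b = (p : ℤ) ^ (n - 1) + p * e b)
    (hpe : p = 3 → 3 ≤ n ∧ ∀ b, (p : ℤ) ∣ e b) :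
    IsSelfOrthogonal (puncturedCode B f) := by
  refine isSelfOrthogonal_puncturedCode hp hB hBs hf
    (sum_mul_self_eq_zero hp hB hBs hf hn hn2 hns) fun b b' => ?_
  by_cases hp3 : p = 3
  · exact supportForm_eq_zero_of_eq_three hp3 hB hBs hf hn (hpe hp3).1 he (hpe hp3).2 b b'
  · exact supportForm_eq_zero_of_ne_three hp hp3 hB hBs hf b b'

end Parameters

end PlateauedCode

theorem theorem2 {p : ℕ} [Fact p.Prime] (hp : p ≠ 2)
    {V : Type*} [AddCommGroup V] [Module (ZMod p) V] [Fintype V]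
    (B : LinearMap.BilinForm (ZMod p) V) (hB : B.Nondegenerate) (hBs : B.IsSymm)
    (n s k : ℕ) (hn : Module.finrank (ZMod p) V = n)
    (heven : Even (n + s) → s + 2 ≤ n ∧ 4 ≤ n + s)
    (hodd : Odd (n + s) → s + 1 ≤ n ∧ 3 ≤ n + s)
    (f : V → ZMod p) (hf : MemF B s f) (hk : (Bplus B s f).ncard = k) :
    (Even (n + s) →
      -- `0` is in the Walsh support, so that the sign `ε₀` is defined
      (0 ∈ Bplus B s f ∨ 0 ∈ Bminus B s f) ∧
      HasParams (puncturedCode B f)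
        (((p : ℤ) - 1) * ((p : ℤ) ^ (n - 1) - eps B s f 0 * (p : ℤ) ^ ((n + s) / 2 - 1)))
        ((n : ℤ) + 1) ∧
      (0 ∈ Bplus B s f → HasWeightTable (puncturedCode B f) (tableEvenPlus p n s k)) ∧
      (0 ∈ Bminus B s f → HasWeightTable (puncturedCode B f) (tableEvenMinus p n s k)) ∧
      HasParams (dualCode (puncturedCode B f))
        (((p : ℤ) - 1) * ((p : ℤ) ^ (n - 1) - eps B s f 0 * (p : ℤ) ^ ((n + s) / 2 - 1)))
        (((p : ℤ) - 1) * ((p : ℤ) ^ (n - 1) - eps B s f 0 * (p : ℤ) ^ ((n + s) / 2 - 1))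
          - (n : ℤ) - 1)) ∧
    (Odd (n + s) →
      HasParams (puncturedCode B f) (((p : ℤ) - 1) * (p : ℤ) ^ (n - 1)) ((n : ℤ) + 1) ∧
      HasWeightTable (puncturedCode B f) (tableOdd p n s) ∧
      HasParams (dualCode (puncturedCode B f)) (((p : ℤ) - 1) * (p : ℤ) ^ (n - 1))
        (((p : ℤ) - 1) * (p : ℤ) ^ (n - 1) - (n : ℤ) - 1)) ∧
    HasMinDist (dualCode (puncturedCode B f)) 3 ∧
    ((p ≠ 3 ∨ 5 ≤ n + s) → IsSelfOrthogonal (puncturedCode B f)) := by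
  have hp3 : (3 : ℤ) ≤ p := by
    have := (Fact.out : p.Prime).two_le
    exact_mod_cast (show 3 ≤ p by omega)
  rcases Nat.even_or_odd (n + s) with hpar | hpar
  · obtain ⟨h2, h4⟩ := heven hpar
    have hpar2 := Nat.even_iff.1 hpar
    obtain ⟨e, δ, A, A', hδ1, hδ0, hA, hA', he, he0, hle, hdvd, hφ⟩ :=
      exists_excess_even hp hB hBs hf hn hpar h2 h4 hk
    have hh : 1 ≤ (p : ℤ) ^ ((n + s) / 2 - 2) := one_le_pow₀ (by linarith)
    -- Here `s + 2 ≤ n` enters, as `(n + s) / 2 ≤ n - 1`.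
    have hhq : (p : ℤ) * (p : ℤ) ^ ((n + s) / 2 - 2) ≤ (p : ℤ) ^ (n - 2) := by
      rw [← pow_succ']
      exact pow_le_pow_right₀ (by linarith) (by omega)
    have hq1 : (p : ℤ) ^ (n - 1) = p * (p : ℤ) ^ (n - 2) := pow_pred_mul (n := n - 1) (by omega)
    have hp4 : (p : ℤ) ^ ((n + s) / 2 - 1) = p * (p : ℤ) ^ ((n + s) / 2 - 2) := by
      rw [← pow_succ']; congr 1; omega
    have hm : (p - 1) * (p : ℤ) ^ (n - 1) - p * e 0 =
        ((p : ℤ) - 1) * ((p : ℤ) ^ (n - 1) - eps B s f 0 * (p : ℤ) ^ ((n + s) / 2 - 1)) := by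
      rw [he0, hp4]; ring
    have hb := fun b => abs_le.1 (hle b)
    set q := (p : ℤ) ^ (n - 2)
    set X := (p - 1) * (p : ℤ) ^ ((n + s) / 2 - 2) with hX
    have hX0 : 0 < X := mul_pos (by linarith) (by linarith)
    have hX3 : 3 * X ≤ p * X := mul_le_mul_of_nonneg_right hp3 hX0.le
    have hXq : p * X ≤ (p - 1) * q := by
      rw [hX, mul_left_comm]
      exact mul_le_mul_of_nonneg_left hhq (by linarith)
    have hqp : 2 * ((p - 1) * q) ≤ (p - 1) ^ 2 * q := by
      rw [sq, mul_assoc]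
      exact mul_le_mul_of_nonneg_right (by linarith) (by linarith)
    -- With `|e b| ≤ X`, one has `e 0 - e b ≤ 2X < 3X ≤ (p - 1) q` and `(p - 1) e 0 + e b ≤ pX ≤ (p
    -- - 1) q < (p - 1)² q`.
    have hcw : ∀ (a : ZMod p) (b : V), a ≠ 0 ∨ b ≠ 0 → codeWeight B f a b ≠ 0 := fun a b =>
      codeWeight_ne_zero hp hB hBs hf hn (by omega) he
        (fun b => by linarith [(hb b).1, (hb 0).2])
        (fun b => by
          have := mul_le_mul_of_nonneg_left (hb 0).2 (show (0 : ℤ) ≤ p - 1 by linarith)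
          linarith [(hb b).2])
    have hpar1 := hasParams_puncturedCode hn (by omega) he hcw hm
    refine ⟨fun _ => ⟨mem_Bplus_or_mem_Bminus hp (zero_mem_walshSupport hp hB hBs hf), hpar1,
      fun h0 => ?_, fun h0 => ?_, ?_⟩, fun h => absurd hpar (Nat.not_even_iff_odd.2 h), ?_,
      fun hor => ?_⟩
    · rw [eps_of_mem_Bplus h0, one_mul] at he0
      rw [hδ1 h0, one_mul] at hA
      rw [hδ1 h0, sub_self, zero_mul, add_zero] at hA'
      exact hasWeightTable_tableEvenPlus hp hB hBs hf hn hpar h2 h4 he hcw he0 hA hA' hφ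
    · rw [eps_of_mem_Bminus h0, neg_one_mul] at he0
      rw [hδ0 h0, zero_mul, add_zero] at hA
      rw [hδ0 h0, zero_sub, neg_one_mul, ← sub_eq_add_neg] at hA'
      exact hasWeightTable_tableEvenMinus hp hB hBs hf hn hpar h2 h4 he hcw he0 hA hA' hφ
    · rw [sub_sub _ (n : ℤ) 1]
      exact hpar1.dualCode
    · refine hasMinDist_dualCode_of_excess hp hB hBs hf hn (by omega) he ?_
      have h5 := mul_le_mul_of_nonneg_left (hb 0).2 (show (0 : ℤ) ≤ p by linarith)
      have h6 : 3 * 1 ≤ p * q := mul_le_mul hp3 (by linarith) (by norm_num) (by linarith)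
      have h7 : 1 * (p * q) ≤ (p - 2) * (p * q) :=
        mul_le_mul_of_nonneg_right (by linarith) (by linarith)
      rw [hq1]
      linarith
    · exact isSelfOrthogonal_of_excess hp hB hBs hf hn (by omega) (by omega) he fun hp3' =>
        ⟨by omega, hdvd (hor.resolve_left (not_not.2 hp3'))⟩
  · obtain ⟨h1, h3⟩ := hodd hpar
    have hpar2 := Nat.odd_iff.1 hpar
    obtain ⟨e, he, he0, hle, hdvd, hφ⟩ := exists_excess_odd hp hB hBs hf hn hpar h1 h3
    -- Here `s + 1 ≤ n` enters, as `n + s - 3 ≤ 2 (n - 2)`.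
    have hP : (p : ℤ) ^ ((n + s - 3) / 2) ≤ (p : ℤ) ^ (n - 2) :=
      pow_le_pow_right₀ (by linarith) (by omega)
    have hq0 : 1 ≤ (p : ℤ) ^ (n - 2) := one_le_pow₀ (by linarith)
    have hq1 : (p : ℤ) ^ (n - 1) = p * (p : ℤ) ^ (n - 2) := pow_pred_mul (n := n - 1) (by omega)
    have hm : (p - 1) * (p : ℤ) ^ (n - 1) - p * e 0 = ((p : ℤ) - 1) * (p : ℤ) ^ (n - 1) := by
      rw [he0, mul_zero, sub_zero]
    have hb := fun b => abs_le.1 (hle b)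
    set q := (p : ℤ) ^ (n - 2)
    have hq2 : 2 * q ≤ (p - 1) * q := mul_le_mul_of_nonneg_right (by linarith) (by linarith)
    have hqp : 2 * ((p - 1) * q) ≤ (p - 1) ^ 2 * q := by
      rw [sq, mul_assoc]
      exact mul_le_mul_of_nonneg_right (by linarith) (by linarith)
    have hcw : ∀ (a : ZMod p) (b : V), a ≠ 0 ∨ b ≠ 0 → codeWeight B f a b ≠ 0 := fun a b =>
      codeWeight_ne_zero hp hB hBs hf hn (by omega) he
        (fun b => by rw [he0]; linarith [(hb b).1]) (fun b => by rw [he0]; linarith [(hb b).2])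
    have hpar1 := hasParams_puncturedCode hn (by omega) he hcw hm
    refine ⟨fun h => absurd hpar (Nat.not_odd_iff_even.2 h), fun _ => ⟨hpar1, ?_, ?_⟩, ?_,
      fun hor => ?_⟩
    · exact hasWeightTable_tableOdd hp hB hBs hf hn (by omega) h1 he hcw he0 hφ
    · rw [sub_sub _ (n : ℤ) 1]
      exact hpar1.dualCode
    · refine hasMinDist_dualCode_of_excess hp hB hBs hf hn (by omega) he ?_
      have h6 : 3 * 1 ≤ p * q := mul_le_mul hp3 hq0 (by norm_num) (by linarith)
      have h7 : 1 * (p * q) ≤ (p - 2) * (p * q) :=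
        mul_le_mul_of_nonneg_right (by linarith) (by linarith)
      rw [he0, hq1]
      linarith
    · exact isSelfOrthogonal_of_excess hp hB hBs hf hn (by omega) h3 he fun hp3' =>
        have h5 := hor.resolve_left (not_not.2 hp3')
        ⟨by omega, hdvd h5⟩
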